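/- Let $d_x,d_y\ge 1$, and let $(X_1,Y_1),(X_2,Y_2),\dots$ be i.i.d. random vectors in $\mathbb R^{d_x}\times\mathbb R^{d_y}$ with joint probability density $f(x,y)$ with respect to Lebesgue measure. Let $f_X(x)=\int f(x,y)\,dy$ and $f_Y(y)=\int f(x,y)\,dx$ be the marginal densities, and $f_{Y|X}(y|x)=f(x,y)/f_X(x)$, $f_{X|Y}(x|y)=f(x,y)/f_Y(y)$ the conditional densities. Assume that (a) $\int f(x,y)\,|\log f(x,y)|\,dx\,dy<\infty$; (b) there is a finite constant $C'$ such that $f_{Y|X}(y|x)<C'$ and $f_{X|Y}(x|y)<C'$ for almost every $(x,y)$; (c) $f$ is twice continuously differentiable on $\mathbb R^{d_x+d_y}$ and there is a finite constant $C$ such that its Hessian matrix satisfies $\|H_f(x,y)\|_2<C$ (spectral norm) for almost every $(x,y)$. Let $I(X;Y)=H(X)+H(Y)-H(X,Y)$, where $H(X)=-\int f_X\log f_X$, $H(Y)=-\int f_Y\log f_Y$ and $H(X,Y)=-\int f\log f$. Fix an integer $k>\max\{d_x/d_y,\,d_y/d_x\}$. For $N>k$, $p\in\{2,\infty\}$ and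 $1\le i\le N$, let $\rho_{k,i,p}$ be the $\ell_p$ distance in $\mathbb R^{d_x+d_y}$ from $(X_i,Y_i)$ to its $k$-th nearest neighbour among the other points $(X_j,Y_j)$, $j\le N$, $j\ne i$; let $n_{x,i,p}$ be the number of $j\le N$, $j\neq i$, with $\|X_j-X_i\|_p\le\rho_{k,i,p}$, and $n_{y,i,p}$ the number of $j\le N$, $j\ne i$, with $\|Y_j-Y_i\|_p\le\rho_{k,i,p}$. With $\psi=\Gamma'/\Gamma$ the digamma function and $c_{d,2}=\pi^{d/2}/\Gamma(d/2+1)$ the volume of the Euclidean unit ball of $\mathbb R^d$, define $$\widehat I_{\rm KSG}(X;Y)=\psi(k)+\log N-\frac1N\sum_{i=1}^N\bigl(\psi(n_{x,i,\infty}+1)+\psi(n_{y,i,\infty}+1)\bigr),$$ $$\widehat I_{\rm BI\text{-}KSG}(X;Y)=\psi(k)+\log N+\log\Bigl(\frac{c_{d_x,2}\,c_{d_y,2}}{c_{d_x+d_y,2}}\Bigr)-\frac1N\sum_{i=1}^N\bigl(\log n_{x,i,2}+\log n_{y,i,2}\bigr).$$ Then the integrals defining $H(X)$ and $H(Y)$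 converge absolutely, so that $I(X;Y)$ is a well-defined real number, and for every $\varepsilon>0$ $$\lim_{N\to\infty}\mathbb P\bigl(|\widehat I_{\rm KSG}(X;Y)-I(X;Y)|>\varepsilon\bigr)=0\quad\text{and}\quad\lim_{N\to\infty}\mathbb P\bigl(|\widehat I_{\rm BI\text{-}KSG}(X;Y)-I(X;Y)|>\varepsilon\bigr)=0.$$ -/

import Mathlib

open MeasureTheory ProbabilityTheory Filter Topology
open scoped ENNReal

noncomputable section

namespace KSG

/-- The digamma function `ψ = Γ' / Γ` at a real argument. -/
def digamma (x : ℝ) : ℝ := (Complex.digamma (x : ℂ)).re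

/-- The `ℓ_p` norm on `ℝ^ι` (`p = 2` is the Euclidean norm, `p = ⊤` the maximum norm). -/
def vecNorm {ι : Type*} [Fintype ι] (p : ℝ≥0∞) (v : ι → ℝ) : ℝ := ‖WithLp.toLp p v‖

/-- The volume `π^(d/2) / Γ(d/2 + 1)` of the unit `ℓ_2` ball of `ℝ^d`. -/
def unitBallVol (d : ℕ) : ℝ := Real.pi ^ ((d : ℝ) / 2) / Real.Gamma ((d : ℝ) / 2 + 1)

section Estimators

variable {dx dy N : ℕ}

/-- The `ℓ_p` distance in `ℝ^(dx+dy)` between the sample points `(x j, y j)` and `(x i, y i)`. -/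
def jointDist (p : ℝ≥0∞) (x : Fin N → Fin dx → ℝ) (y : Fin N → Fin dy → ℝ) (i j : Fin N) : ℝ :=
  vecNorm p (Sum.elim (x j - x i) (y j - y i))

/-- `ρ_{k,i,p}`: the `ℓ_p` distance from the `i`-th sample point to its `k`-th nearest neighbour
among the other sample points, i.e. the least `r ≥ 0` such that at least `k` other sample points
lie within distance `r` (meaningful for `N > k`). -/
def knnDist (p : ℝ≥0∞) (k : ℕ) (x : Fin N → Fin dx → ℝ) (y : Fin N → Fin dy → ℝ)
    (i : Fin N) : ℝ :=
  sInf {r : ℝ | 0 ≤ r ∧ k ≤ {j : Fin N | j ≠ i ∧ jointDist p x y i j ≤ r}.ncard}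

/-- `n_{x,i,p}`: the number of `j ≠ i` with `‖x j - x i‖_p ≤ ρ_{k,i,p}`. -/
def nX (p : ℝ≥0∞) (k : ℕ) (x : Fin N → Fin dx → ℝ) (y : Fin N → Fin dy → ℝ)
    (i : Fin N) : ℕ :=
  {j : Fin N | j ≠ i ∧ vecNorm p (x j - x i) ≤ knnDist p k x y i}.ncard

/-- `n_{y,i,p}`: the number of `j ≠ i` with `‖y j - y i‖_p ≤ ρ_{k,i,p}`. -/
def nY (p : ℝ≥0∞) (k : ℕ) (x : Fin N → Fin dx → ℝ) (y : Fin N → Fin dy → ℝ)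
    (i : Fin N) : ℕ :=
  {j : Fin N | j ≠ i ∧ vecNorm p (y j - y i) ≤ knnDist p k x y i}.ncard

/-- The KSG estimator of mutual information from the samples `(x i, y i)`, `i < N`. -/
def ksgEstimator (k : ℕ) (x : Fin N → Fin dx → ℝ) (y : Fin N → Fin dy → ℝ) : ℝ :=
  digamma k + Real.log N
    - 1 / (N : ℝ) * ∑ i, (digamma (nX ⊤ k x y i + 1) + digamma (nY ⊤ k x y i + 1))

/-- The bias-improved KSG estimator of mutual information from the samples `(x i, y i)`,
`i < N`. -/
def biKsgEstimator (k : ℕ) (x : Fin N → Fin dx → ℝ) (y : Fin N → Fin dy → ℝ) : ℝ :=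
  digamma k + Real.log N
    + Real.log (unitBallVol dx * unitBallVol dy / unitBallVol (dx + dy))
    - 1 / (N : ℝ) * ∑ i, (Real.log (nX 2 k x y i) + Real.log (nY 2 k x y i))

end Estimators

section Densities

variable {dx dy : ℕ}

/-- The differential entropy `-∫ g log g` of a density `g` (with `0 log 0 = 0`). -/
def diffEntropy {E : Type*} [MeasureSpace E] (g : E → ℝ) : ℝ := -∫ z, g z * Real.log (g z)

/-- The marginal density `f_X(x) = ∫ f(x,y) dy`. -/
def marginalX (f : (Fin dx → ℝ) × (Fin dy → ℝ) → ℝ) (x : Fin dx → ℝ) : ℝ := ∫ y, f (x, y)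

/-- The marginal density `f_Y(y) = ∫ f(x,y) dx`. -/
def marginalY (f : (Fin dx → ℝ) × (Fin dy → ℝ) → ℝ) (y : Fin dy → ℝ) : ℝ := ∫ x, f (x, y)

/-- The conditional density `f_{Y|X}(y|x) = f(x,y) / f_X(x)`. -/
def condYX (f : (Fin dx → ℝ) × (Fin dy → ℝ) → ℝ) (x : Fin dx → ℝ) (y : Fin dy → ℝ) : ℝ :=
  f (x, y) / marginalX f x

/-- The conditional density `f_{X|Y}(x|y) = f(x,y) / f_Y(y)`. -/
def condXY (f : (Fin dx → ℝ) × (Fin dy → ℝ) → ℝ) (x : Fin dx → ℝ) (y : Fin dy → ℝ) : ℝ :=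
  f (x, y) / marginalY f y

/-- The mutual information `I(X;Y) = H(X) + H(Y) - H(X,Y)` of a pair with joint density `f`. -/
def mutualInfo (f : (Fin dx → ℝ) × (Fin dy → ℝ) → ℝ) : ℝ :=
  diffEntropy (marginalX f) + diffEntropy (marginalY f) - diffEntropy f

/-- The standard basis of `ℝ^dx × ℝ^dy`, indexed by its `dx + dy` coordinates. -/
def stdBasis : Fin dx ⊕ Fin dy → (Fin dx → ℝ) × (Fin dy → ℝ)
  | Sum.inl i => (Pi.single i 1, 0)
  | Sum.inr j => (0, Pi.single j 1)

/-- The Hessian matrix `(∂_a ∂_b f)(z)` of `f` at `z`. -/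
def hessian (f : (Fin dx → ℝ) × (Fin dy → ℝ) → ℝ) (z : (Fin dx → ℝ) × (Fin dy → ℝ)) :
    Matrix (Fin dx ⊕ Fin dy) (Fin dx ⊕ Fin dy) ℝ :=
  Matrix.of fun a b => fderiv ℝ (fun w => fderiv ℝ f w (stdBasis b)) z (stdBasis a)

/-- The spectral norm `‖A‖_2` of a square matrix. -/
def matNorm {ι : Type*} [Fintype ι] [DecidableEq ι] (A : Matrix ι ι ℝ) : ℝ :=
  ‖Matrix.toEuclideanCLM (n := ι) (𝕜 := ℝ) A‖

end Densities

end KSG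

end

/-! Write d = dx + dy and let c, cx, cy be the volumes of the unit balls of the joint and marginal
norms. Around a point z with f(z) > 0, the radius at level s is the r with N c f(z) r^d = e^s. At a
Lebesgue point the number of other samples in the joint ball of that radius is asymptotically
Poisson with mean e^s. Hence the k-th neighbour lies beyond level s with limiting probability
P(Poisson(e^s) < k) = P(Gamma_k > e^s). The marginal balls of the same radius have mean counts close
to N f_X cx r^dx and N f_Y cy r^dy. These diverge, so the counts concentrate, and the product of the
means is N (f_X f_Y / f)(cx cy / c) e^s. Counts are monotone in the radius, so log(nx ny / N) -
log(f_X f_Y / f) - log(cx cy / c) converges in law to the logarithm of a Gamma variable of shape k,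
whose mean is ψ(k).

The mean of log(f_X f_Y / f) under f is -I(X;Y), so the averages of log(nx ny / N) should tend to
ψ(k) - I + log(cx cy / c); this is the claim for BI-KSG. For the maximum norm the last logarithm
vanishes, and replacing log n by ψ(n+1) costs at most 1/n, where n tends to infinity in probability;
this gives KSG.

Passing from laws to averages takes two further facts.

Asymptotic pairwise independence: two distinct centres have eventually disjoint balls, and the
trinomial law of the two counts tends to a product of Poisson laws (`tendsto_far_pair`).

Uniform integrability: given its centre z, the event |log(nx ny / N)| > t has probability at most
min(1, A (1 + 1/f(z))^(d+2) e^(-ηt)) (`tail_bound`). A power of 1/f need not be integrable, but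
integrating in t leaves only log(1 + A (1 + 1/f)^(d+2)), which is integrable by the entropy
assumption (`integrableOn_tail`, `exists_tail`). The conditional bounds give f ≤ C f_X and f ≤ C
f_Y, hence upper bounds on all masses and a comparison of marginal with joint mass. The Hessian
bound gives semiconvexity, hence a joint ball has mass at least half of f(z) times its volume while
K r^2 ≤ f(z). When this inequality fails, N is bounded polynomially in 1/f(z) and the trivial bound
1 suffices.

`tendsto_integral_average` turns these facts into a weak law in L¹, and the centring terms obey the
strong law. -/

noncomputable section

namespace KSG

/-! ### Counting sample points in sets -/

section Counting

variable {E Ω : Type*} [MeasurableSpace Ω]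

variable [MeasurableSpace E] in
/-- The sequence `Z` is i.i.d. with law `μ` under `P`. -/
structure IsIID (Z : ℕ → Ω → E) (μ : Measure E) (P : Measure Ω) : Prop where
  measurable : ∀ n, Measurable (Z n)
  indep : iIndepFun Z P
  map_eq : ∀ n, P.map (Z n) = μ

/-- The restriction of a sample to the indices in `S`. -/
def restrictSample (Z : ℕ → Ω → E) (S : Finset ℕ) (ω : Ω) : S → E := fun j => Z j ω

open scoped Classical in
/-- The number of sample points in `B`. -/
def cnt (S : Finset ℕ) (B : Set E) (w : S → E) : ℕ :=
  (Finset.univ.filter (fun j : S => w j ∈ B)).card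

lemma cnt_eq_sum (S : Finset ℕ) (B : Set E) (w : S → E) :
    (cnt S B w : ℝ) = ∑ j : S, B.indicator 1 (w j) := by
  classical
  simp [cnt, Set.indicator_apply]

lemma cnt_mono (S : Finset ℕ) {B B' : Set E} (h : B ⊆ B') (w : S → E) :
    cnt S B w ≤ cnt S B' w := by
  classical
  unfold cnt
  refine Finset.card_le_card fun j hj => ?_
  simp only [Finset.mem_filter, Finset.mem_univ, true_and] at hj ⊢
  exact h hj

variable [MeasurableSpace E]

/-- Joint measurability in the centre and the sample is what permits conditioning on the centre by
Fubini. -/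
lemma measurable_cnt {C : Type*} [MeasurableSpace C] (S : Finset ℕ) {B : C → Set E}
    (hB : MeasurableSet {q : C × E | q.2 ∈ B q.1}) :
    Measurable fun q : C × (S → E) => (cnt S (B q.1) q.2 : ℝ) := by
  simp_rw [cnt_eq_sum]
  refine Finset.measurable_sum _ fun j _ => ?_
  have : (fun q : C × (S → E) => (B q.1).indicator (1 : E → ℝ) (q.2 j)) =
      ({q : C × E | q.2 ∈ B q.1}.indicator 1) ∘ fun q : C × (S → E) => (q.1, q.2 j) := by
    ext q
    classical
    simp [Set.indicator_apply]
  rw [this]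
  refine (measurable_one.indicator hB).comp ?_
  fun_prop

lemma measurable_cnt_nat {C : Type*} [MeasurableSpace C] (S : Finset ℕ) {B : C → Set E}
    (hB : MeasurableSet {q : C × E | q.2 ∈ B q.1}) :
    Measurable fun q : C × (S → E) => cnt S (B q.1) q.2 := by
  refine measurable_to_countable' fun n => ?_
  have := measurable_cnt S hB (measurableSet_singleton (n : ℝ))
  convert this using 1
  ext q
  simp

variable {Z : ℕ → Ω → E} {μ : Measure E} {P : Measure Ω}

lemma IsIID.measurable_restrictSample (h : IsIID Z μ P) (S : Finset ℕ) :
    Measurable (restrictSample Z S) :=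
  measurable_pi_lambda _ fun j => h.measurable j

lemma IsIID.isProbabilityMeasure [IsProbabilityMeasure P] (h : IsIID Z μ P) :
    IsProbabilityMeasure μ := by
  rw [← h.map_eq 0]
  exact Measure.isProbabilityMeasure_map (h.measurable 0).aemeasurable

lemma IsIID.measureReal_mem (h : IsIID Z μ P) (n : ℕ) {B : Set E} (hB : MeasurableSet B) :
    P.real {ω | Z n ω ∈ B} = μ.real B := by
  rw [← h.map_eq n, map_measureReal_apply (h.measurable n) hB]
  rfl

variable [IsProbabilityMeasure P]

lemma IsIID.integral_indicator (h : IsIID Z μ P) (n : ℕ) {B : Set E} (hB : MeasurableSet B) :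
    ∫ ω, B.indicator (1 : E → ℝ) (Z n ω) ∂P = μ.real B := by
  rw [← h.measureReal_mem n hB]
  have : (fun ω => B.indicator (1 : E → ℝ) (Z n ω)) = (Z n ⁻¹' B).indicator 1 := by
    ext ω
    classical
    simp [Set.indicator_apply]
  rw [this, integral_indicator_one (h.measurable n hB)]
  rfl

lemma IsIID.memLp_indicator (h : IsIID Z μ P) (n : ℕ) {B : Set E} (hB : MeasurableSet B)
    (p : ℝ≥0∞) : MemLp (fun ω => B.indicator (1 : E → ℝ) (Z n ω)) p P := by
  refine MemLp.of_bound
    ((measurable_one.indicator hB).comp (h.measurable n)).aestronglyMeasurable 1 (ae_of_all _ ?_)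
  intro ω
  classical
  simp only [Set.indicator_apply]
  split_ifs <;> simp

lemma IsIID.integral_cnt (h : IsIID Z μ P) (S : Finset ℕ) {B : Set E} (hB : MeasurableSet B) :
    ∫ ω, (cnt S B (restrictSample Z S ω) : ℝ) ∂P = S.card * μ.real B := by
  simp_rw [cnt_eq_sum]
  rw [integral_finsetSum]
  · simp [restrictSample, h.integral_indicator _ hB]
  · exact fun j _ => (h.memLp_indicator j hB 1).integrable le_rfl

lemma IsIID.memLp_cnt (h : IsIID Z μ P) (S : Finset ℕ) {B : Set E} (hB : MeasurableSet B) :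
    MemLp (fun ω => (cnt S B (restrictSample Z S ω) : ℝ)) 2 P := by
  simp_rw [cnt_eq_sum]
  exact memLp_finsetSum _ fun j _ => h.memLp_indicator j hB 2

/-- Independence makes the variances of the indicators add, and the variance of an indicator is at
most its second moment, which is its mean. -/
lemma IsIID.variance_cnt_le (h : IsIID Z μ P) (S : Finset ℕ) {B : Set E} (hB : MeasurableSet B) :
    variance (fun ω => (cnt S B (restrictSample Z S ω) : ℝ)) P ≤ S.card * μ.real B := by
  have e : (fun ω => (cnt S B (restrictSample Z S ω) : ℝ)) =
      ∑ j ∈ S, fun ω => B.indicator (1 : E → ℝ) (Z j ω) := by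
    ext ω
    rw [cnt_eq_sum, Finset.sum_apply, ← Finset.sum_coe_sort S]
    rfl
  rw [e, IndepFun.variance_sum]
  · calc _ ≤ ∑ _j ∈ S, μ.real B := by
          refine Finset.sum_le_sum fun j _ => ?_
          refine (variance_le_expectation_sq
            ((measurable_one.indicator hB).comp (h.measurable j)).aestronglyMeasurable).trans ?_
          rw [← h.integral_indicator j hB]
          refine le_of_eq (integral_congr_ae (ae_of_all _ fun ω => ?_))
          classical
          simp only [Pi.pow_apply, Function.comp, Set.indicator_apply]
          split_ifs <;> simp
      _ = _ := by simp
  · exact fun j _ => h.memLp_indicator j hB 2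
  · intro i _ j _ hij
    exact (h.indep.indepFun hij).comp (measurable_one.indicator hB) (measurable_one.indicator hB)

lemma IsIID.markov_cnt (h : IsIID Z μ P) (S : Finset ℕ) {B : Set E} (hB : MeasurableSet B)
    {m : ℝ} (hm : 0 < m) :
    P.real {ω | m ≤ cnt S B (restrictSample Z S ω)} ≤ S.card * μ.real B / m := by
  rw [le_div_iff₀ hm, mul_comm, ← h.integral_cnt S hB]
  exact mul_meas_ge_le_integral_of_nonneg (ae_of_all _ fun ω => by positivity)
    ((h.memLp_cnt S hB).integrable one_le_two) m

lemma IsIID.chebyshev_cnt (h : IsIID Z μ P) (S : Finset ℕ) {B : Set E} (hB : MeasurableSet B)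
    {ε : ℝ} (hε : 0 < ε) (hp : 0 < S.card * μ.real B) :
    P.real {ω | ε * (S.card * μ.real B) ≤
      |cnt S B (restrictSample Z S ω) - S.card * μ.real B|} ≤
      1 / (ε ^ 2 * (S.card * μ.real B)) := by
  have := meas_ge_le_variance_div_sq (h.memLp_cnt S hB) (mul_pos hε hp)
  rw [h.integral_cnt S hB] at this
  calc _ ≤ variance (fun ω => (cnt S B (restrictSample Z S ω) : ℝ)) P /
        (ε * (S.card * μ.real B)) ^ 2 := by
        refine ENNReal.toReal_le_of_le_ofReal (by have := variance_nonneg (fun ω => (cnt S B (restrictSample Z S ω) : ℝ)) P; positivity) this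
    _ ≤ S.card * μ.real B / (ε * (S.card * μ.real B)) ^ 2 := by
        gcongr
        exact h.variance_cnt_le S hB
    _ = _ := by field_simp

/-- The lower tail of a count with mean `m`. -/
lemma IsIID.cnt_le_half (h : IsIID Z μ P) (S : Finset ℕ) {B : Set E} (hB : MeasurableSet B)
    (hp : 0 < S.card * μ.real B) :
    P.real {ω | (cnt S B (restrictSample Z S ω) : ℝ) ≤ S.card * μ.real B / 2} ≤
      4 / (S.card * μ.real B) := by
  have := h.chebyshev_cnt S hB (half_pos one_pos) hp
  refine (measureReal_mono fun ω hω => ?_).trans (this.trans (le_of_eq (by field_simp; norm_num)))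
  simp only [Set.mem_ofPred_eq] at hω ⊢
  rw [le_abs]
  right
  linarith

/-- Conditioning on an independent random element. -/
lemma measureReal_eq_integral_of_indepFun {C R : Type*} [MeasurableSpace C] [MeasurableSpace R]
    {W : Ω → C} {V : Ω → R} (hW : Measurable W) (hV : Measurable V) (hi : IndepFun W V P)
    {A : Set (C × R)} (hA : MeasurableSet A) :
    P.real {ω | (W ω, V ω) ∈ A} = ∫ w, P.real {ω | (w, V ω) ∈ A} ∂(P.map W) := by
  have h1 := (indepFun_iff_map_prod_eq_prod_map_map hW.aemeasurable hV.aemeasurable).1 hi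
  have hp : IsProbabilityMeasure (P.map V) := Measure.isProbabilityMeasure_map hV.aemeasurable
  have hp' : IsProbabilityMeasure (P.map W) := Measure.isProbabilityMeasure_map hW.aemeasurable
  have h2 : P {ω | (W ω, V ω) ∈ A} = ∫⁻ w, P {ω | (w, V ω) ∈ A} ∂(P.map W) := by
    have h3 : P {ω | (W ω, V ω) ∈ A} = (P.map (fun ω => (W ω, V ω))) A := by
      rw [Measure.map_apply (hW.prodMk hV) hA]; rfl
    rw [h3, h1, Measure.prod_apply hA]
    refine lintegral_congr fun w => ?_
    rw [Measure.map_apply hV (measurable_prodMk_left hA)]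
    rfl
  have h4 : Measurable fun w => P {ω | (w, V ω) ∈ A} := by
    have := measurable_measure_prodMk_left (ν := P.map V) hA
    convert this using 1
    ext w
    rw [Measure.map_apply hV (measurable_prodMk_left hA)]
    rfl
  simp only [Measure.real]
  rw [h2, integral_toReal h4.aemeasurable (ae_of_all _ fun w => measure_lt_top _ _)]

lemma measurable_measureReal_frozen {C R : Type*} [MeasurableSpace C] [MeasurableSpace R]
    {V : Ω → R} (hV : Measurable V) {A : Set (C × R)} (hA : MeasurableSet A) :
    Measurable fun w => P.real {ω | (w, V ω) ∈ A} := by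
  have hp : IsProbabilityMeasure (P.map V) := Measure.isProbabilityMeasure_map hV.aemeasurable
  have := (measurable_measure_prodMk_left (ν := P.map V) hA).ennreal_toReal
  convert this using 1
  ext w
  rw [Measure.map_apply hV (measurable_prodMk_left hA)]
  rfl

/-- Conditioning on one sample point. -/
lemma IsIID.freeze_one (h : IsIID Z μ P) {i : ℕ} {S : Finset ℕ} (hi : i ∉ S)
    {A : Set (E × (S → E))} (hA : MeasurableSet A) :
    P.real {ω | (Z i ω, restrictSample Z S ω) ∈ A} =
      ∫ z, P.real {ω | (z, restrictSample Z S ω) ∈ A} ∂μ := by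
  rw [← h.map_eq i]
  refine measureReal_eq_integral_of_indepFun (h.measurable i) (h.measurable_restrictSample S) ?_ hA
  have := h.indep.indepFun_finset {i} S (by simpa using hi) (fun n => h.measurable n)
  exact this.comp (φ := fun w : (({i} : Finset ℕ) → E) => w ⟨i, by simp⟩) (ψ := id)
    (by fun_prop) measurable_id

/-- Conditioning on two sample points. -/
lemma IsIID.freeze_two (h : IsIID Z μ P) {i j : ℕ} {S : Finset ℕ} (hij : i ≠ j) (hi : i ∉ S)
    (hj : j ∉ S) {A : Set ((E × E) × (S → E))} (hA : MeasurableSet A) :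
    P.real {ω | ((Z i ω, Z j ω), restrictSample Z S ω) ∈ A} =
      ∫ z, P.real {ω | (z, restrictSample Z S ω) ∈ A} ∂(μ.prod μ) := by
  have e : P.map (fun ω => (Z i ω, Z j ω)) = μ.prod μ := by
    rw [(indepFun_iff_map_prod_eq_prod_map_map (h.measurable i).aemeasurable
      (h.measurable j).aemeasurable).1 (h.indep.indepFun hij), h.map_eq, h.map_eq]
  rw [← e]
  refine measureReal_eq_integral_of_indepFun ((h.measurable i).prodMk (h.measurable j))
    (h.measurable_restrictSample S) ?_ hA
  have := h.indep.indepFun_finset {i, j} S (by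
    rw [Finset.disjoint_left]; intro a ha; simp at ha; rcases ha with rfl | rfl <;> assumption)
    (fun n => h.measurable n)
  exact this.comp (φ := fun w : (({i, j} : Finset ℕ) → E) => (w ⟨i, by simp⟩, w ⟨j, by simp⟩)) (ψ := id)
    (by fun_prop) measurable_id

end Counting

/-! ### Trinomial counts, their Poisson limit, and concentration of large counts -/

section Trinomial

variable {E Ω : Type*} [MeasurableSpace Ω]

open scoped Classical in
lemma cnt_restrictSample (Z : ℕ → Ω → E) (S : Finset ℕ) (B : Set E) (ω : Ω) :
    cnt S B (restrictSample Z S ω) = (S.filter (fun j => Z j ω ∈ B)).card := by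
  have : ((cnt S B (restrictSample Z S ω) : ℕ) : ℝ) = (S.filter (fun j => Z j ω ∈ B)).card := by
    rw [cnt_eq_sum]
    have := Finset.sum_coe_sort S (fun j => B.indicator (1 : E → ℝ) (Z j ω))
    simp only [restrictSample]
    rw [this]
    simp [Set.indicator_apply]
  exact_mod_cast this

variable [MeasurableSpace E] {Z : ℕ → Ω → E} {μ : Measure E} {P : Measure Ω}
  [IsProbabilityMeasure P]

open scoped Classical in
-- The event splits according to which indices fall in `B` and which in `B'`. Each such pattern is
-- an intersection of independent events, and all patterns have the same probability.
lemma IsIID.measureReal_cnt_eq (h : IsIID Z μ P) (S : Finset ℕ) {B B' : Set E}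
    (hB : MeasurableSet B) (hB' : MeasurableSet B') (hd : Disjoint B B') (a b : ℕ) :
    P.real {ω | cnt S B (restrictSample Z S ω) = a ∧ cnt S B' (restrictSample Z S ω) = b} =
      (S.card.choose a) * ((S.card - a).choose b) * (μ.real B ^ a * μ.real B' ^ b *
        (1 - μ.real B - μ.real B') ^ (S.card - a - b)) := by
  have hμ := h.isProbabilityMeasure
  -- The set prescribed for the `j`-th point when `A` and `A'` are the index sets landing in `B` and
  -- `B'`.
  let cell : Finset ℕ → Finset ℕ → ℕ → Set E := fun A A' j =>
    if j ∈ A then B else if j ∈ A' then B' else (B ∪ B')ᶜ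
  have hcell : ∀ A A' j, MeasurableSet (cell A A' j) := by
    intro A A' j
    simp only [cell]
    split_ifs
    exacts [hB, hB', (hB.union hB').compl]
  let T : Finset ((_ : Finset ℕ) × Finset ℕ) :=
    (S.powersetCard a).sigma fun A => (S \ A).powersetCard b
  let pat : ((_ : Finset ℕ) × Finset ℕ) → Set Ω := fun t =>
    ⋂ j ∈ S, Z j ⁻¹' (cell t.1 t.2 j)
  have hpat_m : ∀ t, MeasurableSet (pat t) := fun t =>
    Finset.measurableSet_biInter _ fun j _ => h.measurable j (hcell _ _ _)
  have hpat : ∀ t ∈ T, ∀ ω ∈ pat t, S.filter (fun j => Z j ω ∈ B) = t.1 ∧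
      S.filter (fun j => Z j ω ∈ B') = t.2 := by
    rintro ⟨A, A'⟩ ht ω hω
    simp only [T, Finset.mem_sigma, Finset.mem_powersetCard] at ht
    obtain ⟨⟨hA, -⟩, hA', -⟩ := ht
    simp only [pat, Set.mem_iInter, Set.mem_preimage, cell] at hω
    have hne : ∀ x, x ∈ B → x ∉ B' := fun x hx hx' => Set.disjoint_left.1 hd hx hx'
    constructor
    · ext j
      simp only [Finset.mem_filter]
      constructor
      · rintro ⟨hj, hjB⟩
        by_contra hjA
        have := hω j hj
        rw [if_neg hjA] at this
        split_ifs at this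
        · exact hne _ hjB this
        · exact this (Or.inl hjB)
      · intro hj
        have := hω j (hA hj)
        rw [if_pos hj] at this
        exact ⟨hA hj, this⟩
    · ext j
      simp only [Finset.mem_filter]
      constructor
      · rintro ⟨hj, hjB⟩
        by_contra hjA
        have := hω j hj
        rw [if_neg hjA] at this
        split_ifs at this
        · exact hne _ this hjB
        · exact this (Or.inr hjB)
      · intro hj
        have h1 := Finset.mem_sdiff.1 (hA' hj)
        have := hω j h1.1
        rw [if_neg h1.2, if_pos hj] at this
        exact ⟨h1.1, this⟩
  have hunion : {ω | cnt S B (restrictSample Z S ω) = a ∧ cnt S B' (restrictSample Z S ω) = b} =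
      ⋃ t ∈ T, pat t := by
    ext ω
    simp only [cnt_restrictSample, Set.mem_ofPred_eq, Set.mem_iUnion, exists_prop]
    constructor
    · rintro ⟨ha, hb⟩
      refine ⟨⟨S.filter (fun j => Z j ω ∈ B), S.filter (fun j => Z j ω ∈ B')⟩, ?_, ?_⟩
      · simp only [T, Finset.mem_sigma, Finset.mem_powersetCard]
        refine ⟨⟨Finset.filter_subset _ _, ha⟩, ?_, hb⟩
        intro j hj
        rw [Finset.mem_filter] at hj
        rw [Finset.mem_sdiff, Finset.mem_filter]
        exact ⟨hj.1, fun h' => Set.disjoint_left.1 hd h'.2 hj.2⟩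
      · simp only [pat, Set.mem_iInter, Set.mem_preimage, cell, Finset.mem_filter]
        intro j hj
        split_ifs with h1 h2
        · exact h1.2
        · exact h2.2
        · rintro (h' | h')
          exacts [h1 ⟨hj, h'⟩, h2 ⟨hj, h'⟩]
    · rintro ⟨t, ht, hω⟩
      obtain ⟨h1, h2⟩ := hpat t ht ω hω
      rw [h1, h2]
      simp only [T, Finset.mem_sigma, Finset.mem_powersetCard] at ht
      exact ⟨ht.1.2, ht.2.2⟩
  have hdis : (T : Set _).PairwiseDisjoint pat := by
    intro t ht t' ht' hne
    rw [Function.onFun, Set.disjoint_left]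
    intro ω h1 h2
    obtain ⟨e1, e2⟩ := hpat t ht ω h1
    obtain ⟨e3, e4⟩ := hpat t' ht' ω h2
    obtain ⟨x, y⟩ := t
    obtain ⟨x', y'⟩ := t'
    simp only at e1 e2 e3 e4
    exact hne (by rw [← e1, ← e2, ← e3, ← e4])
  have hval : ∀ t ∈ T, P.real (pat t) = μ.real B ^ a * μ.real B' ^ b *
        (1 - μ.real B - μ.real B') ^ (S.card - a - b) := by
    rintro ⟨A, A'⟩ ht
    simp only [T, Finset.mem_sigma, Finset.mem_powersetCard] at ht
    obtain ⟨⟨hA, hAc⟩, hA', hAc'⟩ := ht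
    have h1 : P.real (pat ⟨A, A'⟩) = ∏ j ∈ S, μ.real (cell A A' j) := by
      rw [Measure.real, h.indep.measure_inter_preimage_eq_mul S (fun j _ => hcell A A' j),
        ENNReal.toReal_prod]
      refine Finset.prod_congr rfl fun j _ => ?_
      exact h.measureReal_mem j (hcell _ _ _)
    have hr : μ.real (B ∪ B')ᶜ = 1 - μ.real B - μ.real B' := by
      rw [probReal_compl_eq_one_sub (hB.union hB'), measureReal_union hd hB']
      ring
    rw [h1, ← Finset.prod_sdiff hA, ← Finset.prod_sdiff hA']
    have e1 : ∏ j ∈ A, μ.real (cell A A' j) = μ.real B ^ a := by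
      rw [← hAc, ← Finset.prod_const]
      exact Finset.prod_congr rfl fun j hj => by simp [cell, hj]
    have e2 : ∏ j ∈ A', μ.real (cell A A' j) = μ.real B' ^ b := by
      rw [← hAc', ← Finset.prod_const]
      exact Finset.prod_congr rfl fun j hj => by
        have := (Finset.mem_sdiff.1 (hA' hj)).2
        simp [cell, hj, this]
    have e3 : ∏ j ∈ (S \ A) \ A', μ.real (cell A A' j) =
        (1 - μ.real B - μ.real B') ^ (S.card - a - b) := by
      have : S.card - a - b = ((S \ A) \ A').card := by
        rw [Finset.card_sdiff_of_subset hA', Finset.card_sdiff_of_subset hA, hAc, hAc']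
      rw [this, ← Finset.prod_const]
      refine Finset.prod_congr rfl fun j hj => ?_
      simp only [Finset.mem_sdiff] at hj
      simp only [cell, if_neg hj.1.2, if_neg hj.2, hr]
    rw [e1, e2, e3]
    ring
  rw [hunion, measureReal_biUnion_finset hdis (fun t _ => hpat_m t), Finset.sum_congr rfl hval,
    Finset.sum_const, nsmul_eq_mul]
  congr 1
  rw [Finset.card_sigma, Finset.sum_congr rfl (g := fun _ => (S.card - a).choose b)]
  · simp
  · intro A hA
    rw [Finset.mem_powersetCard] at hA
    rw [Finset.card_powersetCard, Finset.card_sdiff_of_subset hA.1, hA.2]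

/-- The probability that a Poisson variable with mean `l` is less than `k`. -/
def poissonLt (k : ℕ) (l : ℝ) : ℝ := ∑ a ∈ Finset.range k, l ^ a / a.factorial * Real.exp (-l)

lemma IsIID.measureReal_cnt_lt (h : IsIID Z μ P) (S : Finset ℕ) {B B' : Set E}
    (hB : MeasurableSet B) (hB' : MeasurableSet B') (hd : Disjoint B B') (k : ℕ) :
    P.real {ω | cnt S B (restrictSample Z S ω) < k ∧ cnt S B' (restrictSample Z S ω) < k} =
      ∑ a ∈ Finset.range k, ∑ b ∈ Finset.range k,
      (S.card.choose a) * ((S.card - a).choose b) * (μ.real B ^ a * μ.real B' ^ b *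
        (1 - μ.real B - μ.real B') ^ (S.card - a - b)) := by
  have hu : {ω | cnt S B (restrictSample Z S ω) < k ∧ cnt S B' (restrictSample Z S ω) < k} =
      ⋃ t ∈ Finset.range k ×ˢ Finset.range k,
      {ω | cnt S B (restrictSample Z S ω) = t.1 ∧ cnt S B' (restrictSample Z S ω) = t.2} := by
    ext ω
    simp
  have hm : ∀ {B : Set E}, MeasurableSet B → ∀ a,
      MeasurableSet {ω | cnt S B (restrictSample Z S ω) = a} := by
    intro B hB a
    have h1 := measurable_cnt_nat (C := Unit) S (B := fun _ => B) (measurable_snd hB)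
    exact (h1.comp (measurable_const.prodMk (h.measurable_restrictSample S) :
      Measurable fun ω => ((), restrictSample Z S ω))) (measurableSet_singleton a)
  rw [hu, measureReal_biUnion_finset, Finset.sum_product]
  · exact Finset.sum_congr rfl fun a _ => Finset.sum_congr rfl fun b _ =>
      h.measureReal_cnt_eq S hB hB' hd a b
  · rintro ⟨a, b⟩ - ⟨a', b'⟩ - hne
    rw [Function.onFun, Set.disjoint_left]
    rintro ω ⟨h1, h2⟩ ⟨h3, h4⟩
    simp only at h1 h2 h3 h4
    exact hne (by rw [← h1, ← h2, ← h3, ← h4])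
  · exact fun t _ => (hm hB t.1).inter (hm hB' t.2)

/-- Convergence of N p forces p → 0, so removing a fixed number of points does not change the
limiting mean. -/
lemma tendsto_natCast_sub_mul {p : ℕ → ℝ} {l : ℝ} (hp : Tendsto (fun N : ℕ => N * p N) atTop (𝓝 l))
    (c : ℕ) : Tendsto (fun N => ((N - c : ℕ) : ℝ) * p N) atTop (𝓝 l) := by
  have h0 := tendsto_zero_of_tendsto_mul_atTop hp
  have h1 := hp.sub (h0.const_mul (c : ℝ))
  rw [mul_zero, sub_zero] at h1
  refine h1.congr' ?_
  filter_upwards [eventually_ge_atTop c] with N hN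
  rw [Nat.cast_sub hN]
  ring

lemma tendsto_choose_sub_mul_pow (a c : ℕ) {p : ℕ → ℝ} {l : ℝ}
    (hp : Tendsto (fun N : ℕ => N * p N) atTop (𝓝 l)) :
    Tendsto (fun N => ((N - c).choose a : ℝ) * p N ^ a) atTop (𝓝 (l ^ a / a.factorial)) := by
  have h1 : Asymptotics.IsEquivalent atTop (fun N => ((N - c).choose a : ℝ) * p N ^ a)
      (fun N => (((N - c : ℕ) : ℝ) ^ a / a.factorial) * p N ^ a) :=
    ((isEquivalent_choose a).comp_tendsto (tendsto_sub_atTop_nat c)).mul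
      Asymptotics.IsEquivalent.refl
  rw [h1.tendsto_nhds_iff]
  refine (((tendsto_natCast_sub_mul hp c).pow a).div_const (a.factorial : ℝ)).congr fun N => ?_
  rw [mul_pow]
  ring

lemma tendsto_one_add_pow_sub {x : ℕ → ℝ} {t : ℝ} (hx : Tendsto (fun N : ℕ => N * x N) atTop (𝓝 t))
    (m : ℕ) : Tendsto (fun N => (1 + x N) ^ (N - m)) atTop (𝓝 (Real.exp t)) := by
  have h0 := tendsto_zero_of_tendsto_mul_atTop hx
  have h1 : Tendsto (fun N => 1 + x N) atTop (𝓝 1) := by simpa using h0.const_add 1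
  have h2 := (Real.tendsto_one_add_pow_exp_of_tendsto hx).mul ((h1.pow m).inv₀ (by simp))
  rw [one_pow, inv_one, mul_one] at h2
  refine h2.congr' ?_
  filter_upwards [eventually_ge_atTop m, h1.eventually_ne one_ne_zero] with N hN hne
  rw [pow_sub₀ _ hne hN]

/-- The binomial coefficients behave like powers over factorials and the last factor tends to exp(-l
- l'), so the limit factorises. The shift `c` accounts for the sample points serving as centres. -/
lemma tendsto_trinomial (k c : ℕ) {p q : ℕ → ℝ} {l l' : ℝ}
    (hp : Tendsto (fun N : ℕ => N * p N) atTop (𝓝 l))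
    (hq : Tendsto (fun N : ℕ => N * q N) atTop (𝓝 l')) :
    Tendsto (fun N : ℕ => ∑ a ∈ Finset.range k, ∑ b ∈ Finset.range k,
      ((N - c).choose a : ℝ) * ((N - c - a).choose b) * (p N ^ a * q N ^ b *
        (1 - p N - q N) ^ (N - c - a - b))) atTop (𝓝 (poissonLt k l * poissonLt k l')) := by
  unfold poissonLt
  rw [Finset.sum_mul_sum]
  refine tendsto_finsetSum _ fun a _ => tendsto_finsetSum _ fun b _ => ?_
  have h1 := tendsto_choose_sub_mul_pow a c hp
  have h2 := tendsto_choose_sub_mul_pow b (c + a) hq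
  have h3 : Tendsto (fun N : ℕ => N * (-p N - q N)) atTop (𝓝 (-l - l')) := by
    refine (hp.neg.sub hq).congr fun N => ?_
    ring
  have h4 := tendsto_one_add_pow_sub h3 (c + a + b)
  have h5 := (h1.mul h2).mul h4
  have e : l ^ a / a.factorial * Real.exp (-l) * (l' ^ b / b.factorial * Real.exp (-l')) =
      l ^ a / a.factorial * (l' ^ b / b.factorial) * Real.exp (-l - l') := by
    rw [sub_eq_add_neg, Real.exp_add]
    ring
  rw [e]
  refine h5.congr fun N => ?_
  rw [← Nat.sub_sub, ← Nat.sub_sub, ← Nat.sub_sub]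
  ring

/-- Joint Poisson limit for the counts in two small disjoint sets. -/
lemma IsIID.tendsto_cnt_lt_pair (h : IsIID Z μ P) (k c : ℕ) {S : ℕ → Finset ℕ}
    (hS : ∀ᶠ N in atTop, (S N).card = N - c) {B B' : ℕ → Set E} (hB : ∀ N, MeasurableSet (B N))
    (hB' : ∀ N, MeasurableSet (B' N)) (hd : ∀ᶠ N in atTop, Disjoint (B N) (B' N)) {l l' : ℝ}
    (hl : Tendsto (fun N : ℕ => N * μ.real (B N)) atTop (𝓝 l))
    (hl' : Tendsto (fun N : ℕ => N * μ.real (B' N)) atTop (𝓝 l')) :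
    Tendsto (fun N => P.real {ω | cnt (S N) (B N) (restrictSample Z (S N) ω) < k ∧
      cnt (S N) (B' N) (restrictSample Z (S N) ω) < k}) atTop
      (𝓝 (poissonLt k l * poissonLt k l')) := by
  refine (tendsto_trinomial k c hl hl').congr' ?_
  filter_upwards [hS, hd] with N hN hdN
  rw [h.measureReal_cnt_lt (S N) (hB N) (hB' N) hdN, hN]

lemma poissonLt_zero {k : ℕ} (hk : 1 ≤ k) : poissonLt k 0 = 1 := by
  unfold poissonLt
  rw [Finset.sum_eq_single 0]
  · simp
  · intro b _ hb
    simp [hb]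
  · intro h0
    exact absurd (Finset.mem_range.2 (by omega)) h0

lemma continuous_poissonLt (k : ℕ) : Continuous (poissonLt k) := by
  unfold poissonLt
  fun_prop

/-- Poisson limit for the count in a small set. -/
lemma IsIID.tendsto_cnt_lt (h : IsIID Z μ P) {k : ℕ} (hk : 1 ≤ k) (c : ℕ) {S : ℕ → Finset ℕ}
    (hS : ∀ᶠ N in atTop, (S N).card = N - c) {B : ℕ → Set E} (hB : ∀ N, MeasurableSet (B N))
    {l : ℝ} (hl : Tendsto (fun N : ℕ => N * μ.real (B N)) atTop (𝓝 l)) :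
    Tendsto (fun N => P.real {ω | cnt (S N) (B N) (restrictSample Z (S N) ω) < k}) atTop
      (𝓝 (poissonLt k l)) := by
  have h1 := h.tendsto_cnt_lt_pair k c hS hB (B' := fun _ => ∅) (fun _ => MeasurableSet.empty)
    (Eventually.of_forall fun _ => disjoint_bot_right) hl (l' := 0) (by simp)
  rw [poissonLt_zero hk, mul_one] at h1
  refine h1.congr fun N => ?_
  congr 1
  ext ω
  have : cnt (S N) (∅ : Set E) (restrictSample Z (S N) ω) < k := by
    simp [cnt]
    omega
  simp [this]

/-- Counts with diverging mean concentrate. -/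
lemma IsIID.tendsto_cnt_ge (h : IsIID Z μ P) {S : ℕ → Finset ℕ} {B : ℕ → Set E}
    (hB : ∀ N, MeasurableSet (B N)) {m : ℕ → ℝ} (hm : Tendsto m atTop atTop)
    (hr : Tendsto (fun N => (S N).card * μ.real (B N) / m N) atTop (𝓝 1)) {a : ℝ} (ha : 1 < a) :
    Tendsto (fun N => P.real {ω | a * m N ≤ cnt (S N) (B N) (restrictSample Z (S N) ω)}) atTop
      (𝓝 0) := by
  set ε := (a - 1) / 2 with hε
  have hε0 : 0 < ε := by linarith
  have hM : Tendsto (fun N => (S N).card * μ.real (B N)) atTop atTop := by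
    refine (hr.pos_mul_atTop one_pos hm).congr' ?_
    filter_upwards [hm.eventually_gt_atTop 0] with N hN
    field_simp
  have hlim : Tendsto (fun N => 1 / (ε ^ 2 * ((S N).card * μ.real (B N)))) atTop (𝓝 0) := by
    simp_rw [one_div]
    exact (hM.const_mul_atTop (by positivity)).inv_tendsto_atTop
  refine squeeze_zero' (Eventually.of_forall fun N => measureReal_nonneg) ?_ hlim
  -- Since 1 + ε < a, the threshold a m eventually exceeds (1 + ε) times the mean, so reaching it is
  -- a Chebyshev deviation of relative size ε.
  have h1 : 1 < a / (1 + ε) := by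
    rw [lt_div_iff₀ (by linarith)]
    linarith
  filter_upwards [hm.eventually_gt_atTop 0, hM.eventually_gt_atTop 0, hr.eventually_lt_const h1]
    with N h2 h3 h4
  refine (measureReal_mono fun ω hω => ?_).trans (h.chebyshev_cnt (S N) (hB N) hε0 h3)
  simp only [Set.mem_ofPred_eq] at hω ⊢
  rw [div_lt_div_iff₀ h2 (by linarith)] at h4
  rw [le_abs]
  left
  linarith

lemma IsIID.tendsto_cnt_le (h : IsIID Z μ P) {S : ℕ → Finset ℕ} {B : ℕ → Set E}
    (hB : ∀ N, MeasurableSet (B N)) {m : ℕ → ℝ} (hm : Tendsto m atTop atTop)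
    (hr : Tendsto (fun N => (S N).card * μ.real (B N) / m N) atTop (𝓝 1)) {a : ℝ} (ha : a < 1)
    (ha0 : 0 < a) :
    Tendsto (fun N => P.real {ω | cnt (S N) (B N) (restrictSample Z (S N) ω) ≤ a * m N}) atTop
      (𝓝 0) := by
  set ε := (1 - a) / 2 with hε
  have hε0 : 0 < ε := by linarith
  have hM : Tendsto (fun N => (S N).card * μ.real (B N)) atTop atTop := by
    refine (hr.pos_mul_atTop one_pos hm).congr' ?_
    filter_upwards [hm.eventually_gt_atTop 0] with N hN
    field_simp
  have hlim : Tendsto (fun N => 1 / (ε ^ 2 * ((S N).card * μ.real (B N)))) atTop (𝓝 0) := by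
    simp_rw [one_div]
    exact (hM.const_mul_atTop (by positivity)).inv_tendsto_atTop
  refine squeeze_zero' (Eventually.of_forall fun N => measureReal_nonneg) ?_ hlim
  have h1 : a / (1 - ε) < 1 := by
    rw [div_lt_one (by linarith)]
    linarith
  filter_upwards [hm.eventually_gt_atTop 0, hM.eventually_gt_atTop 0, hr.eventually_const_lt h1]
    with N h2 h3 h4
  refine (measureReal_mono fun ω hω => ?_).trans (h.chebyshev_cnt (S N) (hB N) hε0 h3)
  simp only [Set.mem_ofPred_eq] at hω ⊢
  rw [div_lt_div_iff₀ (by linarith) h2] at h4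
  rw [le_abs]
  right
  linarith

end Trinomial

/-! ### Densities, marginals and the entropy identity -/

section DensityLemmas

variable {dx dy : ℕ}

/-- `f` is a probability density on `ℝ^dx × ℝ^dy`. -/
structure IsDensity (f : (Fin dx → ℝ) × (Fin dy → ℝ) → ℝ) : Prop where
  nonneg : ∀ z, 0 ≤ f z
  measurable : Measurable f
  integrable : Integrable f
  integral_eq : ∫ z, f z = 1

/-- The law with density `f`. -/
def law (f : (Fin dx → ℝ) × (Fin dy → ℝ) → ℝ) : Measure ((Fin dx → ℝ) × (Fin dy → ℝ)) :=
  volume.withDensity fun z => ENNReal.ofReal (f z)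

variable {f : (Fin dx → ℝ) × (Fin dy → ℝ) → ℝ}

/-- Integrability of `f` and total mass one are recovered from the fact that the samples have a
probability law. -/
lemma isDensity_of_isProbabilityMeasure (h0 : ∀ z, 0 ≤ f z) (hm : Measurable f)
    (h1 : IsProbabilityMeasure (law f)) : IsDensity f := by
  have h2 : ∫⁻ z, ENNReal.ofReal (f z) = 1 := by
    have := h1.measure_univ
    rwa [law, withDensity_apply _ MeasurableSet.univ, Measure.restrict_univ] at this
  refine ⟨h0, hm, ⟨hm.aestronglyMeasurable, ?_⟩, ?_⟩
  · rw [hasFiniteIntegral_iff_ofReal (ae_of_all _ h0), h2]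
    exact ENNReal.one_lt_top
  · rw [integral_eq_lintegral_of_nonneg_ae (ae_of_all _ h0) hm.aestronglyMeasurable, h2]
    rfl

lemma IsDensity.isProbabilityMeasure_law (h : IsDensity f) : IsProbabilityMeasure (law f) := by
  constructor
  rw [law, withDensity_apply _ MeasurableSet.univ, Measure.restrict_univ,
    ← ofReal_integral_eq_lintegral_ofReal h.integrable (ae_of_all _ h.nonneg), h.integral_eq]
  simp

lemma IsDensity.swap (h : IsDensity f) : IsDensity (f ∘ Prod.swap) where
  nonneg z := h.nonneg _
  measurable := h.measurable.comp measurable_swap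
  integrable := h.integrable.swap
  integral_eq := by
    rw [← h.integral_eq]
    exact integral_prod_swap f

lemma marginalX_swap : marginalX (f ∘ Prod.swap) = marginalY f := rfl

lemma ae_swap {p : (Fin dx → ℝ) × (Fin dy → ℝ) → Prop} (h : ∀ᵐ z, p z) :
    ∀ᵐ z : (Fin dy → ℝ) × (Fin dx → ℝ), p z.swap :=
  (Measure.measurePreserving_swap (μ := (volume : Measure (Fin dy → ℝ)))
    (ν := (volume : Measure (Fin dx → ℝ)))).quasiMeasurePreserving.ae h

namespace IsDensity

lemma law_real (h : IsDensity f) {A : Set ((Fin dx → ℝ) × (Fin dy → ℝ))} (hA : MeasurableSet A) :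
    (law f).real A = ∫ z in A, f z := by
  rw [integral_eq_lintegral_of_nonneg_ae (ae_of_all _ h.nonneg)
    h.measurable.aestronglyMeasurable, Measure.real, law, withDensity_apply _ hA]

lemma integral_law (h : IsDensity f) (φ : (Fin dx → ℝ) × (Fin dy → ℝ) → ℝ) :
    ∫ z, φ z ∂(law f) = ∫ z, f z * φ z := by
  rw [law, integral_withDensity_eq_integral_toReal_smul h.measurable.ennreal_ofReal
    (ae_of_all _ fun _ => ENNReal.ofReal_lt_top)]
  refine integral_congr_ae (ae_of_all _ fun z => ?_)
  simp [ENNReal.toReal_ofReal (h.nonneg z)]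

lemma integrable_law (h : IsDensity f) {φ : (Fin dx → ℝ) × (Fin dy → ℝ) → ℝ} :
    Integrable φ (law f) ↔ Integrable fun z => f z * φ z := by
  rw [law, integrable_withDensity_iff_integrable_smul' h.measurable.ennreal_ofReal
    (ae_of_all _ fun _ => ENNReal.ofReal_lt_top)]
  refine integrable_congr (ae_of_all _ fun z => ?_)
  simp [ENNReal.toReal_ofReal (h.nonneg z)]

lemma ae_law_of_ae {p : (Fin dx → ℝ) × (Fin dy → ℝ) → Prop} (hp : ∀ᵐ z, p z) :
    ∀ᵐ z ∂(law f), p z :=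
  (withDensity_absolutelyContinuous _ _).ae_le hp

lemma ae_law_pos (h : IsDensity f) : ∀ᵐ z ∂(law f), 0 < f z := by
  rw [law, ae_withDensity_iff h.measurable.ennreal_ofReal]
  refine ae_of_all _ fun z hz => ?_
  simpa using hz

lemma marginalX_nonneg (h : IsDensity f) (x : Fin dx → ℝ) : 0 ≤ marginalX f x :=
  integral_nonneg fun _ => h.nonneg _

lemma measurable_marginalX (h : IsDensity f) : Measurable (marginalX f) :=
  (h.measurable.stronglyMeasurable.integral_prod_right' (ν := volume)).measurable

lemma integrable_marginalX (h : IsDensity f) : Integrable (marginalX f) :=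
  h.integrable.integral_prod_left

lemma integral_marginalX (h : IsDensity f) : ∫ x, marginalX f x = 1 := by
  rw [← h.integral_eq]
  exact (integral_prod f h.integrable).symm

lemma integral_mul_fst (φ : (Fin dx → ℝ) → ℝ)
    (hi : Integrable fun z : (Fin dx → ℝ) × (Fin dy → ℝ) => f z * φ z.1) :
    (Integrable fun x => marginalX f x * φ x) ∧
      ∫ z, f z * φ z.1 = ∫ x, marginalX f x * φ x := by
  have e : (fun x => marginalX f x * φ x) = fun x => ∫ y, f (x, y) * φ x := by
    ext x
    rw [integral_mul_const, marginalX]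
  rw [e]
  exact ⟨hi.integral_prod_left, integral_prod _ hi⟩

lemma law_real_fst (h : IsDensity f) {A : Set (Fin dx → ℝ)} (hA : MeasurableSet A) :
    (law f).real {z | z.1 ∈ A} = ∫ x in A, marginalX f x := by
  have e1 : (fun z : (Fin dx → ℝ) × (Fin dy → ℝ) => f z * A.indicator (1 : (Fin dx → ℝ) → ℝ) z.1) =
      {z : (Fin dx → ℝ) × (Fin dy → ℝ) | z.1 ∈ A}.indicator f := by
    ext z
    classical
    simp [Set.indicator_apply]
  have hA' : MeasurableSet {z : (Fin dx → ℝ) × (Fin dy → ℝ) | z.1 ∈ A} := measurable_fst hA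
  have h1 := integral_mul_fst (f := f) (A.indicator (1 : (Fin dx → ℝ) → ℝ)) (by
    rw [e1]
    exact h.integrable.indicator hA')
  have e2 : (fun x => marginalX f x * A.indicator (1 : (Fin dx → ℝ) → ℝ) x) = A.indicator (marginalX f) := by
    ext z
    classical
    simp [Set.indicator_apply]
  rw [e1, e2] at h1
  rw [h.law_real hA', ← integral_indicator hA', h1.2, integral_indicator hA]

/-- Where the marginal is positive this is the conditional bound cleared of its denominator. Where
it vanishes the quotient is 0 by convention and says nothing, but almost every fibre with zero
integral carries only zero values of `f`. -/
lemma ae_le_mul_marginalX (h : IsDensity f) {C : ℝ} (hC : ∀ᵐ z : (Fin dx → ℝ) × (Fin dy → ℝ), condYX f z.1 z.2 < C) :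
    ∀ᵐ z, f z ≤ C * marginalX f z.1 := by
  have hm : MeasurableSet {z : (Fin dx → ℝ) × (Fin dy → ℝ) |
      marginalX f z.1 = 0 → f z = 0} := by
    have h1 : MeasurableSet {z : (Fin dx → ℝ) × (Fin dy → ℝ) | marginalX f z.1 = 0} :=
      (h.measurable_marginalX.comp measurable_fst) (measurableSet_singleton 0)
    have h2 : MeasurableSet {z : (Fin dx → ℝ) × (Fin dy → ℝ) | f z = 0} :=
      h.measurable (measurableSet_singleton 0)
    convert h1.compl.union h2 using 1
    ext z
    simp [imp_iff_not_or]
  have h0 : ∀ᵐ z : (Fin dx → ℝ) × (Fin dy → ℝ), marginalX f z.1 = 0 → f z = 0 := by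
    rw [Measure.volume_eq_prod]
    refine (Measure.ae_prod_iff_ae_ae hm).2 ?_
    filter_upwards [h.integrable.prod_right_ae] with x hx
    by_cases hx0 : marginalX f x = 0
    · have := (integral_eq_zero_iff_of_nonneg (fun y => h.nonneg (x, y)) hx).1 hx0
      filter_upwards [this] with y hy _
      exact hy
    · exact ae_of_all _ fun y hy => absurd hy hx0
  filter_upwards [hC, h0] with z h1 h2
  rcases eq_or_lt_of_le (h.marginalX_nonneg z.1) with h3 | h3
  · rw [h2 h3.symm, ← h3, mul_zero]
  · rw [condYX, div_lt_iff₀ h3] at h1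
    exact h1.le

/-- Integrating f ≤ C f_Y in y suffices, because f_Y has mass one. -/
lemma marginalX_le (h : IsDensity f) {C : ℝ} (hC : ∀ᵐ z, f z ≤ C * marginalY f z.2) :
    ∀ᵐ x, marginalX f x ≤ C := by
  rw [Measure.volume_eq_prod] at hC
  have h1 := Measure.ae_ae_of_ae_prod hC
  filter_upwards [h1, h.integrable.prod_right_ae] with x hx hx'
  have h2 := h.swap.integrable_marginalX
  have h3 := h.swap.integral_marginalX
  rw [marginalX_swap] at h2 h3
  calc marginalX f x ≤ ∫ y, C * marginalY f y := integral_mono_ae hx' (h2.const_mul C) hx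
    _ = C := by rw [integral_const_mul, h3, mul_one]

/-- Where f > 0, the bounds f / C ≤ f_X ≤ C trap log f_X between log f - log C and log C, so |log
f_X| ≤ |log f| + |log C|. -/
lemma integrable_mul_log_marginalX (h : IsDensity f)
    (hent : Integrable fun z => f z * |Real.log (f z)|) {C : ℝ}
    (h1 : ∀ᵐ z, f z ≤ C * marginalX f z.1) (h2 : ∀ᵐ x, marginalX f x ≤ C) (hC : 0 < C) :
    Integrable fun z : (Fin dx → ℝ) × (Fin dy → ℝ) => f z * Real.log (marginalX f z.1) := by
  refine (hent.add (h.integrable.mul_const |Real.log C|)).mono'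
    (h.measurable.mul (h.measurable_marginalX.comp measurable_fst).log).aestronglyMeasurable ?_
  have h3 : ∀ᵐ z : (Fin dx → ℝ) × (Fin dy → ℝ), marginalX f z.1 ≤ C :=
    Measure.quasiMeasurePreserving_fst.ae h2
  filter_upwards [h1, h3] with z hz1 hz2
  simp only [Pi.add_apply, norm_mul, Real.norm_eq_abs, abs_of_nonneg (h.nonneg z)]
  rw [← mul_add]
  rcases eq_or_lt_of_le (h.nonneg z) with h0 | h0
  · rw [← h0]; simp
  refine mul_le_mul_of_nonneg_left ?_ h0.le
  have hX : 0 < marginalX f z.1 := by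
    by_contra hn
    nlinarith [mul_nonneg hC.le (neg_nonneg.2 (not_lt.1 hn))]
  have h4 := Real.log_le_log h0 hz1
  rw [Real.log_mul hC.ne' hX.ne'] at h4
  have h5 := Real.log_le_log hX hz2
  rw [abs_le]
  constructor
  · linarith [neg_abs_le (Real.log (f z)), le_abs_self (Real.log C)]
  · linarith [abs_nonneg (Real.log (f z)), le_abs_self (Real.log C)]

end IsDensity

/-- The logarithm of `f_X f_Y / f`. -/
def logRatio (f : (Fin dx → ℝ) × (Fin dy → ℝ) → ℝ) (z : (Fin dx → ℝ) × (Fin dy → ℝ)) : ℝ :=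
  Real.log (marginalX f z.1) + Real.log (marginalY f z.2) - Real.log (f z)

/-- The upper bounds on `f` and its marginals that follow from bounded conditional densities. -/
structure BoundedCond (f : (Fin dx → ℝ) × (Fin dy → ℝ) → ℝ) (C : ℝ) : Prop where
  pos : 0 < C
  le_X : ∀ᵐ z, f z ≤ C * marginalX f z.1
  le_Y : ∀ᵐ z, f z ≤ C * marginalY f z.2
  X_le : ∀ᵐ x, marginalX f x ≤ C
  Y_le : ∀ᵐ y, marginalY f y ≤ C

lemma BoundedCond.swap {C : ℝ} (h : BoundedCond f C) : BoundedCond (f ∘ Prod.swap) C where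
  pos := h.pos
  le_X := ae_swap h.le_Y
  le_Y := ae_swap h.le_X
  X_le := h.Y_le
  Y_le := h.X_le

lemma IsDensity.boundedCond (h : IsDensity f) {C : ℝ}
    (hC : ∀ᵐ z : (Fin dx → ℝ) × (Fin dy → ℝ), condYX f z.1 z.2 < C ∧ condXY f z.1 z.2 < C) :
    BoundedCond f C := by
  have hX := h.ae_le_mul_marginalX (hC.mono fun _ hz => hz.1)
  have hY : ∀ᵐ z, f z ≤ C * marginalY f z.2 := by
    have h1 : ∀ᵐ z : (Fin dy → ℝ) × (Fin dx → ℝ), condYX (f ∘ Prod.swap) z.1 z.2 < C :=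
      ae_swap (hC.mono fun _ hz => hz.2)
    exact ae_swap (h.swap.ae_le_mul_marginalX h1)
  refine ⟨?_, hX, hY, h.marginalX_le hY, h.swap.marginalX_le (ae_swap hX)⟩
  obtain ⟨z, hz⟩ := hC.exists
  exact (div_nonneg (h.nonneg _) (h.marginalX_nonneg _)).trans_lt hz.1

section Entropy

variable {C : ℝ}

/-- By Fubini the integral of f(x,y) log f_X(x) is that of f_X log f_X, and likewise for y; the
three entropy integrals then add up to -I. -/
lemma IsDensity.integrable_logRatio (h : IsDensity f) (hb : BoundedCond f C)
    (hent : Integrable fun z => f z * |Real.log (f z)|) :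
    (Integrable (fun x => marginalX f x * Real.log (marginalX f x)) ∧
      Integrable (fun y => marginalY f y * Real.log (marginalY f y))) ∧
    Integrable (logRatio f) (law f) ∧ ∫ z, logRatio f z ∂(law f) = -mutualInfo f := by
  have hX := h.integrable_mul_log_marginalX hent hb.le_X hb.X_le hb.pos
  have hent' : Integrable fun z => (f ∘ Prod.swap) z * |Real.log ((f ∘ Prod.swap) z)| :=
    hent.swap
  have hY := h.swap.integrable_mul_log_marginalX hent' hb.swap.le_X hb.swap.X_le hb.pos
  have hY' : Integrable fun z : (Fin dx → ℝ) × (Fin dy → ℝ) =>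
      f z * Real.log (marginalY f z.2) := hY.swap
  have hf : Integrable fun z => f z * Real.log (f z) := by
    refine hent.mono (h.measurable.mul h.measurable.log).aestronglyMeasurable (ae_of_all _ fun z => ?_)
    simp
  have h1 := IsDensity.integral_mul_fst (fun x => Real.log (marginalX f x)) hX
  have h2 := IsDensity.integral_mul_fst
    (fun y => Real.log (marginalX (f ∘ Prod.swap) y)) hY
  rw [marginalX_swap] at h2
  have e : (fun z => f z * logRatio f z) = fun z => f z * Real.log (marginalX f z.1) +
      f z * Real.log (marginalY f z.2) - f z * Real.log (f z) := by
    ext z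
    rw [logRatio]
    ring
  have e2 : ∫ z, f z * Real.log (marginalY f z.2) =
      ∫ y, marginalY f y * Real.log (marginalY f y) := by
    rw [← h2.2]
    exact (integral_prod_swap (fun z => f z * Real.log (marginalY f z.2))).symm
  refine ⟨⟨h1.1, h2.1⟩, ?_, ?_⟩
  · rw [h.integrable_law, e]
    exact (hX.add hY').sub hf
  · have e3 := integral_sub (hX.add hY') hf
    simp only [Pi.add_apply] at e3
    rw [h.integral_law, e, e3, integral_add hX hY', h1.2, e2]
    simp only [mutualInfo, diffEntropy]
    ring

end Entropy

end DensityLemmas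

/-! ### Semiconvexity from the bounded Hessian -/

section Hessian

variable {dx dy : ℕ}

lemma abs_apply_le_matNorm {ι : Type*} [Fintype ι] [DecidableEq ι] (A : Matrix ι ι ℝ) (a b : ι) :
    |A a b| ≤ matNorm A := by
  have h1 := (Matrix.toEuclideanCLM (n := ι) (𝕜 := ℝ) A).le_opNorm (PiLp.single 2 b (1 : ℝ))
  rw [PiLp.norm_single, norm_one, mul_one] at h1
  refine le_trans ?_ h1
  have h2 := PiLp.norm_apply_le
    (Matrix.toEuclideanCLM (n := ι) (𝕜 := ℝ) A (PiLp.single 2 b (1 : ℝ))) a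
  refine le_trans (le_of_eq ?_) h2
  simp [Matrix.ofLp_toEuclideanCLM, Matrix.mulVec_single]

lemma eq_sum_stdBasis (v : (Fin dx → ℝ) × (Fin dy → ℝ)) :
    v = ∑ a, (Sum.elim v.1 v.2 a) • (stdBasis a : (Fin dx → ℝ) × (Fin dy → ℝ)) := by
  rw [Fintype.sum_sum_type]
  ext i
  · simp [stdBasis, Prod.fst_sum, Finset.sum_apply, Pi.single_apply]
  · simp [stdBasis, Prod.snd_sum, Finset.sum_apply, Pi.single_apply]

lemma abs_sumElim_le (v : (Fin dx → ℝ) × (Fin dy → ℝ)) (a : Fin dx ⊕ Fin dy) :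
    |Sum.elim v.1 v.2 a| ≤ ‖v‖ := by
  rcases a with i | j
  · exact (norm_le_pi_norm v.1 i).trans (norm_fst_le v)
  · exact (norm_le_pi_norm v.2 j).trans (norm_snd_le v)

lemma norm_clm_le_of_stdBasis (T : (Fin dx → ℝ) × (Fin dy → ℝ) →L[ℝ] ℝ) {C : ℝ}
    (hT : ∀ a, |T (stdBasis a)| ≤ C) (v : (Fin dx → ℝ) × (Fin dy → ℝ)) :
    |T v| ≤ (dx + dy : ℕ) * C * ‖v‖ := by
  conv_lhs => rw [eq_sum_stdBasis v, map_sum]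
  calc |∑ a, T ((Sum.elim v.1 v.2 a) • stdBasis a)| ≤ ∑ a, |T ((Sum.elim v.1 v.2 a) • stdBasis a)| :=
        Finset.abs_sum_le_sum_abs _ _
    _ ≤ ∑ _a : Fin dx ⊕ Fin dy, ‖v‖ * C := by
        refine Finset.sum_le_sum fun a _ => ?_
        rw [map_smul, smul_eq_mul, abs_mul]
        exact mul_le_mul (abs_sumElim_le v a) (hT a) (abs_nonneg _) (norm_nonneg _)
    _ = _ := by
        simp
        ring

/-- A function with bounded Hessian is semiconvex. -/
lemma exists_semiconvex {f : (Fin dx → ℝ) × (Fin dy → ℝ) → ℝ} (hf : ContDiff ℝ 2 f)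
    (hH : ∃ C : ℝ, ∀ᵐ z : (Fin dx → ℝ) × (Fin dy → ℝ), matNorm (hessian f z) < C) :
    ∃ K : ℝ, 0 < K ∧ ∀ z v, 2 * f z - K * ‖v‖ ^ 2 ≤ f (z + v) + f (z - v) := by
  obtain ⟨C, hC⟩ := hH
  have hC0 : 0 ≤ C := by
    obtain ⟨z, hz⟩ := hC.exists
    exact (norm_nonneg _).trans hz.le
  set n : ℝ := ((dx + dy : ℕ) : ℝ) with hn
  have hn0 : 0 ≤ n := Nat.cast_nonneg _
  let G : Fin dx ⊕ Fin dy → (Fin dx → ℝ) × (Fin dy → ℝ) → ℝ := fun b w => fderiv ℝ f w (stdBasis b)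
  have hG : ∀ b, ContDiff ℝ 1 (G b) := fun b =>
    (hf.fderiv_right (m := 1) (by norm_num)).clm_apply contDiff_const
  have hent : ∀ a b z, |fderiv ℝ (G b) z (stdBasis a)| ≤ C := by
    intro a b
    have hcont : Continuous fun z => |fderiv ℝ (G b) z (stdBasis a)| :=
      (((hG b).continuous_fderiv one_ne_zero).clm_apply continuous_const).abs
    have hae : ∀ᵐ z, |fderiv ℝ (G b) z (stdBasis a)| ≤ C := by
      filter_upwards [hC] with z hz
      exact (abs_apply_le_matNorm (hessian f z) a b).trans hz.le
    -- The second derivatives are continuous, so the bound holds on a closed set; having full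
    -- measure, that set is dense, hence everything.
    have hcl : IsClosed {z | |fderiv ℝ (G b) z (stdBasis a)| ≤ C} :=
      isClosed_le hcont continuous_const
    have hd := Measure.dense_of_ae hae
    intro z
    have := hd.closure_eq ▸ hcl.closure_eq
    have h2 : z ∈ {z | |fderiv ℝ (G b) z (stdBasis a)| ≤ C} := by
      rw [← hcl.closure_eq, hd.closure_eq]
      trivial
    exact h2
  have hlip : ∀ b w w', |G b w - G b w'| ≤ n * C * ‖w - w'‖ := by
    intro b w w'
    refine Convex.norm_image_sub_le_of_norm_fderiv_le (𝕜 := ℝ) (f := G b) (s := Set.univ)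
      (fun x _ => ((hG b).differentiable one_ne_zero) x) (fun x _ => ?_) convex_univ trivial trivial
    exact ContinuousLinearMap.opNorm_le_bound _ (by positivity)
      fun v => norm_clm_le_of_stdBasis _ (fun a => hent a b x) v
  have hlip2 : ∀ w w' v, |fderiv ℝ f w v - fderiv ℝ f w' v| ≤ n * (n * C * ‖w - w'‖) * ‖v‖ := by
    intro w w' v
    exact norm_clm_le_of_stdBasis (fderiv ℝ f w - fderiv ℝ f w') (fun b => hlip b w w') v
  -- One factor `n` comes from bounding the derivative of each partial derivative by its entries,
  -- the other from bounding the gradient by its components; the added 1 makes the constant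
  -- positive.
  refine ⟨n * n * C + 1, by positivity, fun z v => ?_⟩
  set K := n * n * C with hK
  -- The Lipschitz bound on the gradient makes Φ nondecreasing on [0, 1]; comparing Φ(0) with Φ(1)
  -- is semiconvexity.
  let Φ : ℝ → ℝ := fun t => f (z + t • v) + f (z - t • v) + K * ‖v‖ ^ 2 * t ^ 2
  have hΦ : ∀ t, HasDerivAt Φ (fderiv ℝ f (z + t • v) v - fderiv ℝ f (z - t • v) v +
      K * ‖v‖ ^ 2 * (2 * t)) t := by
    intro t
    have hfd := hf.differentiable two_ne_zero
    have hv : HasDerivAt (fun t : ℝ => t • v) v t := by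
      simpa using (hasDerivAt_id t).smul_const v
    have e1 := (hfd (z + t • v)).hasFDerivAt.comp_hasDerivAt t (hv.const_add z)
    have e2 := (hfd (z - t • v)).hasFDerivAt.comp_hasDerivAt t (hv.const_sub z)
    have e3 := ((hasDerivAt_pow 2 t).const_mul (K * ‖v‖ ^ 2))
    convert! (e1.add e2).add e3 using 1
    simp
    ring
  have hmono : MonotoneOn Φ (Set.Icc 0 1) := by
    refine monotoneOn_of_deriv_nonneg (convex_Icc 0 1)
      (fun t _ => (hΦ t).continuousAt.continuousWithinAt)
      (fun t _ => (hΦ t).differentiableAt.differentiableWithinAt) fun t ht => ?_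
    rw [interior_Icc] at ht
    rw [(hΦ t).deriv]
    have h1 := hlip2 (z + t • v) (z - t • v) v
    have h2 : ‖z + t • v - (z - t • v)‖ = 2 * t * ‖v‖ := by
      have : z + t • v - (z - t • v) = (2 * t) • v := by module
      rw [this, norm_smul, Real.norm_eq_abs, abs_of_pos (by linarith [ht.1])]
    rw [h2] at h1
    have h3 := neg_le_of_abs_le h1
    have : n * (n * C * (2 * t * ‖v‖)) * ‖v‖ = K * ‖v‖ ^ 2 * (2 * t) := by
      rw [hK]
      ring
    linarith
  have := hmono (Set.left_mem_Icc.2 zero_le_one) (Set.right_mem_Icc.2 zero_le_one) zero_le_one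
  simp only [Φ, zero_smul, one_smul, add_zero, sub_zero] at this
  nlinarith [sq_nonneg ‖v‖]

end Hessian

/-! ### Gauge balls and Lebesgue differentiation -/

section Gauge

instance isAddHaarMeasure_volume_prod {dx dy : ℕ} :
    (volume : Measure ((Fin dx → ℝ) × (Fin dy → ℝ))).IsAddHaarMeasure :=
  Measure.prod.instIsAddHaarMeasure (volume : Measure (Fin dx → ℝ)) (volume : Measure (Fin dy → ℝ))

instance isNegInvariant_volume_prod {dx dy : ℕ} :
    (volume : Measure ((Fin dx → ℝ) × (Fin dy → ℝ))).IsNegInvariant :=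
  Measure.IsAddHaarMeasure.isNegInvariant_of_innerRegular _

/-- `g` is a gauge dominating the norm, whose balls have volume `c r ^ d`. -/
structure IsGauge {E : Type*} [NormedAddCommGroup E] [MeasureSpace E] (g : E → ℝ) (c : ℝ) (d : ℕ) :
    Prop where
  measurable : Measurable g
  norm_le : ∀ v, ‖v‖ ≤ g v
  neg : ∀ v, g (-v) = g v
  pos : 0 < c
  volume_le : ∀ r : ℝ, 0 ≤ r → volume.real {v | g v ≤ r} = c * r ^ d

/-- The ball of radius `r` about `z` with respect to the gauge `g`. -/
def gball {E : Type*} [NormedAddCommGroup E] (g : E → ℝ) (z : E) (r : ℝ) : Set E :=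
  {w | g (w - z) ≤ r}

variable {E : Type*} [NormedAddCommGroup E] {g : E → ℝ} {c : ℝ} {d : ℕ}

lemma gball_mono (z : E) {r r' : ℝ} (h : r ≤ r') : gball g z r ⊆ gball g z r' :=
  fun _ hw => le_trans hw h

variable [MeasureSpace E]

lemma IsGauge.gball_subset (h : IsGauge g c d) (z : E) (r : ℝ) :
    gball g z r ⊆ Metric.closedBall z r := fun w hw => by
  rw [Metric.mem_closedBall, dist_eq_norm]
  exact (h.norm_le _).trans hw

variable [BorelSpace E] [SecondCountableTopology E]

lemma IsGauge.measurableSet_gball_prod {C : Type*} [MeasurableSpace C] (h : IsGauge g c d)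
    {a : C → E} (ha : Measurable a) {r : C → ℝ} (hr : Measurable r) :
    MeasurableSet {q : C × E | q.2 ∈ gball g (a q.1) (r q.1)} := by
  refine measurableSet_le (h.measurable.comp (measurable_snd.sub (ha.comp measurable_fst)))
    (hr.comp measurable_fst)

lemma IsGauge.measurableSet_gball (h : IsGauge g c d) (z : E) (r : ℝ) :
    MeasurableSet (gball g z r) :=
  measurableSet_le (h.measurable.comp (measurable_id.sub measurable_const)) measurable_const

variable [NormedSpace ℝ E] [FiniteDimensional ℝ E] [(volume : Measure E).IsAddHaarMeasure]

lemma IsGauge.volume_gball (h : IsGauge g c d) (z : E) {r : ℝ} (hr : 0 ≤ r) :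
    volume.real (gball g z r) = c * r ^ d := by
  rw [← h.volume_le r hr]
  have : gball g z r = (fun w => w - z) ⁻¹' {v | g v ≤ r} := rfl
  simp only [Measure.real, this, sub_eq_add_neg]
  rw [measure_preimage_add_right]

lemma IsGauge.volume_gball_lt_top (h : IsGauge g c d) (z : E) (r : ℝ) :
    volume (gball g z r) < ∞ :=
  (measure_mono (h.gball_subset z r)).trans_lt (isCompact_closedBall z r).measure_lt_top

/-- Lebesgue differentiation along gauge balls. -/
lemma IsGauge.ae_tendsto_integral_div (h : IsGauge g c d) (hd : Module.finrank ℝ E = d) {φ : E → ℝ}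
    (hφ : Integrable φ) :
    ∀ᵐ x, ∀ r : ℕ → ℝ, (∀ᶠ N in atTop, 0 < r N) → Tendsto r atTop (𝓝 0) →
      Tendsto (fun N => (∫ w in gball g x (r N), φ w) / (c * r N ^ d)) atTop (𝓝 (φ x)) := by
  filter_upwards [IsUnifLocDoublingMeasure.ae_tendsto_average_norm_sub (volume : Measure E)
    hφ.locallyIntegrable 1] with x hx r hr0 hr
  have h1 := hx (fun _ => x) r (tendsto_nhdsWithin_iff.2 ⟨hr, hr0⟩)
    (hr0.mono fun N hN => by simpa using hN.le)
  set b := volume.real (Metric.ball (0 : E) 1) with hb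
  -- The gauge ball sits inside the norm ball, whose volume is b / c times as large, so mean
  -- deviations over gauge balls are at most b / c times those over norm balls.
  have h2 := h1.const_mul (b / c)
  rw [mul_zero] at h2
  rw [tendsto_iff_norm_sub_tendsto_zero]
  refine squeeze_zero' (Eventually.of_forall fun _ => norm_nonneg _) (hr0.mono fun N hN => ?_) h2
  have hrd : 0 < r N ^ d := pow_pos hN d
  have hcp := h.pos
  have hvol : volume.real (Metric.closedBall x (r N)) = r N ^ d * b := by
    rw [Measure.real, Measure.addHaar_closedBall _ _ hN.le, hd, ENNReal.toReal_mul,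
      ENNReal.toReal_ofReal hrd.le, hb]
    rfl
  have hi : IntegrableOn (fun w => ‖φ w - φ x‖) (Metric.closedBall x (r N)) :=
    (hφ.integrableOn.sub (integrableOn_const
      (isCompact_closedBall x (r N)).measure_lt_top.ne)).norm
  have e1 : ∫ w in gball g x (r N), (φ w - φ x) =
      (∫ w in gball g x (r N), φ w) - c * r N ^ d * φ x := by
    rw [integral_sub hφ.integrableOn (integrableOn_const (h.volume_gball_lt_top _ _).ne)]
    simp [h.volume_gball x hN.le]
  have e2 : (∫ w in gball g x (r N), φ w) / (c * r N ^ d) - φ x =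
      (∫ w in gball g x (r N), (φ w - φ x)) / (c * r N ^ d) := by
    rw [e1]
    field_simp
  have e3 : ‖∫ w in gball g x (r N), (φ w - φ x)‖ ≤
      ∫ w in Metric.closedBall x (r N), ‖φ w - φ x‖ :=
    (norm_integral_le_integral_norm _).trans
      (setIntegral_mono_set hi (ae_of_all _ fun _ => norm_nonneg _)
        (h.gball_subset x (r N)).eventuallyLE)
  rw [e2, norm_div, Real.norm_of_nonneg (by positivity : 0 ≤ c * r N ^ d), setAverage_eq, hvol]
  rcases eq_or_ne b 0 with h0 | h0
  · have : volume (Metric.ball (0 : E) 1) ≠ 0 := (Metric.measure_ball_pos _ _ one_pos).ne'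
    rw [hb, Measure.real, ENNReal.toReal_eq_zero_iff] at h0
    rcases h0 with h0 | h0
    · exact absurd h0 this
    · exact absurd h0 measure_ball_lt_top.ne
  · calc _ ≤ (∫ w in Metric.closedBall x (r N), ‖φ w - φ x‖) / (c * r N ^ d) := by gcongr
      _ = _ := by
        rw [smul_eq_mul]
        field_simp

end Gauge

/-! ### Masses of joint and marginal balls -/

section Joint

variable {dx dy : ℕ} {f : (Fin dx → ℝ) × (Fin dy → ℝ) → ℝ} {C K : ℝ}
  {gx : (Fin dx → ℝ) → ℝ} {gy : (Fin dy → ℝ) → ℝ} {g : (Fin dx → ℝ) × (Fin dy → ℝ) → ℝ}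
  {cx cy c : ℝ}

/-- The ball is symmetric, so twice its mass is the integral of f(z+v) + f(z-v). By semiconvexity
the integrand is at least 2 f(z) - K r^2 ≥ f(z). -/
lemma IsDensity.law_gball_ge (h : IsDensity f) (hg : IsGauge g c (dx + dy))
    (hK : ∀ z v, 2 * f z - K * ‖v‖ ^ 2 ≤ f (z + v) + f (z - v)) (hK0 : 0 ≤ K)
    (z : (Fin dx → ℝ) × (Fin dy → ℝ)) {r : ℝ} (hr : 0 ≤ r) (hrz : K * r ^ 2 ≤ f z) :
    f z * (c * r ^ (dx + dy)) / 2 ≤ (law f).real (gball g z r) := by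
  set A := {v | g v ≤ r} with hA
  have hAm : MeasurableSet A := hg.measurable measurableSet_Iic
  have hv : volume.real A = c * r ^ (dx + dy) := hg.volume_le r hr
  have e1 : (law f).real (gball g z r) = ∫ v in A, f (z + v) := by
    rw [h.law_real (hg.measurableSet_gball z r)]
    have := (measurePreserving_add_left volume z).setIntegral_preimage_emb
      (measurableEmbedding_addLeft z) f (gball g z r)
    rw [← this]
    congr 2
    ext v
    simp [gball, hA]
  have e2 : (law f).real (gball g z r) = ∫ v in A, f (z - v) := by
    rw [e1]
    have := (Measure.measurePreserving_neg volume).setIntegral_preimage_emb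
      (MeasurableEquiv.neg _).measurableEmbedding (fun v => f (z + v)) A
    rw [← this]
    have hA' : (Neg.neg ⁻¹' A : Set ((Fin dx → ℝ) × (Fin dy → ℝ))) = A := by
      ext v
      simp [hA, hg.neg]
    rw [hA']
    simp [sub_eq_add_neg]
  have hi1 : IntegrableOn (fun v => f (z + v)) A := (h.integrable.comp_add_left z).integrableOn
  have hi2 : IntegrableOn (fun v => f (z - v)) A := (h.integrable.comp_sub_left z).integrableOn
  have hAfin : volume A ≠ ∞ := by
    have : A = gball g 0 r := by ext v; simp [hA, gball]
    rw [this]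
    exact (hg.volume_gball_lt_top 0 r).ne
  have h3 : ∫ _v in A, f z ≤ ∫ v in A, (f (z + v) + f (z - v)) := by
    refine setIntegral_mono_on (integrableOn_const hAfin) (hi1.add hi2) hAm fun v hv => ?_
    have h4 : ‖v‖ ≤ r := (hg.norm_le v).trans hv
    have h5 : K * ‖v‖ ^ 2 ≤ K * r ^ 2 := by gcongr
    linarith [hK z v]
  rw [integral_add hi1 hi2, ← e1, ← e2, setIntegral_const, hv, smul_eq_mul] at h3
  linarith

/-- The density is bounded, since f ≤ C f_X ≤ C^2 almost everywhere. -/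
lemma IsDensity.law_gball_le (h : IsDensity f) (hb : BoundedCond f C)
    (hg : IsGauge g c (dx + dy)) (z : (Fin dx → ℝ) × (Fin dy → ℝ)) {r : ℝ} (hr : 0 ≤ r) :
    (law f).real (gball g z r) ≤ C * C * (c * r ^ (dx + dy)) := by
  have h1 : ∀ᵐ z, f z ≤ C * C := by
    have h3 : ∀ᵐ z : (Fin dx → ℝ) × (Fin dy → ℝ), marginalX f z.1 ≤ C :=
      Measure.quasiMeasurePreserving_fst.ae hb.X_le
    filter_upwards [hb.le_X, h3] with z h1 h2
    exact h1.trans (mul_le_mul_of_nonneg_left h2 hb.pos.le)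
  rw [h.law_real (hg.measurableSet_gball z r)]
  calc _ ≤ ∫ _w in gball g z r, C * C :=
        integral_mono_ae h.integrable.integrableOn
          (integrableOn_const (hg.volume_gball_lt_top z r).ne) (ae_restrict_of_ae h1)
    _ = _ := by
        rw [setIntegral_const, hg.volume_gball z hr, smul_eq_mul, mul_comm]

lemma IsDensity.law_gball_fst_le (h : IsDensity f) (hb : BoundedCond f C)
    (hg : IsGauge gx cx dx) (x : Fin dx → ℝ) {r : ℝ} (hr : 0 ≤ r) :
    (law f).real {w | w.1 ∈ gball gx x r} ≤ C * (cx * r ^ dx) := by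
  rw [h.law_real_fst (hg.measurableSet_gball x r)]
  calc _ ≤ ∫ _w in gball gx x r, C :=
        integral_mono_ae h.integrable_marginalX.integrableOn
          (integrableOn_const (hg.volume_gball_lt_top x r).ne) (ae_restrict_of_ae hb.X_le)
    _ = _ := by
        rw [setIntegral_const, hg.volume_gball x hr, smul_eq_mul, mul_comm]

/-- The joint ball lies in the product of the marginal balls, and on that product the majorant C f_X
integrates as a product. Read backwards, this bounds the marginal mass from below. -/
lemma IsDensity.law_gball_le_fst (h : IsDensity f) (hb : BoundedCond f C)
    (hgx : IsGauge gx cx dx) (hgy : IsGauge gy cy dy)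
    (hx : ∀ v, gx v.1 ≤ g v) (hy : ∀ v, gy v.2 ≤ g v)
    (z : (Fin dx → ℝ) × (Fin dy → ℝ)) {r : ℝ} (hr : 0 ≤ r) :
    (law f).real (gball g z r) ≤
      C * (cy * r ^ dy) * (law f).real {w | w.1 ∈ gball gx z.1 r} := by
  set Bx := gball gx z.1 r
  set By := gball gy z.2 r
  have hmx : MeasurableSet Bx := hgx.measurableSet_gball _ _
  have hmy : MeasurableSet By := hgy.measurableSet_gball _ _
  have hsub : gball g z r ⊆ Bx ×ˢ By := fun w hw =>
    ⟨(hx (w - z)).trans hw, (hy (w - z)).trans hw⟩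
  have hi : IntegrableOn (fun w : (Fin dx → ℝ) × (Fin dy → ℝ) => C * marginalX f w.1 * 1)
      (Bx ×ˢ By) := by
    rw [IntegrableOn, Measure.volume_eq_prod, ← Measure.prod_restrict]
    exact (h.integrable_marginalX.const_mul C).integrableOn.mul_prod
      (integrableOn_const (hgy.volume_gball_lt_top _ _).ne)
  have := h.isProbabilityMeasure_law
  calc (law f).real (gball g z r) ≤ (law f).real (Bx ×ˢ By) := measureReal_mono hsub
    _ = ∫ w in Bx ×ˢ By, f w := h.law_real (hmx.prod hmy)
    _ ≤ ∫ w in Bx ×ˢ By, C * marginalX f w.1 * 1 := by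
        refine integral_mono_ae h.integrable.integrableOn hi (ae_restrict_of_ae ?_)
        filter_upwards [hb.le_X] with w hw
        rwa [mul_one]
    _ = (∫ x in Bx, C * marginalX f x) * ∫ _y in By, (1 : ℝ) := by
        rw [Measure.volume_eq_prod]
        exact setIntegral_prod_mul (fun x => C * marginalX f x) (fun _ => (1 : ℝ)) Bx By
    _ = _ := by
        rw [h.law_real_fst hmx, setIntegral_const, hgy.volume_gball _ hr, integral_const_mul]
        simp
        ring

lemma IsDensity.law_swap (h : IsDensity f) {A : Set ((Fin dx → ℝ) × (Fin dy → ℝ))}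
    (hA : MeasurableSet A) : (law (f ∘ Prod.swap)).real (Prod.swap ⁻¹' A) = (law f).real A := by
  rw [h.law_real hA, h.swap.law_real (measurable_swap hA)]
  exact (Measure.measurePreserving_swap (μ := (volume : Measure (Fin dy → ℝ)))
    (ν := (volume : Measure (Fin dx → ℝ)))).setIntegral_preimage_emb
    MeasurableEquiv.prodComm.measurableEmbedding f A

end Joint

/-! ### Tail estimates for the counts around a fixed centre -/

section Tails

variable {dx dy : ℕ}

/-- The standing assumptions on the density and on the gauges used for the neighbour search. -/
structure Setup (f : (Fin dx → ℝ) × (Fin dy → ℝ) → ℝ) (C K : ℝ) (gx : (Fin dx → ℝ) → ℝ)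
    (gy : (Fin dy → ℝ) → ℝ) (g : (Fin dx → ℝ) × (Fin dy → ℝ) → ℝ) (cx cy c : ℝ) : Prop where
  dx_pos : 1 ≤ dx
  dy_pos : 1 ≤ dy
  dens : IsDensity f
  cond : BoundedCond f C
  K_pos : 0 < K
  semiconvex : ∀ z v, 2 * f z - K * ‖v‖ ^ 2 ≤ f (z + v) + f (z - v)
  gauge_x : IsGauge gx cx dx
  gauge_y : IsGauge gy cy dy
  gauge : IsGauge g c (dx + dy)
  fst_le : ∀ v, gx v.1 ≤ g v
  snd_le : ∀ v, gy v.2 ≤ g v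

/-- Points whose first coordinate is within `r` of that of `z`. -/
def xball (gx : (Fin dx → ℝ) → ℝ) (z : (Fin dx → ℝ) × (Fin dy → ℝ)) (r : ℝ) :
    Set ((Fin dx → ℝ) × (Fin dy → ℝ)) := {w | w.1 ∈ gball gx z.1 r}

/-- Points whose second coordinate is within `r` of that of `z`. -/
def yball (gy : (Fin dy → ℝ) → ℝ) (z : (Fin dx → ℝ) × (Fin dy → ℝ)) (r : ℝ) :
    Set ((Fin dx → ℝ) × (Fin dy → ℝ)) := {w | w.2 ∈ gball gy z.2 r}

/-- The radius `r` with `N c f r ^ (dx + dy) = exp s`. -/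
def rad (dx dy : ℕ) (c : ℝ) (N : ℕ) (s u : ℝ) : ℝ :=
  (Real.exp s / (N * c * u)) ^ (((dx + dy : ℕ) : ℝ)⁻¹)

lemma measurable_rad (dx dy : ℕ) (c : ℝ) (N : ℕ) (s : ℝ) : Measurable (rad dx dy c N s) := by
  unfold rad
  fun_prop

lemma rad_pos (dx dy : ℕ) {c : ℝ} (hc : 0 < c) {N : ℕ} (hN : 1 ≤ N) (s : ℝ) {u : ℝ} (hu : 0 < u) :
    0 < rad dx dy c N s u := by
  have : (0 : ℝ) < N := by exact_mod_cast hN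
  unfold rad
  positivity

lemma rad_pow {dx dy : ℕ} (hdx : 1 ≤ dx) {c : ℝ} (hc : 0 < c) {N : ℕ} (hN : 1 ≤ N)
    (s : ℝ) {u : ℝ} (hu : 0 < u) : N * c * u * rad dx dy c N s u ^ (dx + dy) = Real.exp s := by
  have : (0 : ℝ) < N := by exact_mod_cast hN
  unfold rad
  rw [Real.rpow_inv_natCast_pow (by positivity) (by omega)]
  field_simp

variable {f : (Fin dx → ℝ) × (Fin dy → ℝ) → ℝ} {C K : ℝ}
  {gx : (Fin dx → ℝ) → ℝ} {gy : (Fin dy → ℝ) → ℝ} {g : (Fin dx → ℝ) × (Fin dy → ℝ) → ℝ}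
  {cx cy c : ℝ}

namespace Setup

lemma measurableSet_xball (H : Setup f C K gx gy g cx cy c) (z : (Fin dx → ℝ) × (Fin dy → ℝ))
    (r : ℝ) : MeasurableSet (xball gx z r) :=
  measurable_fst (H.gauge_x.measurableSet_gball z.1 r)

lemma measurableSet_yball (H : Setup f C K gx gy g cx cy c) (z : (Fin dx → ℝ) × (Fin dy → ℝ))
    (r : ℝ) : MeasurableSet (yball gy z r) :=
  measurable_snd (H.gauge_y.measurableSet_gball z.2 r)

lemma law_xball_le (H : Setup f C K gx gy g cx cy c) (z : (Fin dx → ℝ) × (Fin dy → ℝ)) {r : ℝ}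
    (hr : 0 ≤ r) : (law f).real (xball gx z r) ≤ C * (cx * r ^ dx) :=
  H.dens.law_gball_fst_le H.cond H.gauge_x z.1 hr

/-- The assumptions are symmetric in the two coordinates, so estimates for `yball` can be read off
from those for `xball`. -/
lemma swap (H : Setup f C K gx gy g cx cy c) :
    Setup (f ∘ Prod.swap) C K gy gx (g ∘ Prod.swap) cy cx c where
  dx_pos := H.dy_pos
  dy_pos := H.dx_pos
  dens := H.dens.swap
  cond := H.cond.swap
  K_pos := H.K_pos
  semiconvex z v := by
    have := H.semiconvex z.swap v.swap
    rwa [show ‖v.swap‖ = ‖v‖ by simp [Prod.norm_def, max_comm]] at this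
  gauge_x := H.gauge_y
  gauge_y := H.gauge_x
  gauge :=
    { measurable := H.gauge.measurable.comp measurable_swap
      norm_le := fun v => by
        have := H.gauge.norm_le v.swap
        rwa [show ‖v.swap‖ = ‖v‖ by simp [Prod.norm_def, max_comm]] at this
      neg := fun v => H.gauge.neg v.swap
      pos := H.gauge.pos
      volume_le := fun r hr => by
        rw [add_comm dy dx, ← H.gauge.volume_le r hr]
        have := (Measure.measurePreserving_swap (μ := (volume : Measure (Fin dy → ℝ)))
          (ν := (volume : Measure (Fin dx → ℝ)))).measureReal_preimage
          (H.gauge.measurable measurableSet_Iic : MeasurableSet {v | g v ≤ r}).nullMeasurableSet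
        exact this }
  fst_le v := H.snd_le v.swap
  snd_le v := H.fst_le v.swap

lemma law_yball_eq (H : Setup f C K gx gy g cx cy c) (z : (Fin dx → ℝ) × (Fin dy → ℝ)) (r : ℝ) :
    (law (f ∘ Prod.swap)).real (xball gy z.swap r) = (law f).real (yball gy z r) := by
  have e : xball gy z.swap r = Prod.swap ⁻¹' yball gy z r := by
    ext w
    rfl
  rw [e, H.dens.law_swap (H.measurableSet_yball z r)]

lemma law_yball_le (H : Setup f C K gx gy g cx cy c) (z : (Fin dx → ℝ) × (Fin dy → ℝ)) {r : ℝ}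
    (hr : 0 ≤ r) : (law f).real (yball gy z r) ≤ C * (cy * r ^ dy) := by
  rw [← H.law_yball_eq]
  exact H.swap.law_xball_le z.swap hr

/-- The lower bound f(z) c r^d / 2 for the joint mass is set against its upper bound C cy r^dy times
the marginal mass; the factor r^dy cancels. -/
lemma law_xball_ge (H : Setup f C K gx gy g cx cy c) (z : (Fin dx → ℝ) × (Fin dy → ℝ)) {r : ℝ}
    (hr : 0 < r) (hrz : K * r ^ 2 ≤ f z) :
    f z * c * r ^ dx / (2 * C * cy) ≤ (law f).real (xball gx z r) := by
  have h1 := H.dens.law_gball_ge H.gauge H.semiconvex H.K_pos.le z hr.le hrz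
  have h2 := H.dens.law_gball_le_fst H.cond H.gauge_x H.gauge_y H.fst_le H.snd_le z hr.le
  have h3 := h1.trans h2
  have hC := H.cond.pos
  have hcy := H.gauge_y.pos
  rw [div_le_iff₀ (by positivity)]
  rw [pow_add] at h3
  have hry : 0 < r ^ dy := pow_pos hr dy
  refine le_of_mul_le_mul_right ?_ hry
  have : (law f).real (xball gx z r) = (law f).real {w | w.1 ∈ gball gx z.1 r} := rfl
  rw [this]
  linarith

lemma law_yball_ge (H : Setup f C K gx gy g cx cy c) (z : (Fin dx → ℝ) × (Fin dy → ℝ)) {r : ℝ}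
    (hr : 0 < r) (hrz : K * r ^ 2 ≤ f z) :
    f z * c * r ^ dy / (2 * C * cx) ≤ (law f).real (yball gy z r) := by
  rw [← H.law_yball_eq]
  exact H.swap.law_xball_ge z.swap hr hrz

/-- If the radius is not small, then the sample size is controlled by the density. -/
lemma sq_le_of_large_rad (H : Setup f C K gx gy g cx cy c) {N : ℕ} {s u r : ℝ}
    (hu : 0 < u) (hr : 0 < r) (hrad : N * c * u * r ^ (dx + dy) = Real.exp s)
    (hlarge : u < K * r ^ 2) :
    (N : ℝ) ^ 2 ≤ Real.exp (2 * s) * (K ^ (dx + dy) / c ^ 2 * (1 / u) ^ (dx + dy + 2)) := by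
  have hc := H.gauge.pos
  have hK := H.K_pos
  have h1 : u ^ (dx + dy) ≤ K ^ (dx + dy) * (r ^ (dx + dy)) ^ 2 := by
    have := pow_le_pow_left₀ hu.le hlarge.le (dx + dy)
    rwa [mul_pow, ← pow_mul, mul_comm 2, pow_mul] at this
  have h2 : Real.exp (2 * s) = (N * c * u * r ^ (dx + dy)) ^ 2 := by
    rw [hrad, ← Real.exp_nat_mul]
    norm_num
  rw [h2]
  have e : (N * c * u * r ^ (dx + dy)) ^ 2 * (K ^ (dx + dy) / c ^ 2 * (1 / u) ^ (dx + dy + 2)) =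
      (N : ℝ) ^ 2 * ((K ^ (dx + dy) * (r ^ (dx + dy)) ^ 2) / u ^ (dx + dy)) := by
    rw [one_div, inv_pow, pow_add u]
    field_simp
  rw [e]
  exact le_mul_of_one_le_right (by positivity) ((one_le_div (by positivity)).2 h1)

variable {Ω : Type*} [MeasurableSpace Ω] {P : Measure Ω} [IsProbabilityMeasure P]
  {Z : ℕ → Ω → (Fin dx → ℝ) × (Fin dy → ℝ)}

lemma cast_sub_one_ge {N : ℕ} (hN : 2 ≤ N) : (N : ℝ) / 2 ≤ ((N - 1 : ℕ) : ℝ) := by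
  rw [Nat.cast_sub (by omega)]
  have : (2 : ℝ) ≤ N := by exact_mod_cast hN
  push_cast
  linarith

/-- Few points within the radius at level `t / 2` is unlikely. -/
lemma prob_cnt_lt (H : Setup f C K gx gy g cx cy c) (k : ℕ) :
    ∃ A : ℝ, 0 ≤ A ∧ ∀ (Z : ℕ → Ω → (Fin dx → ℝ) × (Fin dy → ℝ)), IsIID Z (law f) P →
      ∀ (N : ℕ) (S : Finset ℕ), 2 ≤ N → S.card = N - 1 → ∀ z, 0 < f z → ∀ t : ℝ, 0 ≤ t →
      Real.exp t < N →
      P.real {ω | cnt S (gball g z (rad dx dy c N (t / 2) (f z))) (restrictSample Z S ω) < k} ≤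
        A * (1 + 1 / f z) ^ (dx + dy + 2) * Real.exp (-(t / 4)) := by
  have hc := H.gauge.pos
  have hK := H.K_pos
  refine ⟨(16 + 8 * k) + K ^ (dx + dy) / c ^ 2, by positivity, ?_⟩
  intro Z hZ N S hN hS z hz t ht hNt
  set r := rad dx dy c N (t / 2) (f z) with hr
  have hr0 : 0 < r := rad_pos dx dy hc (by omega) _ hz
  have hrad : N * c * f z * r ^ (dx + dy) = Real.exp (t / 2) :=
    rad_pow H.dx_pos hc (by omega) _ hz
  have hF : 0 ≤ 1 / f z := by positivity
  have hN0 : (0 : ℝ) < N := by positivity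
  -- For a large radius, e^(2t) < N^2 together with the polynomial bound on N^2 makes the right-hand
  -- side at least 1. For a small radius the lower bound on the ball mass is available.
  rcases lt_or_ge (f z) (K * r ^ 2) with hl | hl
  · have h1 := H.sq_le_of_large_rad hz hr0 hrad hl
    have h2 : Real.exp (2 * t) ≤ (N : ℝ) ^ 2 := by
      rw [show Real.exp (2 * t) = Real.exp t ^ 2 by rw [← Real.exp_nat_mul]; norm_num]
      gcongr
    have h3 : 1 ≤ Real.exp (-t) * (K ^ (dx + dy) / c ^ 2 * (1 / f z) ^ (dx + dy + 2)) := by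
      have h4 := h2.trans h1
      rw [show 2 * (t / 2) = t by ring, two_mul, Real.exp_add] at h4
      have h5 := le_of_mul_le_mul_left h4 (Real.exp_pos t)
      rw [Real.exp_neg]
      rwa [inv_mul_eq_div, one_le_div (Real.exp_pos t)]
    refine measureReal_le_one.trans (h3.trans ?_)
    rw [mul_comm]
    gcongr
    · linarith [show (0 : ℝ) ≤ 16 + 8 * k by positivity]
    · linarith
    · linarith
  · have hp := H.dens.law_gball_ge H.gauge H.semiconvex hK.le z hr0.le hl
    have hm := H.gauge.measurableSet_gball z r
    set p := (law f).real (gball g z r) with hpdef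
    have hmean : Real.exp (t / 2) / 4 ≤ S.card * p := by
      rw [hS]
      calc Real.exp (t / 2) / 4 = N / 2 * (f z * (c * r ^ (dx + dy)) / 2) := by
            rw [← hrad]; ring
        _ ≤ _ := by
            gcongr
            exact cast_sub_one_ge hN
    have hmpos : 0 < S.card * p := lt_of_lt_of_le (by positivity) hmean
    have hinv : 1 / (S.card * p) ≤ 4 * Real.exp (-(t / 2)) := by
      rw [Real.exp_neg, div_le_iff₀ hmpos]
      have he := Real.exp_pos (t / 2)
      rw [show 4 * (Real.exp (t / 2))⁻¹ * (S.card * p) = (S.card * p) / (Real.exp (t / 2) / 4) by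
        field_simp]
      rw [one_le_div (by positivity)]
      exact hmean
    have hprob : P.real {ω | cnt S (gball g z r) (restrictSample Z S ω) < k} ≤
        (4 + 2 * k) * (1 / (S.card * p)) := by
      -- If the mean is at least 2k, fewer than k points means at most half the mean; otherwise 2k /
      -- mean already exceeds 1.
      rcases le_or_gt (k : ℝ) (S.card * p / 2) with hk | hk
      · refine (measureReal_mono fun ω hω => ?_).trans ((hZ.cnt_le_half S hm hmpos).trans ?_)
        · simp only [Set.mem_ofPred_eq] at hω ⊢
          have : (cnt S (gball g z r) (restrictSample Z S ω) : ℝ) < k := by exact_mod_cast hω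
          linarith
        · rw [div_eq_mul_one_div]
          gcongr
          linarith [show (0 : ℝ) ≤ k by positivity]
      · refine measureReal_le_one.trans ?_
        rw [mul_one_div, one_le_div hmpos]
        linarith
    refine hprob.trans ?_
    calc (4 + 2 * (k : ℝ)) * (1 / (S.card * p)) ≤ (4 + 2 * k) * (4 * Real.exp (-(t / 2))) := by
          gcongr
      _ = (16 + 8 * k) * 1 * Real.exp (-(t / 2)) := by ring
      _ ≤ _ := by
          gcongr ?_ * ?_ * Real.exp ?_
          · linarith [show 0 ≤ K ^ (dx + dy) / c ^ 2 by positivity]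
          · exact one_le_pow₀ (by linarith)
          · linarith

/-- Many points in the marginal balls at level `t / 2` is unlikely. -/
lemma prob_cnt_mul_gt (H : Setup f C K gx gy g cx cy c) :
    ∃ A : ℝ, 0 ≤ A ∧ ∀ (Z : ℕ → Ω → (Fin dx → ℝ) × (Fin dy → ℝ)), IsIID Z (law f) P →
      ∀ (N : ℕ) (S : Finset ℕ), 2 ≤ N → S.card = N - 1 → ∀ z, 0 < f z → ∀ t : ℝ, 0 ≤ t →
      P.real {ω | N * Real.exp t <
        cnt S (xball gx z (rad dx dy c N (t / 2) (f z))) (restrictSample Z S ω) *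
        cnt S (yball gy z (rad dx dy c N (t / 2) (f z))) (restrictSample Z S ω)} ≤
        A * (1 + 1 / f z) ^ (dx + dy + 2) * Real.exp (-(t / 4)) := by
  have hc := H.gauge.pos
  have hcx := H.gauge_x.pos
  have hcy := H.gauge_y.pos
  have hC := H.cond.pos
  set B := C ^ 2 * cx * cy / c with hB
  have hB0 : 0 < B := by positivity
  refine ⟨2 * (1 + B), by positivity, ?_⟩
  intro Z hZ N S hN hS z hz t ht
  set r := rad dx dy c N (t / 2) (f z) with hr
  have hr0 : 0 < r := rad_pos dx dy hc (by omega) _ hz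
  have hrad : N * c * f z * r ^ (dx + dy) = Real.exp (t / 2) :=
    rad_pow H.dx_pos hc (by omega) _ hz
  have hN0 : (0 : ℝ) < N := by positivity
  have hSN : (S.card : ℝ) ≤ N := by
    rw [hS]; exact_mod_cast Nat.sub_le N 1
  set F := 1 / f z with hF
  have hF0 : 0 < F := by positivity
  -- The means are bounded by `ax` and `ay`, with ax ay = N B F e^(t/2). The common Markov factor θ
  -- = e^(t/4) / q is the one for which the two thresholds multiply to exactly N e^t.
  set q := Real.sqrt (B * F) with hq
  have hq0 : 0 < q := Real.sqrt_pos.2 (by positivity)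
  have hq2 : q ^ 2 = B * F := Real.sq_sqrt (by positivity)
  set θ := Real.exp (t / 4) / q with hθ
  have hθ0 : 0 < θ := by positivity
  set ax := N * (C * (cx * r ^ dx)) with hax
  set ay := N * (C * (cy * r ^ dy)) with hay
  have hax0 : 0 < ax := by positivity
  have hay0 : 0 < ay := by positivity
  have hprod : (θ * ax) * (θ * ay) = N * Real.exp t := by
    have e1 : Real.exp t = Real.exp (t / 4) ^ 2 * Real.exp (t / 2) := by
      rw [← Real.exp_nat_mul, ← Real.exp_add]
      congr 1
      push_cast
      ring
    have e2 : (θ * ax) * (θ * ay) = Real.exp (t / 4) ^ 2 / q ^ 2 * (ax * ay) := by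
      rw [hθ]
      field_simp
    rw [e2, hq2, e1, ← hrad, hax, hay, hB, hF, pow_add]
    field_simp
  have hx : P.real {ω | θ * ax ≤ cnt S (xball gx z r) (restrictSample Z S ω)} ≤ 1 / θ := by
    refine (hZ.markov_cnt S (H.measurableSet_xball z r) (by positivity)).trans ?_
    rw [div_le_div_iff₀ (by positivity) hθ0, one_mul, mul_comm]
    gcongr
    rw [hax]
    gcongr
    exact H.law_xball_le z hr0.le
  have hy : P.real {ω | θ * ay ≤ cnt S (yball gy z r) (restrictSample Z S ω)} ≤ 1 / θ := by
    refine (hZ.markov_cnt S (H.measurableSet_yball z r) (by positivity)).trans ?_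
    rw [div_le_div_iff₀ (by positivity) hθ0, one_mul, mul_comm]
    gcongr
    rw [hay]
    gcongr
    exact H.law_yball_le z hr0.le
  have hqle : q ≤ (1 + B) * (1 + F) := by
    nlinarith [sq_nonneg (q - 1), mul_pos hB0 hF0]
  calc _ ≤ P.real ({ω | θ * ax ≤ cnt S (xball gx z r) (restrictSample Z S ω)} ∪
        {ω | θ * ay ≤ cnt S (yball gy z r) (restrictSample Z S ω)}) := by
        refine measureReal_mono fun ω hω => ?_
        by_contra hn
        simp only [Set.mem_union, Set.mem_ofPred_eq, not_or, not_le] at hn hω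
        have := mul_le_mul hn.1.le hn.2.le (by positivity) (by positivity)
        rw [hprod] at this
        linarith
    _ ≤ 1 / θ + 1 / θ := (measureReal_union_le _ _).trans (add_le_add hx hy)
    _ = 2 * q * Real.exp (-(t / 4)) := by
        rw [hθ, Real.exp_neg]
        field_simp
        ring
    _ ≤ 2 * ((1 + B) * (1 + F) ^ (dx + dy + 2)) * Real.exp (-(t / 4)) := by
        gcongr
        refine hqle.trans ?_
        gcongr
        exact le_self_pow₀ (by linarith) (by omega)
    _ = _ := by ring

/-- Many points within the radius at level `-η t` is unlikely. -/
lemma prob_le_cnt (H : Setup f C K gx gy g cx cy c) {k : ℕ} (hk : 1 ≤ k) :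
    ∃ A : ℝ, 0 ≤ A ∧ ∀ (Z : ℕ → Ω → (Fin dx → ℝ) × (Fin dy → ℝ)), IsIID Z (law f) P →
      ∀ (N : ℕ) (S : Finset ℕ), 2 ≤ N → S.card = N - 1 → ∀ z, 0 < f z → ∀ s : ℝ,
      P.real {ω | k ≤ cnt S (gball g z (rad dx dy c N (-s) (f z))) (restrictSample Z S ω)} ≤
        A * (1 + 1 / f z) ^ (dx + dy + 2) * Real.exp (-s) := by
  have hc := H.gauge.pos
  have hC := H.cond.pos
  refine ⟨C * C, by positivity, ?_⟩
  intro Z hZ N S hN hS z hz s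
  set r := rad dx dy c N (-s) (f z) with hr
  have hr0 : 0 < r := rad_pos dx dy hc (by omega) _ hz
  have hrad : N * c * f z * r ^ (dx + dy) = Real.exp (-s) :=
    rad_pow H.dx_pos hc (by omega) _ hz
  have hSN : (S.card : ℝ) ≤ N := by
    rw [hS]; exact_mod_cast Nat.sub_le N 1
  have hF0 : 0 < 1 / f z := by positivity
  -- Since k ≥ 1, the event requires at least one point, and Markov's inequality at threshold 1 is
  -- enough.
  calc _ ≤ P.real {ω | (1 : ℝ) ≤ cnt S (gball g z r) (restrictSample Z S ω)} := by
        refine measureReal_mono fun ω hω => ?_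
        simp only [Set.mem_ofPred_eq] at hω ⊢
        exact_mod_cast hk.trans hω
    _ ≤ S.card * (law f).real (gball g z r) / 1 :=
        hZ.markov_cnt S (H.gauge.measurableSet_gball z r) one_pos
    _ ≤ N * (C * C * (c * r ^ (dx + dy))) := by
        rw [div_one]
        gcongr
        exact H.dens.law_gball_le H.cond H.gauge z hr0.le
    _ = C * C * (1 / f z) * Real.exp (-s) := by
        rw [← hrad]
        field_simp
    _ ≤ _ := by
        gcongr
        exact le_trans (by linarith) (le_self_pow₀ (by linarith) (by omega : dx + dy + 2 ≠ 0))

end Setup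

end Tails

/-! ### A common integrable tail for the logarithms of the counts -/

section TailBound

variable {dx dy : ℕ}

/-- The exponential rate of the tail bounds. -/
def tailRate (dx dy : ℕ) : ℝ := 1 / (2 * ((dx + dy : ℕ) : ℝ))

lemma tailRate_pos (hdx : 1 ≤ dx) : 0 < tailRate dx dy := by
  have : (0 : ℝ) < ((dx + dy : ℕ) : ℝ) := by exact_mod_cast (by omega : 0 < dx + dy)
  unfold tailRate
  positivity

/-- The rate is fixed so that the level shift s = ηt satisfies s d = t / 2, the relation used in
`mul_rad_pow_ge`. -/
lemma tailRate_mul (hdx : 1 ≤ dx) : tailRate dx dy * ((dx + dy : ℕ) : ℝ) = 1 / 2 := by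
  have : (0 : ℝ) < ((dx + dy : ℕ) : ℝ) := by exact_mod_cast (by omega : 0 < dx + dy)
  unfold tailRate
  field_simp

lemma tailRate_le (hdx : 1 ≤ dx) (hdy : 1 ≤ dy) : tailRate dx dy ≤ 1 / 4 := by
  have : (2 : ℝ) ≤ ((dx + dy : ℕ) : ℝ) := by exact_mod_cast (by omega : 2 ≤ dx + dy)
  unfold tailRate
  rw [div_le_div_iff₀ (by positivity) (by norm_num)]
  linarith

/-- The mean number of points in a marginal ball is large when the joint ball is small. -/
lemma mul_rad_pow_ge {N d e e' : ℕ} (hd : e + e' = d) (he' : 1 ≤ e') {c u r M s t : ℝ}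
    (hc : 0 < c) (hu : 0 < u) (hr : 0 < r) (hM : 0 < M) (huM : u ≤ M) (hs : s * d = t / 2)
    (hs0 : 0 ≤ s) (ht : 0 ≤ t)
    (hrad : N * c * u * r ^ d = Real.exp (-s)) (hN : Real.exp t ≤ N) :
    Real.exp s * min 1 (1 / (c * M)) ≤ N * r ^ e := by
  set b := min 1 (1 / (c * M)) with hb
  have hb0 : 0 < b := by positivity
  have hb1 : b ≤ 1 := min_le_left _ _
  have hN0 : (0 : ℝ) < N := (Real.exp_pos t).trans_le hN
  have hd0 : d ≠ 0 := by omega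
  -- On d-th powers the level equation eliminates r: (N r^e)^d equals N^(e') (e^(-s) / (c u))^e.
  -- Here N^(e') ≥ e^t because e' ≥ 1, and e^(sd) = e^t e^(-sd) because s d = t / 2.
  refine le_of_pow_le_pow_left₀ hd0 (by positivity) ?_
  have hrd : r ^ d = Real.exp (-s) * (1 / (c * u)) / N := by
    rw [← hrad]
    field_simp
  have hbu : b ≤ 1 / (c * u) := by
    refine (min_le_right _ _).trans ?_
    gcongr
  have e1 : (N * r ^ e) ^ d = (N : ℝ) ^ e' * (Real.exp (-s) ^ e * (1 / (c * u)) ^ e) := by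
    rw [mul_pow, ← pow_mul, mul_comm e d, pow_mul, hrd, div_pow, mul_pow, ← hd, pow_add]
    field_simp
  have e2 : Real.exp s ^ d ≤ (N : ℝ) ^ e' * Real.exp (-s) ^ e := by
    have h1 : Real.exp t ≤ (N : ℝ) ^ e' := by
      refine hN.trans (le_self_pow₀ ?_ (by omega))
      exact (Real.one_le_exp ht).trans hN
    have h2 : Real.exp (-s) ^ d ≤ Real.exp (-s) ^ e :=
      pow_le_pow_of_le_one (Real.exp_pos _).le (Real.exp_le_one_iff.2 (by linarith)) (by omega)
    have h3 : Real.exp s ^ d = Real.exp t * Real.exp (-s) ^ d := by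
      rw [← Real.exp_nat_mul, ← Real.exp_nat_mul, ← Real.exp_add]
      congr 1
      linarith
    rw [h3]
    gcongr
  have e3 : b ^ d ≤ (1 / (c * u)) ^ e :=
    (pow_le_pow_of_le_one hb0.le hb1 (by omega)).trans (pow_le_pow_left₀ hb0.le hbu e)
  rw [e1, mul_pow, ← mul_assoc]
  gcongr

variable {f : (Fin dx → ℝ) × (Fin dy → ℝ) → ℝ} {C K : ℝ}
  {gx : (Fin dx → ℝ) → ℝ} {gy : (Fin dy → ℝ) → ℝ} {g : (Fin dx → ℝ) × (Fin dy → ℝ) → ℝ}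
  {cx cy c : ℝ} {Ω : Type*} [MeasurableSpace Ω] {P : Measure Ω} [IsProbabilityMeasure P]

namespace Setup

/-- Few points in the marginal balls at level `-η t` is unlikely. -/
lemma prob_cnt_mul_lt (H : Setup f C K gx gy g cx cy c) :
    ∃ A : ℝ, 0 ≤ A ∧ ∀ (Z : ℕ → Ω → (Fin dx → ℝ) × (Fin dy → ℝ)), IsIID Z (law f) P →
      ∀ (N : ℕ) (S : Finset ℕ), 2 ≤ N → S.card = N - 1 → ∀ z, 0 < f z → f z ≤ C * C →
      ∀ t : ℝ, 0 ≤ t → Real.exp t < N →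
      P.real {ω |
        (cnt S (xball gx z (rad dx dy c N (-(tailRate dx dy * t)) (f z))) (restrictSample Z S ω) *
        cnt S (yball gy z (rad dx dy c N (-(tailRate dx dy * t)) (f z))) (restrictSample Z S ω) : ℝ)
          < N * Real.exp (-t)} ≤
        A * (1 + 1 / f z) ^ (dx + dy + 2) * Real.exp (-(tailRate dx dy * t)) := by
  have hc := H.gauge.pos
  have hcx := H.gauge_x.pos
  have hcy := H.gauge_y.pos
  have hC := H.cond.pos
  have hK := H.K_pos
  set b := min 1 (1 / (c * (C * C))) with hb
  have hb0 : 0 < b := by positivity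
  set A1 := 16 * C * cy / (c * b) with hA1
  set A2 := 16 * C * cx / (c * b) with hA2
  set A3 := 64 * C ^ 2 * cx * cy / c with hA3
  set A4 := K ^ (dx + dy) / c ^ 2 with hA4
  refine ⟨A1 + A2 + A3 + A4, by positivity, ?_⟩
  intro Z hZ N S hN hS z hz hzC t ht hNt
  set s := tailRate dx dy * t with hs
  set r := rad dx dy c N (-s) (f z) with hr
  have hη := tailRate_pos (dy := dy) H.dx_pos
  have hs0 : 0 ≤ s := by positivity
  have hsd : s * ((dx + dy : ℕ) : ℝ) = t / 2 := by
    rw [hs, mul_right_comm, tailRate_mul H.dx_pos]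
    ring
  have hst : 2 * s ≤ t := by
    rw [hs]
    nlinarith [tailRate_le H.dx_pos H.dy_pos]
  have hr0 : 0 < r := rad_pos dx dy hc (by omega) _ hz
  have hrad : N * c * f z * r ^ (dx + dy) = Real.exp (-s) :=
    rad_pow H.dx_pos hc (by omega) _ hz
  have hN0 : (0 : ℝ) < N := by positivity
  set F := 1 / f z with hF
  have hF0 : 0 < F := by positivity
  have hone : F ≤ (1 + F) ^ (dx + dy + 2) :=
    le_trans (by linarith) (le_self_pow₀ (by linarith) (by omega : dx + dy + 2 ≠ 0))
  have hA1' : 0 ≤ A1 := by positivity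
  have hA2' : 0 ≤ A2 := by positivity
  have hA3' : 0 ≤ A3 := by positivity
  have hA4' : 0 ≤ A4 := by positivity
  -- For a large radius, 1 ≤ N^2 and the polynomial bound on N^2 make the claim trivial.
  rcases lt_or_ge (f z) (K * r ^ 2) with hl | hl
  · have h1 := H.sq_le_of_large_rad hz hr0 hrad hl
    have h2 : (1 : ℝ) ≤ (N : ℝ) ^ 2 := by
      have : (1 : ℝ) ≤ N := by exact_mod_cast (by omega : 1 ≤ N)
      exact one_le_pow₀ this
    refine measureReal_le_one.trans (h2.trans (h1.trans ?_))
    rw [mul_comm]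
    gcongr ?_ * ?_ ^ _ * Real.exp ?_
    · linarith
    · linarith
    · linarith
  · have hQx := H.law_xball_ge z hr0 hl
    have hQy := H.law_yball_ge z hr0 hl
    set mx := S.card * (law f).real (xball gx z r) with hmx
    set my := S.card * (law f).real (yball gy z r) with hmy
    have hcard : (N : ℝ) / 2 ≤ S.card := by
      rw [hS]
      exact cast_sub_one_ge hN
    have hmx1 : f z * c / (4 * C * cy) * (N * r ^ dx) ≤ mx := by
      calc _ = (N : ℝ) / 2 * (f z * c * r ^ dx / (2 * C * cy)) := by
            field_simp
            ring
        _ ≤ mx := by rw [hmx]; gcongr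
    have hmy1 : f z * c / (4 * C * cx) * (N * r ^ dy) ≤ my := by
      calc _ = (N : ℝ) / 2 * (f z * c * r ^ dy / (2 * C * cx)) := by
            field_simp
            ring
        _ ≤ my := by rw [hmy]; gcongr
    have hgx := mul_rad_pow_ge (e := dx) (e' := dy) rfl H.dy_pos hc hz hr0 (mul_pos hC hC) hzC hsd
      hs0 ht hrad hNt.le
    have hgy := mul_rad_pow_ge (e := dy) (e' := dx) (add_comm dy dx) H.dx_pos hc hz hr0
      (mul_pos hC hC) hzC hsd hs0 ht hrad hNt.le
    rw [← hb] at hgx hgy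
    have hmx2 : f z * c / (4 * C * cy) * (Real.exp s * b) ≤ mx := le_trans (by gcongr) hmx1
    have hmy2 : f z * c / (4 * C * cx) * (Real.exp s * b) ≤ my := le_trans (by gcongr) hmy1
    have hmx0 : 0 < mx := lt_of_lt_of_le (by positivity) hmx2
    have hmy0 : 0 < my := lt_of_lt_of_le (by positivity) hmy2
    have hx := hZ.cnt_le_half S (H.measurableSet_xball z r) hmx0
    have hy := hZ.cnt_le_half S (H.measurableSet_yball z r) hmy0
    rw [← hmx] at hx
    rw [← hmy] at hy
    have hx' : 4 / mx ≤ A1 * F * Real.exp (-s) := by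
      calc 4 / mx ≤ 4 / (f z * c / (4 * C * cy) * (Real.exp s * b)) := by gcongr
        _ = _ := by
          rw [hA1, hF, Real.exp_neg]
          field_simp
          norm_num
    have hy' : 4 / my ≤ A2 * F * Real.exp (-s) := by
      calc 4 / my ≤ 4 / (f z * c / (4 * C * cx) * (Real.exp s * b)) := by gcongr
        _ = _ := by
          rw [hA2, hF, Real.exp_neg]
          field_simp
          norm_num
    -- If A3 F e^(-s) ≥ 1 the claim is trivial. Otherwise the product of the two half-means is at
    -- least N e^(-2s) ≥ N e^(-t), so a product below N e^(-t) forces one count below half its mean.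
    rcases le_or_gt 1 (A3 * F * Real.exp (-s)) with h3 | h3
    · refine measureReal_le_one.trans (h3.trans ?_)
      gcongr
      linarith
    · have hprod : N * Real.exp (-t) ≤ mx / 2 * (my / 2) := by
        have h4 : f z * c / (4 * C * cy) * (N * r ^ dx) * (f z * c / (4 * C * cx) * (N * r ^ dy)) ≤
            mx * my := by gcongr
        have h5 : f z * c / (4 * C * cy) * (N * r ^ dx) * (f z * c / (4 * C * cx) * (N * r ^ dy)) =
            N * Real.exp (-s) * (4 / (A3 * F)) := by
          rw [← hrad, hA3, hF, pow_add]
          field_simp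
          norm_num
        have h6 : Real.exp (-t) ≤ Real.exp (-s) * Real.exp (-s) := by
          rw [← Real.exp_add]
          exact Real.exp_le_exp.2 (by linarith)
        have hAF : 0 < A3 * F := by positivity
        have h7 : Real.exp (-s) * Real.exp (-s) ≤ Real.exp (-s) * (1 / (A3 * F)) := by
          gcongr
          rw [le_div_iff₀ hAF]
          linarith
        have h8 : N * Real.exp (-s) * (4 / (A3 * F)) = 4 * (N * (Real.exp (-s) * (1 / (A3 * F)))) := by
          ring
        have h9 : N * Real.exp (-t) ≤ N * (Real.exp (-s) * (1 / (A3 * F))) := by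
          gcongr
          exact h6.trans h7
        linarith
      calc _ ≤ P.real ({ω | (cnt S (xball gx z r) (restrictSample Z S ω) : ℝ) ≤ mx / 2} ∪
            {ω | (cnt S (yball gy z r) (restrictSample Z S ω) : ℝ) ≤ my / 2}) := by
            refine measureReal_mono fun ω hω => ?_
            by_contra hn
            simp only [Set.mem_union, Set.mem_ofPred_eq, not_or, not_le] at hn hω
            have := mul_le_mul hn.1.le hn.2.le (by positivity) (by positivity)
            linarith
        _ ≤ A1 * F * Real.exp (-s) + A2 * F * Real.exp (-s) :=
            (measureReal_union_le _ _).trans (add_le_add (hx.trans hx') (hy.trans hy'))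
        _ = (A1 + A2) * F * Real.exp (-s) := by ring
        _ ≤ _ := by
            gcongr ?_ * ?_ * Real.exp (-s)
            linarith

lemma measurableSet_gball_rad (H : Setup f C K gx gy g cx cy c) (N : ℕ) (s : ℝ) :
    MeasurableSet {q : ((Fin dx → ℝ) × (Fin dy → ℝ)) × ((Fin dx → ℝ) × (Fin dy → ℝ)) |
      q.2 ∈ gball g q.1 (rad dx dy c N s (f q.1))} :=
  H.gauge.measurableSet_gball_prod measurable_id
    ((measurable_rad dx dy c N s).comp H.dens.measurable)

lemma measurableSet_xball_rad (H : Setup f C K gx gy g cx cy c) (N : ℕ) (s : ℝ) :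
    MeasurableSet {q : ((Fin dx → ℝ) × (Fin dy → ℝ)) × ((Fin dx → ℝ) × (Fin dy → ℝ)) |
      q.2 ∈ xball gx q.1 (rad dx dy c N s (f q.1))} := by
  have h1 := H.gauge_x.measurableSet_gball_prod (C := (Fin dx → ℝ) × (Fin dy → ℝ))
    measurable_fst ((measurable_rad dx dy c N s).comp H.dens.measurable)
  exact (measurable_fst.prodMk (measurable_fst.comp measurable_snd)) h1

lemma measurableSet_yball_rad (H : Setup f C K gx gy g cx cy c) (N : ℕ) (s : ℝ) :
    MeasurableSet {q : ((Fin dx → ℝ) × (Fin dy → ℝ)) × ((Fin dx → ℝ) × (Fin dy → ℝ)) |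
      q.2 ∈ yball gy q.1 (rad dx dy c N s (f q.1))} := by
  have h1 := H.gauge_y.measurableSet_gball_prod (C := (Fin dx → ℝ) × (Fin dy → ℝ))
    measurable_snd ((measurable_rad dx dy c N s).comp H.dens.measurable)
  exact (measurable_fst.prodMk (measurable_snd.comp measurable_snd)) h1

lemma ae_le_sq (H : Setup f C K gx gy g cx cy c) : ∀ᵐ z ∂(law f), f z ≤ C * C := by
  refine IsDensity.ae_law_of_ae ?_
  have h3 : ∀ᵐ z : (Fin dx → ℝ) × (Fin dy → ℝ), marginalX f z.1 ≤ C :=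
    Measure.quasiMeasurePreserving_fst.ae H.cond.X_le
  filter_upwards [H.cond.le_X, h3] with z h1 h2
  exact h1.trans (mul_le_mul_of_nonneg_left h2 H.cond.pos.le)

end Setup

/-- `nx` and `ny` are the numbers of sample points within the `k`-nearest neighbour distance of `z`
in the two coordinates. -/
structure KnnCounts (gx : (Fin dx → ℝ) → ℝ) (gy : (Fin dy → ℝ) → ℝ)
    (g : (Fin dx → ℝ) × (Fin dy → ℝ) → ℝ) (k : ℕ) (S : Finset ℕ) (z : (Fin dx → ℝ) × (Fin dy → ℝ))
    (w : S → (Fin dx → ℝ) × (Fin dy → ℝ)) (nx ny : ℕ) : Prop where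
  le_of : ∀ r, 0 ≤ r → k ≤ cnt S (gball g z r) w →
    nx ≤ cnt S (xball gx z r) w ∧ ny ≤ cnt S (yball gy z r) w
  ge_of : ∀ r, 0 ≤ r → cnt S (gball g z r) w < k →
    cnt S (xball gx z r) w ≤ nx ∧ cnt S (yball gy z r) w ≤ ny
  x_pos : 1 ≤ nx
  y_pos : 1 ≤ ny
  x_le : nx ≤ S.card
  y_le : ny ≤ S.card

/-- The logarithm of `nx ny / N`. -/
def logCounts (N nx ny : ℕ) : ℝ := Real.log nx + Real.log ny - Real.log N

lemma exp_logCounts {N nx ny : ℕ} (hN : 1 ≤ N) (hx : 1 ≤ nx) (hy : 1 ≤ ny) :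
    Real.exp (logCounts N nx ny) = nx * ny / N := by
  have h1 : (0 : ℝ) < N := by exact_mod_cast hN
  have h2 : (0 : ℝ) < nx := by exact_mod_cast hx
  have h3 : (0 : ℝ) < ny := by exact_mod_cast hy
  rw [logCounts, Real.exp_sub, Real.exp_add, Real.exp_log h1, Real.exp_log h2, Real.exp_log h3]

/-- A smooth substitute for min(1, x): with x = a e^(-ηt) its integral over t > 0 is a logarithm of
1 + a. -/
lemma le_two_mul_div_one_add {p x : ℝ} (hx : 0 ≤ x) (h1 : p ≤ 1) (h2 : p ≤ x) :
    p ≤ 2 * x / (1 + x) := by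
  rw [le_div_iff₀ (by linarith)]
  nlinarith

namespace Setup

/-- The tail bound on the number of neighbours given the centre. -/
lemma tail_bound (H : Setup f C K gx gy g cx cy c) {k : ℕ} (hk : 1 ≤ k) :
    ∃ A : ℝ, 0 ≤ A ∧ ∀ (Z : ℕ → Ω → (Fin dx → ℝ) × (Fin dy → ℝ)), IsIID Z (law f) P →
      ∀ (N i : ℕ), 2 ≤ N → i < N → ∀ nx ny : Ω → ℕ,
      (∀ ω, KnnCounts gx gy g k ((Finset.range N).erase i) (Z i ω)
        (restrictSample Z ((Finset.range N).erase i) ω) (nx ω) (ny ω)) → ∀ t : ℝ, 0 ≤ t →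
      P.real {ω | t < |logCounts N (nx ω) (ny ω)|} ≤
        ∫ z, 2 * (A * (1 + 1 / f z) ^ (dx + dy + 2) * Real.exp (-(tailRate dx dy * t))) /
          (1 + A * (1 + 1 / f z) ^ (dx + dy + 2) * Real.exp (-(tailRate dx dy * t))) ∂(law f) := by
  obtain ⟨A1, hA1, h1⟩ := H.prob_cnt_lt (P := P) k
  obtain ⟨A2, hA2, h2⟩ := H.prob_cnt_mul_gt (P := P)
  obtain ⟨A3, hA3, h3⟩ := H.prob_le_cnt (P := P) hk
  obtain ⟨A4, hA4, h4⟩ := H.prob_cnt_mul_lt (P := P)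
  have hfm := H.dens.measurable
  have hprob := H.dens.isProbabilityMeasure_law
  refine ⟨A1 + A2 + A3 + A4, by positivity, ?_⟩
  intro Z hZ N i hN hi nx ny hn t ht
  set S := (Finset.range N).erase i with hSdef
  have hS : S.card = N - 1 := by
    rw [hSdef, Finset.card_erase_of_mem (Finset.mem_range.2 hi), Finset.card_range]
  have hiS : i ∉ S := Finset.notMem_erase _ _
  set x := fun z => (A1 + A2 + A3 + A4) * (1 + 1 / f z) ^ (dx + dy + 2) *
    Real.exp (-(tailRate dx dy * t)) with hx
  have hx0 : ∀ z, 0 ≤ x z := fun z => by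
    have := H.dens.nonneg z
    positivity
  have hN0 : (0 : ℝ) < N := by positivity
  rcases le_or_gt (N : ℝ) (Real.exp t) with hNt | hNt
  -- All counts lie between 1 and N, so |log(nx ny / N)| ≤ log N ≤ t and the event is empty.
  · have hempty : {ω | t < |logCounts N (nx ω) (ny ω)|} = ∅ := by
      rw [Set.eq_empty_iff_forall_notMem]
      intro ω hω
      simp only [Set.mem_ofPred_eq] at hω
      have hlogN : Real.log N ≤ t := by
        rw [← Real.log_exp t]
        exact Real.log_le_log hN0 hNt
      have hle : ∀ n : ℕ, n ≤ S.card → 1 ≤ n → Real.log n ≤ Real.log N := fun n hn hn1 =>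
        Real.log_le_log (by exact_mod_cast hn1) (by exact_mod_cast (hn.trans (by omega)))
      have hge : ∀ n : ℕ, 0 ≤ Real.log n := fun n => Real.log_natCast_nonneg n
      have a1 := hle _ (hn ω).x_le (hn ω).x_pos
      have a2 := hle _ (hn ω).y_le (hn ω).y_pos
      have a3 := hge (nx ω)
      have a4 := hge (ny ω)
      have : |logCounts N (nx ω) (ny ω)| ≤ Real.log N := by
        rw [logCounts, abs_le]
        constructor <;> linarith
      linarith
    rw [hempty, measureReal_empty]
    exact integral_nonneg fun z => div_nonneg (by have := hx0 z; positivity) (by have := hx0 z; positivity)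
  · set η := tailRate dx dy with hη
    let cj := fun s (q : ((Fin dx → ℝ) × (Fin dy → ℝ)) × (S → (Fin dx → ℝ) × (Fin dy → ℝ))) =>
      (cnt S (gball g q.1 (rad dx dy c N s (f q.1))) q.2 : ℝ)
    let cX := fun s (q : ((Fin dx → ℝ) × (Fin dy → ℝ)) × (S → (Fin dx → ℝ) × (Fin dy → ℝ))) =>
      (cnt S (xball gx q.1 (rad dx dy c N s (f q.1))) q.2 : ℝ)
    let cY := fun s (q : ((Fin dx → ℝ) × (Fin dy → ℝ)) × (S → (Fin dx → ℝ) × (Fin dy → ℝ))) =>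
      (cnt S (yball gy q.1 (rad dx dy c N s (f q.1))) q.2 : ℝ)
    have hcj : ∀ s, Measurable (cj s) := fun s =>
      measurable_cnt S (B := fun z => gball g z (rad dx dy c N s (f z))) (H.measurableSet_gball_rad N s)
    have hcX : ∀ s, Measurable (cX s) := fun s =>
      measurable_cnt S (B := fun z => xball gx z (rad dx dy c N s (f z))) (H.measurableSet_xball_rad N s)
    have hcY : ∀ s, Measurable (cY s) := fun s =>
      measurable_cnt S (B := fun z => yball gy z (rad dx dy c N s (f z))) (H.measurableSet_yball_rad N s)
    -- Off G1 the neighbour distance is at most the radius at level t/2, and off G2 the cylinders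
    -- there have product at most N e^t. Off G3 it is at least the radius at level -ηt, and off G4
    -- the cylinders there have product at least N e^(-t).
    let G1 := {q | cj (t / 2) q < k}
    let G2 := {q | N * Real.exp t < cX (t / 2) q * cY (t / 2) q}
    let G3 := {q | k ≤ cj (-(η * t)) q}
    let G4 := {q | cX (-(η * t)) q * cY (-(η * t)) q < N * Real.exp (-t)}
    have hG1 : MeasurableSet G1 := measurableSet_lt (hcj _) measurable_const
    have hG2 : MeasurableSet G2 := measurableSet_lt measurable_const ((hcX _).mul (hcY _))
    have hG3 : MeasurableSet G3 := measurableSet_le measurable_const (hcj _)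
    have hG4 : MeasurableSet G4 := measurableSet_lt ((hcX _).mul (hcY _)) measurable_const
    have hG : MeasurableSet (G1 ∪ G2 ∪ G3 ∪ G4) := ((hG1.union hG2).union hG3).union hG4
    have hrnn : ∀ s z, 0 ≤ rad dx dy c N s (f z) := fun s z => by
      have := H.dens.nonneg z
      have := H.gauge.pos
      unfold rad
      positivity
    have hsub : {ω | t < |logCounts N (nx ω) (ny ω)|} ⊆
        {ω | (Z i ω, restrictSample Z S ω) ∈ G1 ∪ G2 ∪ G3 ∪ G4} := by
      intro ω hω
      simp only [Set.mem_ofPred_eq] at hω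
      have hexp := exp_logCounts (by omega : 1 ≤ N) (hn ω).x_pos (hn ω).y_pos
      by_contra hcon
      simp only [Set.mem_union, Set.mem_ofPred_eq, not_or, G1, G2, G3, G4, not_lt, not_le, cj, cX,
        cY] at hcon
      obtain ⟨⟨⟨b1, b2⟩, b3⟩, b4⟩ := hcon
      obtain ⟨u1, u2⟩ := (hn ω).le_of _ (hrnn (t / 2) (Z i ω)) (by exact_mod_cast b1)
      obtain ⟨l1, l2⟩ := (hn ω).ge_of _ (hrnn (-(η * t)) (Z i ω)) (by exact_mod_cast b3)
      have up : ((nx ω : ℝ) * ny ω) ≤ N * Real.exp t := le_trans (by gcongr) b2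
      have lo : N * Real.exp (-t) ≤ ((nx ω : ℝ) * ny ω) := b4.trans (by gcongr)
      rcases lt_abs.1 hω with h' | h'
      · have := Real.exp_lt_exp.2 h'
        rw [hexp, lt_div_iff₀ hN0] at this
        linarith
      · have := Real.exp_lt_exp.2 (lt_neg.1 h')
        rw [hexp, div_lt_iff₀ hN0] at this
        linarith
    refine (measureReal_mono hsub).trans ?_
    rw [hZ.freeze_one hiS hG]
    have hmeas : Measurable fun z => P.real {ω | (z, restrictSample Z S ω) ∈ G1 ∪ G2 ∪ G3 ∪ G4} :=
      measurable_measureReal_frozen (hZ.measurable_restrictSample S) hG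
    have hxm : Measurable x := by
      rw [hx]
      fun_prop
    refine integral_mono_ae ?_ ?_ ?_
    · refine Integrable.of_bound hmeas.aestronglyMeasurable 1 (ae_of_all _ fun z => ?_)
      rw [Real.norm_of_nonneg measureReal_nonneg]
      exact measureReal_le_one
    · refine Integrable.of_bound (((hxm.const_mul 2).div (hxm.const_add 1)).aestronglyMeasurable) 2
        (ae_of_all _ fun z => ?_)
      have := hx0 z
      rw [Real.norm_of_nonneg (by positivity), div_le_iff₀ (by positivity)]
      linarith
    · filter_upwards [H.dens.ae_law_pos, H.ae_le_sq] with z hz hzC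
      refine le_two_mul_div_one_add (hx0 z) measureReal_le_one ?_
      have p1 : P.real {ω | (z, restrictSample Z S ω) ∈ G1} ≤
          A1 * (1 + 1 / f z) ^ (dx + dy + 2) * Real.exp (-(t / 4)) := by
        have := h1 Z hZ N S hN hS z hz t ht hNt
        simp only [G1, cj, Set.mem_ofPred_eq, Nat.cast_lt]
        exact this
      have p2 := h2 Z hZ N S hN hS z hz t ht
      have p3 : P.real {ω | (z, restrictSample Z S ω) ∈ G3} ≤
          A3 * (1 + 1 / f z) ^ (dx + dy + 2) * Real.exp (-(η * t)) := by
        have := h3 Z hZ N S hN hS z hz (η * t)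
        simp only [G3, cj, Set.mem_ofPred_eq, Nat.cast_le]
        exact this
      have p4 := h4 Z hZ N S hN hS z hz hzC t ht hNt
      have hexp : Real.exp (-(t / 4)) ≤ Real.exp (-(η * t)) := by
        refine Real.exp_le_exp.2 ?_
        have := tailRate_le H.dx_pos H.dy_pos
        nlinarith
      set m := (1 + 1 / f z) ^ (dx + dy + 2)
      have hm0 : 0 ≤ m := by positivity
      calc P.real {ω | (z, restrictSample Z S ω) ∈ G1 ∪ G2 ∪ G3 ∪ G4}
          ≤ P.real {ω | (z, restrictSample Z S ω) ∈ G1} +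
            P.real {ω | (z, restrictSample Z S ω) ∈ G2} +
            P.real {ω | (z, restrictSample Z S ω) ∈ G3} +
            P.real {ω | (z, restrictSample Z S ω) ∈ G4} := by
            refine (measureReal_union_le ({ω | (z, restrictSample Z S ω) ∈ G1 ∪ G2 ∪ G3})
              {ω | (z, restrictSample Z S ω) ∈ G4}).trans ?_
            gcongr
            refine (measureReal_union_le ({ω | (z, restrictSample Z S ω) ∈ G1 ∪ G2})
              {ω | (z, restrictSample Z S ω) ∈ G3}).trans ?_
            gcongr
            exact measureReal_union_le ({ω | (z, restrictSample Z S ω) ∈ G1})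
              {ω | (z, restrictSample Z S ω) ∈ G2}
        _ ≤ A1 * m * Real.exp (-(η * t)) + A2 * m * Real.exp (-(η * t)) +
            A3 * m * Real.exp (-(η * t)) + A4 * m * Real.exp (-(η * t)) := by
            refine add_le_add (add_le_add (add_le_add (p1.trans ?_) (p2.trans ?_)) p3) p4
            · gcongr
            · gcongr
        _ = x z := by
            rw [hx]
            ring

end Setup

/-- An integrable tail function. -/
lemma integrableOn_tail {E : Type*} [MeasurableSpace E] {μ : Measure E} [IsProbabilityMeasure μ]
    {a : E → ℝ} (ha : Measurable a) (ha0 : ∀ z, 0 ≤ a z)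
    (hlog : Integrable (fun z => Real.log (1 + a z)) μ) {η : ℝ} (hη : 0 < η) :
    IntegrableOn (fun t => ∫ z, 2 * (a z * Real.exp (-(η * t))) / (1 + a z * Real.exp (-(η * t))) ∂μ)
      (Set.Ioi 0) := by
  -- The explicit antiderivative gives the t-integral (2/η) log(1 + a z). Its integrability in z,
  -- with Tonelli, makes the double integral finite.
  have hderiv : ∀ z t, HasDerivAt (fun t => -(2 / η) * Real.log (1 + a z * Real.exp (-(η * t))))
      (2 * (a z * Real.exp (-(η * t))) / (1 + a z * Real.exp (-(η * t)))) t := by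
    intro z t
    have hpos : 0 < 1 + a z * Real.exp (-(η * t)) := by have := ha0 z; positivity
    have h1 : HasDerivAt (fun t : ℝ => -(η * t)) (-η) t := by
      convert! ((hasDerivAt_id t).const_mul η).neg using 1
      simp
    have h2 := (((h1.exp.const_mul (a z)).const_add 1).log hpos.ne').const_mul (-(2 / η))
    convert! h2 using 1
    field_simp
  have hnn : ∀ z t, 0 ≤ 2 * (a z * Real.exp (-(η * t))) / (1 + a z * Real.exp (-(η * t))) := by
    intro z t
    have := ha0 z
    positivity
  have hlim : ∀ z, Tendsto (fun t => -(2 / η) * Real.log (1 + a z * Real.exp (-(η * t)))) atTop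
      (𝓝 0) := by
    intro z
    have h1 : Tendsto (fun t : ℝ => Real.exp (-(η * t))) atTop (𝓝 0) :=
      Real.tendsto_exp_neg_atTop_nhds_zero.comp (tendsto_id.const_mul_atTop hη)
    have h2 : Tendsto (fun t : ℝ => 1 + a z * Real.exp (-(η * t))) atTop (𝓝 1) := by
      simpa using (h1.const_mul (a z)).const_add 1
    simpa using (h2.log one_ne_zero).const_mul (-(2 / η))
  have hint : ∀ z, IntegrableOn (fun t => 2 * (a z * Real.exp (-(η * t))) /
      (1 + a z * Real.exp (-(η * t)))) (Set.Ioi 0) := fun z =>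
    integrableOn_Ioi_deriv_of_nonneg' (fun t _ => hderiv z t) (fun t _ => hnn z t) (hlim z)
  have hval : ∀ z, ∫ t in Set.Ioi 0, 2 * (a z * Real.exp (-(η * t))) /
      (1 + a z * Real.exp (-(η * t))) = 2 / η * Real.log (1 + a z) := by
    intro z
    rw [integral_Ioi_of_hasDerivAt_of_nonneg' (fun t _ => hderiv z t) (fun t _ => hnn z t) (hlim z)]
    simp
  have hjoint : Integrable (fun q : ℝ × E => 2 * (a q.2 * Real.exp (-(η * q.1))) /
      (1 + a q.2 * Real.exp (-(η * q.1)))) ((volume.restrict (Set.Ioi 0)).prod μ) := by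
    have hm : Measurable (fun q : ℝ × E => 2 * (a q.2 * Real.exp (-(η * q.1))) /
        (1 + a q.2 * Real.exp (-(η * q.1)))) := by
      have h1 : Measurable fun q : ℝ × E => a q.2 * Real.exp (-(η * q.1)) := by fun_prop
      exact (h1.const_mul 2).div (h1.const_add 1)
    rw [integrable_prod_iff' hm.aestronglyMeasurable]
    refine ⟨ae_of_all _ hint, ?_⟩
    refine (hlog.const_mul (2 / η)).congr (ae_of_all _ fun z => ?_)
    simp only [Real.norm_of_nonneg (hnn z _)]
    exact (hval z).symm
  exact hjoint.integral_prod_left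

namespace Setup

/-- The logarithms of the neighbour counts have a common integrable tail. -/
lemma exists_tail (H : Setup f C K gx gy g cx cy c) {k : ℕ} (hk : 1 ≤ k)
    (hent : Integrable fun z => f z * |Real.log (f z)|) :
    ∃ q : ℝ → ℝ, IntegrableOn q (Set.Ioi 0) ∧
      ∀ (Z : ℕ → Ω → (Fin dx → ℝ) × (Fin dy → ℝ)), IsIID Z (law f) P →
      ∀ (N i : ℕ), 2 ≤ N → i < N → ∀ nx ny : Ω → ℕ,
      (∀ ω, KnnCounts gx gy g k ((Finset.range N).erase i) (Z i ω)
        (restrictSample Z ((Finset.range N).erase i) ω) (nx ω) (ny ω)) → ∀ t : ℝ, 0 ≤ t →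
      P.real {ω | t < |logCounts N (nx ω) (ny ω)|} ≤ q t := by
  obtain ⟨A, hA, h⟩ := H.tail_bound (P := P) hk
  have hprob := H.dens.isProbabilityMeasure_law
  have hfm := H.dens.measurable
  refine ⟨_, integrableOn_tail (μ := law f) (a := fun z => A * (1 + 1 / f z) ^ (dx + dy + 2))
    (by fun_prop) (fun z => ?_) ?_ (tailRate_pos (dy := dy) H.dx_pos), h⟩
  · have := H.dens.nonneg z
    positivity
  · have h1 : Integrable (fun z => |Real.log (f z)|) (law f) := H.dens.integrable_law.2 hent
    set m : ℝ := ((dx + dy + 2 : ℕ) : ℝ)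
    have hC := H.cond.pos
    refine ((h1.const_mul m).add (integrable_const
      (Real.log (1 + A) + m * Real.log (1 + C * C)))).mono'
      (by fun_prop : Measurable _).aestronglyMeasurable ?_
    filter_upwards [H.dens.ae_law_pos, H.ae_le_sq] with z hz hzC
    have hF : 0 < 1 / f z := by positivity
    have hone : 1 ≤ (1 + 1 / f z) ^ (dx + dy + 2) := one_le_pow₀ (by linarith)
    -- Pulling out 1 + A turns the logarithm of the polynomial into a sum, hence into a bound affine
    -- in |log f|, which is integrable under `law f`.
    have h2 : 1 + A * (1 + 1 / f z) ^ (dx + dy + 2) ≤ (1 + A) * (1 + 1 / f z) ^ (dx + dy + 2) := by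
      nlinarith
    have h3 := Real.log_le_log (by positivity) h2
    rw [Real.log_mul (by positivity) (by positivity), Real.log_pow] at h3
    have h4 : Real.log (1 + 1 / f z) ≤ Real.log (1 + C * C) + |Real.log (f z)| := by
      have e : 1 + 1 / f z = (1 + f z) / f z := by field_simp; ring
      rw [e, Real.log_div (by positivity) hz.ne']
      have := Real.log_le_log (by positivity) (by linarith : 1 + f z ≤ 1 + C * C)
      linarith [neg_abs_le (Real.log (f z))]
    rw [Real.norm_of_nonneg (Real.log_nonneg (by
      have : 0 ≤ A * (1 + 1 / f z) ^ (dx + dy + 2) := by positivity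
      linarith))]
    simp only [Pi.add_apply]
    have hm : 0 ≤ m := by positivity
    have h5 := mul_le_mul_of_nonneg_left h4 hm
    linarith

end Setup

end TailBound

/-! ### Passing limits from fixed centres to random ones -/

section Freeze

variable {E Ω : Type*} [MeasurableSpace E] [MeasurableSpace Ω] {P : Measure Ω}
  [IsProbabilityMeasure P] {Z : ℕ → Ω → E} {μ : Measure E}

/-- Probabilities are bounded by 1, so dominated convergence over the independent centre transfers
an almost everywhere limit. -/
lemma IsIID.tendsto_freeze_one (h : IsIID Z μ P) {i : ℕ → ℕ} {S : ℕ → Finset ℕ}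
    (hi : ∀ N, i N ∉ S N) {A : ∀ N, Set (E × (S N → E))} (hA : ∀ N, MeasurableSet (A N)) {L : ℝ}
    (hL : ∀ᵐ z ∂μ, Tendsto (fun N => P.real {ω | (z, restrictSample Z (S N) ω) ∈ A N}) atTop
      (𝓝 L)) :
    Tendsto (fun N => P.real {ω | (Z (i N) ω, restrictSample Z (S N) ω) ∈ A N}) atTop (𝓝 L) := by
  have hμ := h.isProbabilityMeasure
  simp_rw [fun N => h.freeze_one (hi N) (hA N)]
  rw [show L = ∫ _z, L ∂μ by simp]
  refine tendsto_integral_of_dominated_convergence (fun _ => 1) (fun N => ?_) (integrable_const _)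
    (fun N => ae_of_all _ fun z => ?_) hL
  · exact (measurable_measureReal_frozen (h.measurable_restrictSample _)
      (hA N)).aestronglyMeasurable
  · rw [Real.norm_of_nonneg measureReal_nonneg]
    exact measureReal_le_one

lemma IsIID.tendsto_freeze_two (h : IsIID Z μ P) {i j : ℕ → ℕ} {S : ℕ → Finset ℕ}
    (hij : ∀ᶠ N in atTop, i N ≠ j N) (hi : ∀ N, i N ∉ S N) (hj : ∀ N, j N ∉ S N)
    {A : ∀ N, Set ((E × E) × (S N → E))} (hA : ∀ N, MeasurableSet (A N)) {L : ℝ}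
    (hL : ∀ᵐ z ∂(μ.prod μ), Tendsto (fun N => P.real {ω | (z, restrictSample Z (S N) ω) ∈ A N})
      atTop (𝓝 L)) :
    Tendsto (fun N => P.real {ω | ((Z (i N) ω, Z (j N) ω), restrictSample Z (S N) ω) ∈ A N}) atTop
      (𝓝 L) := by
  have hμ := h.isProbabilityMeasure
  have key : Tendsto (fun N => ∫ z, P.real {ω | (z, restrictSample Z (S N) ω) ∈ A N} ∂(μ.prod μ))
      atTop (𝓝 L) := by
    rw [show L = ∫ _z, L ∂(μ.prod μ) by simp]
    refine tendsto_integral_of_dominated_convergence (fun _ => 1) (fun N => ?_)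
      (integrable_const _) (fun N => ae_of_all _ fun z => ?_) hL
    · exact (measurable_measureReal_frozen (h.measurable_restrictSample _)
        (hA N)).aestronglyMeasurable
    · rw [Real.norm_of_nonneg measureReal_nonneg]
      exact measureReal_le_one
  refine key.congr' ?_
  filter_upwards [hij] with N hN
  rw [h.freeze_two hN (hi N) (hj N) (hA N)]

open scoped Classical in
lemma cnt_insert (Z : ℕ → Ω → E) {S : Finset ℕ} {j : ℕ} (hj : j ∉ S) (B : Set E) (ω : Ω) :
    cnt (insert j S) B (restrictSample Z (insert j S) ω) =
      cnt S B (restrictSample Z S ω) + if Z j ω ∈ B then 1 else 0 := by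
  rw [cnt_restrictSample, cnt_restrictSample, Finset.filter_insert]
  split_ifs with h
  · rw [Finset.card_insert_of_notMem]
    intro h'
    exact hj (Finset.mem_filter.1 h').1
  · rfl

end Freeze

/-! ### Limits at a fixed Lebesgue point -/

section Limits

variable {dx dy : ℕ} {f : (Fin dx → ℝ) × (Fin dy → ℝ) → ℝ} {C K : ℝ}
  {gx : (Fin dx → ℝ) → ℝ} {gy : (Fin dy → ℝ) → ℝ} {g : (Fin dx → ℝ) × (Fin dy → ℝ) → ℝ}
  {cx cy c : ℝ}

/-- `z` is a Lebesgue point of the density and its marginals. -/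
structure IsGoodPoint (f : (Fin dx → ℝ) × (Fin dy → ℝ) → ℝ) (gx : (Fin dx → ℝ) → ℝ)
    (gy : (Fin dy → ℝ) → ℝ) (g : (Fin dx → ℝ) × (Fin dy → ℝ) → ℝ) (cx cy c : ℝ)
    (z : (Fin dx → ℝ) × (Fin dy → ℝ)) : Prop where
  pos : 0 < f z
  x_pos : 0 < marginalX f z.1
  y_pos : 0 < marginalY f z.2
  tendsto : ∀ r : ℕ → ℝ, (∀ᶠ N in atTop, 0 < r N) → Tendsto r atTop (𝓝 0) →
    Tendsto (fun N => (law f).real (gball g z (r N)) / (c * r N ^ (dx + dy))) atTop (𝓝 (f z))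
  tendsto_x : ∀ r : ℕ → ℝ, (∀ᶠ N in atTop, 0 < r N) → Tendsto r atTop (𝓝 0) →
    Tendsto (fun N => (law f).real (xball gx z (r N)) / (cx * r N ^ dx)) atTop
      (𝓝 (marginalX f z.1))
  tendsto_y : ∀ r : ℕ → ℝ, (∀ᶠ N in atTop, 0 < r N) → Tendsto r atTop (𝓝 0) →
    Tendsto (fun N => (law f).real (yball gy z (r N)) / (cy * r N ^ dy)) atTop
      (𝓝 (marginalY f z.2))

namespace Setup

lemma ae_good_x (H : Setup f C K gx gy g cx cy c) :
    ∀ᵐ z : (Fin dx → ℝ) × (Fin dy → ℝ), ∀ r : ℕ → ℝ, (∀ᶠ N in atTop, 0 < r N) →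
      Tendsto r atTop (𝓝 0) → Tendsto (fun N => (law f).real (xball gx z (r N)) /
        (cx * r N ^ dx)) atTop (𝓝 (marginalX f z.1)) := by
  have h1 := H.gauge_x.ae_tendsto_integral_div (by simp) H.dens.integrable_marginalX
  have h2 := (Measure.quasiMeasurePreserving_fst (μ := (volume : Measure (Fin dx → ℝ)))
    (ν := (volume : Measure (Fin dy → ℝ)))).ae h1
  filter_upwards [h2] with z hz r hr0 hr
  refine (hz r hr0 hr).congr fun N => ?_
  rw [← H.dens.law_real_fst (H.gauge_x.measurableSet_gball _ _)]
  rfl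

/-- Under the law, f > 0 almost surely, and f ≤ C f_X, f ≤ C f_Y then force both marginals to be
positive; the limits are Lebesgue differentiation. -/
lemma ae_good (H : Setup f C K gx gy g cx cy c) :
    ∀ᵐ z ∂(law f), IsGoodPoint f gx gy g cx cy c z := by
  have h1 := H.gauge.ae_tendsto_integral_div (by simp) H.dens.integrable
  have h2 : ∀ᵐ z : (Fin dx → ℝ) × (Fin dy → ℝ), ∀ r : ℕ → ℝ, (∀ᶠ N in atTop, 0 < r N) →
      Tendsto r atTop (𝓝 0) → Tendsto (fun N => (law (f ∘ Prod.swap)).real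
        (xball gy z.swap (r N)) / (cy * r N ^ dy)) atTop
        (𝓝 (marginalX (f ∘ Prod.swap) z.swap.1)) := ae_swap H.swap.ae_good_x
  filter_upwards [IsDensity.ae_law_of_ae h1, IsDensity.ae_law_of_ae H.ae_good_x,
    IsDensity.ae_law_of_ae h2, H.dens.ae_law_pos, IsDensity.ae_law_of_ae H.cond.le_X,
    IsDensity.ae_law_of_ae H.cond.le_Y] with z a1 a2 a3 a4 a5 a6
  have hC := H.cond.pos
  refine ⟨a4, pos_of_mul_pos_right (a4.trans_le a5) hC.le,
    pos_of_mul_pos_right (a4.trans_le a6) hC.le, fun r hr0 hr => ?_, a2, fun r hr0 hr => ?_⟩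
  · refine (a1 r hr0 hr).congr fun N => ?_
    rw [H.dens.law_real (H.gauge.measurableSet_gball _ _)]
  · refine (a3 r hr0 hr).congr fun N => ?_
    rw [H.law_yball_eq]

end Setup

lemma tendsto_rad (hdx : 1 ≤ dx) {c : ℝ} (hc : 0 < c) (s : ℝ) {u : ℝ} (hu : 0 < u) :
    Tendsto (fun N => rad dx dy c N s u) atTop (𝓝 0) := by
  unfold rad
  have h1 : Tendsto (fun N : ℕ => Real.exp s / (N * c * u)) atTop (𝓝 0) := by
    refine Tendsto.div_atTop tendsto_const_nhds ?_
    exact (tendsto_natCast_atTop_atTop.atTop_mul_const hc).atTop_mul_const hu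
  have hp : (0 : ℝ) < (((dx + dy : ℕ) : ℝ)⁻¹) := by
    have : (0 : ℝ) < ((dx + dy : ℕ) : ℝ) := by exact_mod_cast (by omega : 0 < dx + dy)
    positivity
  have h2 := h1.rpow_const (p := (((dx + dy : ℕ) : ℝ)⁻¹)) (Or.inr hp.le)
  rwa [Real.zero_rpow hp.ne'] at h2

lemma eventually_rad_pos {c : ℝ} (hc : 0 < c) (s : ℝ) {u : ℝ} (hu : 0 < u) :
    ∀ᶠ N in atTop, 0 < rad dx dy c N s u := by
  filter_upwards [eventually_ge_atTop 1] with N hN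
  exact rad_pos dx dy hc hN s hu

/-- The mean number of points in a marginal ball diverges. -/
lemma tendsto_mul_rad_pow (hdx : 1 ≤ dx) {e e' : ℕ} (he : e + e' = dx + dy) (he' : 1 ≤ e')
    {c : ℝ} (hc : 0 < c) (s : ℝ) {u : ℝ} (hu : 0 < u) :
    Tendsto (fun N : ℕ => (N : ℝ) * rad dx dy c N s u ^ e) atTop atTop := by
  have h0 := tendsto_rad (dy := dy) hdx hc s hu
  have h1 := eventually_rad_pos (dx := dx) (dy := dy) hc s hu
  -- By the level equation N r^e = (e^s / (c u)) r^(-e'), which diverges because r → 0 and e' ≥ 1.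
  have h2 : Tendsto (fun N => rad dx dy c N s u ^ e') atTop (𝓝[>] 0) := by
    rw [tendsto_nhdsWithin_iff]
    refine ⟨?_, h1.mono fun N hN => pow_pos hN e'⟩
    have := h0.pow e'
    rwa [zero_pow (by omega)] at this
  have h3 := h2.inv_tendsto_nhdsGT_zero.const_mul_atTop (by positivity : 0 < Real.exp s / (c * u))
  refine h3.congr' ?_
  filter_upwards [h1, eventually_ge_atTop 1] with N hN hN1
  have hN0 : (0 : ℝ) < N := by exact_mod_cast hN1
  rw [← rad_pow hdx hc hN1 s hu (dy := dy), Pi.inv_apply, ← he, pow_add]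
  field_simp

lemma tendsto_card_div {S : ℕ → Finset ℕ} {a : ℕ} (hS : ∀ᶠ N in atTop, (S N).card = N - a) :
    Tendsto (fun N => ((S N).card : ℝ) / N) atTop (𝓝 1) := by
  have h1 : Tendsto (fun N : ℕ => 1 - (a : ℝ) / N) atTop (𝓝 1) := by
    simpa using (tendsto_const_div_atTop_nhds_zero_nat (a : ℝ)).const_sub 1
  refine h1.congr' ?_
  filter_upwards [hS, eventually_ge_atTop (a + 1)] with N hN hNa
  have : (0 : ℝ) < N := by exact_mod_cast (by omega : 0 < N)
  rw [hN, Nat.cast_sub (by omega)]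
  field_simp

/-- The centring of the logarithm of the neighbour counts. -/
def logCentre (f : (Fin dx → ℝ) × (Fin dy → ℝ) → ℝ) (cx cy c : ℝ)
    (z : (Fin dx → ℝ) × (Fin dy → ℝ)) : ℝ := logRatio f z + Real.log (cx * cy / c)

namespace Setup

variable {Ω : Type*} [MeasurableSpace Ω] {P : Measure Ω} [IsProbabilityMeasure P]
  {Z : ℕ → Ω → (Fin dx → ℝ) × (Fin dy → ℝ)} {z : (Fin dx → ℝ) × (Fin dy → ℝ)}

lemma measurable_logCentre (H : Setup f C K gx gy g cx cy c) :
    Measurable (logCentre f cx cy c) := by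
  have h1 := H.dens.measurable
  have h2 := H.dens.measurable_marginalX
  have h3 : Measurable (marginalY f) := H.dens.swap.measurable_marginalX
  unfold logCentre logRatio
  fun_prop

lemma exp_logCentre (H : Setup f C K gx gy g cx cy c) (hz : IsGoodPoint f gx gy g cx cy c z) :
    Real.exp (logCentre f cx cy c z) = marginalX f z.1 * marginalY f z.2 / f z * (cx * cy / c) := by
  have h1 := H.gauge_x.pos
  have h2 := H.gauge_y.pos
  have h3 := H.gauge.pos
  rw [logCentre, logRatio, Real.exp_add, Real.exp_sub, Real.exp_add, Real.exp_log hz.x_pos,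
    Real.exp_log hz.y_pos, Real.exp_log hz.pos, Real.exp_log (by positivity)]

/-- To first order the mass is f(z) c r^d, and the level equation turns N times this into e^s. -/
lemma tendsto_mul_law_gball (H : Setup f C K gx gy g cx cy c)
    (hz : IsGoodPoint f gx gy g cx cy c z) (s : ℝ) :
    Tendsto (fun N : ℕ => N * (law f).real (gball g z (rad dx dy c N s (f z)))) atTop
      (𝓝 (Real.exp s)) := by
  have hc := H.gauge.pos
  have h1 := hz.tendsto _ (eventually_rad_pos (dx := dx) (dy := dy) hc s hz.pos)
    (tendsto_rad H.dx_pos hc s hz.pos)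
  have h2 := h1.mul_const (Real.exp s / f z)
  rw [mul_div_cancel₀ _ hz.pos.ne'] at h2
  refine h2.congr' ?_
  filter_upwards [eventually_rad_pos (dx := dx) (dy := dy) hc s hz.pos, eventually_ge_atTop 1]
    with N hN hN1
  have hN0 : (0 : ℝ) < N := by exact_mod_cast hN1
  have hf := hz.pos
  rw [← rad_pow H.dx_pos hc hN1 s hz.pos (dy := dy)]
  field_simp

lemma tendsto_card_mul_law_xball (H : Setup f C K gx gy g cx cy c)
    (hz : IsGoodPoint f gx gy g cx cy c z) (s : ℝ) {S : ℕ → Finset ℕ} {a : ℕ}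
    (hS : ∀ᶠ N in atTop, (S N).card = N - a) :
    Tendsto (fun N : ℕ => (S N).card * (law f).real (xball gx z (rad dx dy c N s (f z))) /
      (N * marginalX f z.1 * cx * rad dx dy c N s (f z) ^ dx)) atTop (𝓝 1) := by
  have hc := H.gauge.pos
  have hcx := H.gauge_x.pos
  have hX := hz.x_pos
  have h1 := hz.tendsto_x _ (eventually_rad_pos (dx := dx) (dy := dy) hc s hz.pos)
    (tendsto_rad H.dx_pos hc s hz.pos)
  have h2 := ((tendsto_card_div hS).mul h1).mul_const (1 / marginalX f z.1)
  rw [one_mul, mul_one_div_cancel hX.ne'] at h2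
  refine h2.congr fun N => ?_
  simp only [div_eq_mul_inv, mul_inv]
  ring

lemma tendsto_card_mul_law_yball (H : Setup f C K gx gy g cx cy c)
    (hz : IsGoodPoint f gx gy g cx cy c z) (s : ℝ) {S : ℕ → Finset ℕ} {a : ℕ}
    (hS : ∀ᶠ N in atTop, (S N).card = N - a) :
    Tendsto (fun N : ℕ => (S N).card * (law f).real (yball gy z (rad dx dy c N s (f z))) /
      (N * marginalY f z.2 * cy * rad dx dy c N s (f z) ^ dy)) atTop (𝓝 1) := by
  have hc := H.gauge.pos
  have hX := hz.y_pos
  have h1 := hz.tendsto_y _ (eventually_rad_pos (dx := dx) (dy := dy) hc s hz.pos)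
    (tendsto_rad H.dx_pos hc s hz.pos)
  have h2 := ((tendsto_card_div hS).mul h1).mul_const (1 / marginalY f z.2)
  rw [one_mul, mul_one_div_cancel hX.ne'] at h2
  refine h2.congr fun N => ?_
  simp only [div_eq_mul_inv, mul_inv]
  ring

lemma tendsto_mean_x (H : Setup f C K gx gy g cx cy c)
    (hz : IsGoodPoint f gx gy g cx cy c z) (s : ℝ) :
    Tendsto (fun N : ℕ => N * marginalX f z.1 * cx * rad dx dy c N s (f z) ^ dx) atTop atTop := by
  have h1 := (tendsto_mul_rad_pow H.dx_pos (rfl : dx + dy = dx + dy) H.dy_pos H.gauge.pos s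
    hz.pos).const_mul_atTop (mul_pos hz.x_pos H.gauge_x.pos)
  refine h1.congr fun N => ?_
  ring

lemma tendsto_mean_y (H : Setup f C K gx gy g cx cy c)
    (hz : IsGoodPoint f gx gy g cx cy c z) (s : ℝ) :
    Tendsto (fun N : ℕ => N * marginalY f z.2 * cy * rad dx dy c N s (f z) ^ dy) atTop atTop := by
  have h1 := (tendsto_mul_rad_pow H.dx_pos (add_comm dy dx) H.dx_pos H.gauge.pos s
    hz.pos).const_mul_atTop (mul_pos hz.y_pos H.gauge_y.pos)
  refine h1.congr fun N => ?_
  ring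

/-- Since dx + dy = d, the radius enters the product only through r^d, which the level equation
eliminates; what remains is the density ratio whose mean logarithm is -I. -/
lemma mean_mul_mean (H : Setup f C K gx gy g cx cy c) (hz : IsGoodPoint f gx gy g cx cy c z)
    (s : ℝ) {N : ℕ} (hN : 1 ≤ N) :
    (N * marginalX f z.1 * cx * rad dx dy c N s (f z) ^ dx) *
      (N * marginalY f z.2 * cy * rad dx dy c N s (f z) ^ dy) =
      N * Real.exp (logCentre f cx cy c z + s) := by
  have hc := H.gauge.pos
  have hf := hz.pos
  have hN0 : (0 : ℝ) < N := by exact_mod_cast hN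
  rw [Real.exp_add, H.exp_logCentre hz, ← rad_pow H.dx_pos hc hN s hz.pos (dy := dy), pow_add]
  field_simp

/-- If both counts stay below e^(δ/2) times their means, the product stays below e^δ times the
product of the means. Each of the two exceptional events vanishes by concentration. -/
lemma tendsto_frozen_ge (H : Setup f C K gx gy g cx cy c) (hZ : IsIID Z (law f) P)
    (hz : IsGoodPoint f gx gy g cx cy c z) (s : ℝ) {δ : ℝ} (hδ : 0 < δ) {S : ℕ → Finset ℕ} {a : ℕ}
    (hS : ∀ᶠ N in atTop, (S N).card = N - a) :
    Tendsto (fun N : ℕ => P.real {ω | N * Real.exp (logCentre f cx cy c z + s + δ) ≤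
      cnt (S N) (xball gx z (rad dx dy c N s (f z))) (restrictSample Z (S N) ω) *
      cnt (S N) (yball gy z (rad dx dy c N s (f z))) (restrictSample Z (S N) ω)}) atTop (𝓝 0) := by
  have ha : 1 < Real.exp (δ / 2) := Real.one_lt_exp_iff.2 (by linarith)
  have hx := hZ.tendsto_cnt_ge (fun N => H.measurableSet_xball z _) (H.tendsto_mean_x hz s)
    (H.tendsto_card_mul_law_xball hz s hS) ha
  have hy := hZ.tendsto_cnt_ge (fun N => H.measurableSet_yball z _) (H.tendsto_mean_y hz s)
    (H.tendsto_card_mul_law_yball hz s hS) ha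
  have hxy := hx.add hy
  rw [add_zero] at hxy
  refine squeeze_zero' (Eventually.of_forall fun N => measureReal_nonneg) ?_ hxy
  filter_upwards [eventually_ge_atTop 1, (H.tendsto_mean_x hz s).eventually_gt_atTop 0] with N hN hm
  refine (measureReal_mono ?_).trans (measureReal_union_le _ _)
  intro ω hω
  by_contra hn
  simp only [Set.mem_union, Set.mem_ofPred_eq, not_or, not_le] at hn hω
  have h1 := mul_lt_mul'' hn.1 hn.2 (by positivity) (by positivity)
  have h2 := H.mean_mul_mean hz s hN
  have h3 : Real.exp (δ / 2) * (N * marginalX f z.1 * cx * rad dx dy c N s (f z) ^ dx) *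
      (Real.exp (δ / 2) * (N * marginalY f z.2 * cy * rad dx dy c N s (f z) ^ dy)) =
      N * Real.exp (logCentre f cx cy c z + s + δ) := by
    rw [mul_mul_mul_comm, h2, ← Real.exp_add, Real.exp_add _ δ, show δ / 2 + δ / 2 = δ by ring]
    ring
  rw [h3] at h1
  linarith

lemma tendsto_frozen_le (H : Setup f C K gx gy g cx cy c) (hZ : IsIID Z (law f) P)
    (hz : IsGoodPoint f gx gy g cx cy c z) (s : ℝ) {δ : ℝ} (hδ : 0 < δ) {S : ℕ → Finset ℕ} {a : ℕ}
    (hS : ∀ᶠ N in atTop, (S N).card = N - a) :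
    Tendsto (fun N : ℕ => P.real {ω |
      (cnt (S N) (xball gx z (rad dx dy c N s (f z))) (restrictSample Z (S N) ω) *
      cnt (S N) (yball gy z (rad dx dy c N s (f z))) (restrictSample Z (S N) ω) : ℝ) ≤
      N * Real.exp (logCentre f cx cy c z + s - δ)}) atTop (𝓝 0) := by
  have ha : Real.exp (-(δ / 2)) < 1 := by
    rw [← Real.exp_zero]
    exact Real.exp_lt_exp.2 (by linarith)
  have hx := hZ.tendsto_cnt_le (fun N => H.measurableSet_xball z _) (H.tendsto_mean_x hz s)
    (H.tendsto_card_mul_law_xball hz s hS) ha (Real.exp_pos _)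
  have hy := hZ.tendsto_cnt_le (fun N => H.measurableSet_yball z _) (H.tendsto_mean_y hz s)
    (H.tendsto_card_mul_law_yball hz s hS) ha (Real.exp_pos _)
  have hxy := hx.add hy
  rw [add_zero] at hxy
  refine squeeze_zero' (Eventually.of_forall fun N => measureReal_nonneg) ?_ hxy
  filter_upwards [eventually_ge_atTop 1, (H.tendsto_mean_x hz s).eventually_gt_atTop 0,
    (H.tendsto_mean_y hz s).eventually_gt_atTop 0] with N hN hm hm'
  refine (measureReal_mono ?_).trans (measureReal_union_le _ _)
  intro ω hω
  by_contra hn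
  simp only [Set.mem_union, Set.mem_ofPred_eq, not_or, not_le] at hn hω
  have h1 := mul_lt_mul'' hn.1 hn.2 (by positivity) (by positivity)
  have h2 := H.mean_mul_mean hz s hN
  have h3 : Real.exp (-(δ / 2)) * (N * marginalX f z.1 * cx * rad dx dy c N s (f z) ^ dx) *
      (Real.exp (-(δ / 2)) * (N * marginalY f z.2 * cy * rad dx dy c N s (f z) ^ dy)) =
      N * Real.exp (logCentre f cx cy c z + s - δ) := by
    rw [mul_mul_mul_comm, h2, ← Real.exp_add, sub_eq_add_neg, Real.exp_add _ (-δ),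
      show -(δ / 2) + -(δ / 2) = -δ by ring]
    ring
  rw [h3] at h1
  linarith

/-- The diverging mean eventually exceeds 2m, so a count of at most m is a count of at most half the
mean. This serves the comparison of ψ(n+1) with log n. -/
lemma tendsto_frozen_x_le (H : Setup f C K gx gy g cx cy c) (hZ : IsIID Z (law f) P)
    (hz : IsGoodPoint f gx gy g cx cy c z) (s : ℝ) (m : ℝ) {S : ℕ → Finset ℕ} {a : ℕ}
    (hS : ∀ᶠ N in atTop, (S N).card = N - a) :
    Tendsto (fun N : ℕ => P.real {ω |
      (cnt (S N) (xball gx z (rad dx dy c N s (f z))) (restrictSample Z (S N) ω) : ℝ) ≤ m})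
      atTop (𝓝 0) := by
  have hx := hZ.tendsto_cnt_le (fun N => H.measurableSet_xball z _) (H.tendsto_mean_x hz s)
    (H.tendsto_card_mul_law_xball hz s hS) (a := 1 / 2) (by norm_num) (by norm_num)
  refine squeeze_zero' (Eventually.of_forall fun N => measureReal_nonneg) ?_ hx
  filter_upwards [(H.tendsto_mean_x hz s).eventually_ge_atTop (2 * m)] with N hN
  refine measureReal_mono fun ω hω => ?_
  simp only [Set.mem_ofPred_eq] at hω ⊢
  linarith

lemma tendsto_frozen_y_le (H : Setup f C K gx gy g cx cy c) (hZ : IsIID Z (law f) P)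
    (hz : IsGoodPoint f gx gy g cx cy c z) (s : ℝ) (m : ℝ) {S : ℕ → Finset ℕ} {a : ℕ}
    (hS : ∀ᶠ N in atTop, (S N).card = N - a) :
    Tendsto (fun N : ℕ => P.real {ω |
      (cnt (S N) (yball gy z (rad dx dy c N s (f z))) (restrictSample Z (S N) ω) : ℝ) ≤ m})
      atTop (𝓝 0) := by
  have hx := hZ.tendsto_cnt_le (fun N => H.measurableSet_yball z _) (H.tendsto_mean_y hz s)
    (H.tendsto_card_mul_law_yball hz s hS) (a := 1 / 2) (by norm_num) (by norm_num)
  refine squeeze_zero' (Eventually.of_forall fun N => measureReal_nonneg) ?_ hx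
  filter_upwards [(H.tendsto_mean_y hz s).eventually_ge_atTop (2 * m)] with N hN
  refine measureReal_mono fun ω hω => ?_
  simp only [Set.mem_ofPred_eq] at hω ⊢
  linarith

end Setup

end Limits

/-! ### Limits at random centres and asymptotic independence of pairs -/

section Integrated

/-- The indices of the sample points other than the `i`-th among the first `N`. -/
def others (N i : ℕ) : Finset ℕ := (Finset.range N).erase i

lemma notMem_others (N i : ℕ) : i ∉ others N i := Finset.notMem_erase _ _

lemma card_others {N i : ℕ} (hi : i < N) : (others N i).card = N - 1 := by
  rw [others, Finset.card_erase_of_mem (Finset.mem_range.2 hi), Finset.card_range]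

variable {dx dy : ℕ} {f : (Fin dx → ℝ) × (Fin dy → ℝ) → ℝ} {C K : ℝ}
  {gx : (Fin dx → ℝ) → ℝ} {gy : (Fin dy → ℝ) → ℝ} {g : (Fin dx → ℝ) × (Fin dy → ℝ) → ℝ}
  {cx cy c : ℝ} {Ω : Type*} [MeasurableSpace Ω] {P : Measure Ω} [IsProbabilityMeasure P]
  {Z : ℕ → Ω → (Fin dx → ℝ) × (Fin dy → ℝ)}

/-- The ball about the `i`-th sample point whose radius is at level `s`. -/
def levelBall (f g : (Fin dx → ℝ) × (Fin dy → ℝ) → ℝ) (c : ℝ) (N : ℕ) (s : ℝ)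
    (z : (Fin dx → ℝ) × (Fin dy → ℝ)) : Set ((Fin dx → ℝ) × (Fin dy → ℝ)) :=
  gball g z (rad dx dy c N s (f z))

/-- The cylinder over the ball in the first coordinate whose radius is at level `s`. -/
def levelX (f : (Fin dx → ℝ) × (Fin dy → ℝ) → ℝ) (gx : (Fin dx → ℝ) → ℝ) (c : ℝ) (N : ℕ) (s : ℝ)
    (z : (Fin dx → ℝ) × (Fin dy → ℝ)) : Set ((Fin dx → ℝ) × (Fin dy → ℝ)) :=
  xball gx z (rad dx dy c N s (f z))

/-- The cylinder over the ball in the second coordinate whose radius is at level `s`. -/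
def levelY (f : (Fin dx → ℝ) × (Fin dy → ℝ) → ℝ) (gy : (Fin dy → ℝ) → ℝ) (c : ℝ) (N : ℕ) (s : ℝ)
    (z : (Fin dx → ℝ) × (Fin dy → ℝ)) : Set ((Fin dx → ℝ) × (Fin dy → ℝ)) :=
  yball gy z (rad dx dy c N s (f z))

/-- The number of the other sample points in the set attached to the `i`-th one. -/
def cntAt {E : Type*} (Z : ℕ → Ω → E) (N i : ℕ) (B : E → Set E) (ω : Ω) : ℕ :=
  cnt (others N i) (B (Z i ω)) (restrictSample Z (others N i) ω)

lemma IsIID.measurable_cntAt {E : Type*} [MeasurableSpace E] {Z : ℕ → Ω → E} {μ : Measure E}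
    (hZ : IsIID Z μ P) (N i : ℕ) {B : E → Set E} (hB : MeasurableSet {q : E × E | q.2 ∈ B q.1}) :
    Measurable (cntAt Z N i B) :=
  (measurable_cnt_nat (others N i) hB).comp
    ((hZ.measurable i).prodMk (hZ.measurable_restrictSample (others N i)))

open scoped Classical in
-- Each centre is itself a sample point for the other one; the indicator terms account for it once
-- both centres are removed from `S`.
lemma measurableSet_cnt_pair {E : Type*} [MeasurableSpace E] (S : Finset ℕ) {B : E → Set E}
    (hB : MeasurableSet {q : E × E | q.2 ∈ B q.1}) (k : ℕ) :
    MeasurableSet {q : (E × E) × (S → E) |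
      cnt S (B q.1.1) q.2 + (if q.1.2 ∈ B q.1.1 then 1 else 0) < k ∧
      cnt S (B q.1.2) q.2 + (if q.1.1 ∈ B q.1.2 then 1 else 0) < k} := by
  have hsw : MeasurableSet {q : E × E | q.1 ∈ B q.2} := measurable_swap hB
  have m1 : Measurable fun q : (E × E) × (S → E) => cnt S (B q.1.1) q.2 :=
    measurable_cnt_nat (C := E × E) S (B := fun p => B p.1)
      (((measurable_fst.comp measurable_fst).prodMk measurable_snd) hB)
  have m2 : Measurable fun q : (E × E) × (S → E) => cnt S (B q.1.2) q.2 :=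
    measurable_cnt_nat (C := E × E) S (B := fun p => B p.2)
      (((measurable_snd.comp measurable_fst).prodMk measurable_snd) hB)
  have m3 : Measurable fun q : (E × E) × (S → E) => if q.1.2 ∈ B q.1.1 then 1 else 0 :=
    Measurable.ite (measurable_fst hB) measurable_const measurable_const
  have m4 : Measurable fun q : (E × E) × (S → E) => if q.1.1 ∈ B q.1.2 then 1 else 0 :=
    Measurable.ite (measurable_fst hsw) measurable_const measurable_const
  exact (measurableSet_lt (m1.add m3) measurable_const).inter
    (measurableSet_lt (m2.add m4) measurable_const)

namespace Setup

/-- The index may vary with N; limits along arbitrary index sequences later give uniformity over the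
indices. -/
lemma tendsto_far (H : Setup f C K gx gy g cx cy c) (hZ : IsIID Z (law f) P) {k : ℕ} (hk : 1 ≤ k)
    (s : ℝ) {i : ℕ → ℕ} (hi : ∀ᶠ N in atTop, i N < N) :
    Tendsto (fun N => P.real {ω | cntAt Z N (i N) (levelBall f g c N s) ω < k}) atTop
      (𝓝 (poissonLt k (Real.exp s))) := by
  refine hZ.tendsto_freeze_one (S := fun N => others N (i N)) (fun N => notMem_others N (i N))
    (A := fun N => {q | cnt (others N (i N)) (levelBall f g c N s q.1) q.2 < k})
    (fun N => ?_) ?_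
  · exact measurableSet_lt (measurable_cnt_nat _ (B := levelBall f g c N s)
      (H.measurableSet_gball_rad N s)) measurable_const
  · filter_upwards [H.ae_good] with z hz
    exact hZ.tendsto_cnt_lt hk 1 (hi.mono fun N hN => card_others hN)
      (fun N => H.gauge.measurableSet_gball z _) (H.tendsto_mul_law_gball hz s)

lemma tendsto_ge (H : Setup f C K gx gy g cx cy c) (hZ : IsIID Z (law f) P) (s : ℝ) {δ : ℝ}
    (hδ : 0 < δ) {i : ℕ → ℕ} (hi : ∀ᶠ N in atTop, i N < N) :
    Tendsto (fun N : ℕ => P.real {ω | N * Real.exp (logCentre f cx cy c (Z (i N) ω) + s + δ) ≤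
      cntAt Z N (i N) (levelX f gx c N s) ω * cntAt Z N (i N) (levelY f gy c N s) ω}) atTop
      (𝓝 0) := by
  refine hZ.tendsto_freeze_one (S := fun N => others N (i N)) (fun N => notMem_others N (i N))
    (A := fun N => {q | N * Real.exp (logCentre f cx cy c q.1 + s + δ) ≤
      cnt (others N (i N)) (levelX f gx c N s q.1) q.2 *
      cnt (others N (i N)) (levelY f gy c N s q.1) q.2})
    (fun N => ?_) ?_
  · have := H.measurable_logCentre
    refine measurableSet_le (by fun_prop) ?_
    exact (measurable_cnt _ (B := levelX f gx c N s) (H.measurableSet_xball_rad N s)).mul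
      (measurable_cnt _ (B := levelY f gy c N s) (H.measurableSet_yball_rad N s))
  · filter_upwards [H.ae_good] with z hz
    exact H.tendsto_frozen_ge hZ hz s hδ (a := 1) (hi.mono fun N hN => card_others hN)

lemma tendsto_le (H : Setup f C K gx gy g cx cy c) (hZ : IsIID Z (law f) P) (s : ℝ) {δ : ℝ}
    (hδ : 0 < δ) {i : ℕ → ℕ} (hi : ∀ᶠ N in atTop, i N < N) :
    Tendsto (fun N : ℕ => P.real {ω |
      (cntAt Z N (i N) (levelX f gx c N s) ω * cntAt Z N (i N) (levelY f gy c N s) ω : ℝ) ≤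
      N * Real.exp (logCentre f cx cy c (Z (i N) ω) + s - δ)}) atTop (𝓝 0) := by
  refine hZ.tendsto_freeze_one (S := fun N => others N (i N)) (fun N => notMem_others N (i N))
    (A := fun N => {q | (cnt (others N (i N)) (levelX f gx c N s q.1) q.2 *
      cnt (others N (i N)) (levelY f gy c N s q.1) q.2 : ℝ) ≤
      N * Real.exp (logCentre f cx cy c q.1 + s - δ)})
    (fun N => ?_) ?_
  · have := H.measurable_logCentre
    refine measurableSet_le ?_ (by fun_prop)
    exact (measurable_cnt _ (B := levelX f gx c N s) (H.measurableSet_xball_rad N s)).mul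
      (measurable_cnt _ (B := levelY f gy c N s) (H.measurableSet_yball_rad N s))
  · filter_upwards [H.ae_good] with z hz
    exact H.tendsto_frozen_le hZ hz s hδ (a := 1) (hi.mono fun N hN => card_others hN)

lemma tendsto_x_le (H : Setup f C K gx gy g cx cy c) (hZ : IsIID Z (law f) P) (s m : ℝ)
    {i : ℕ → ℕ} (hi : ∀ᶠ N in atTop, i N < N) :
    Tendsto (fun N => P.real {ω | (cntAt Z N (i N) (levelX f gx c N s) ω : ℝ) ≤ m}) atTop
      (𝓝 0) := by
  refine hZ.tendsto_freeze_one (S := fun N => others N (i N)) (fun N => notMem_others N (i N))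
    (A := fun N => {q | (cnt (others N (i N)) (levelX f gx c N s q.1) q.2 : ℝ) ≤ m})
    (fun N => ?_) ?_
  · exact measurableSet_le (measurable_cnt _ (B := levelX f gx c N s)
      (H.measurableSet_xball_rad N s)) measurable_const
  · filter_upwards [H.ae_good] with z hz
    exact H.tendsto_frozen_x_le hZ hz s m (a := 1) (hi.mono fun N hN => card_others hN)

lemma tendsto_y_le (H : Setup f C K gx gy g cx cy c) (hZ : IsIID Z (law f) P) (s m : ℝ)
    {i : ℕ → ℕ} (hi : ∀ᶠ N in atTop, i N < N) :
    Tendsto (fun N => P.real {ω | (cntAt Z N (i N) (levelY f gy c N s) ω : ℝ) ≤ m}) atTop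
      (𝓝 0) := by
  refine hZ.tendsto_freeze_one (S := fun N => others N (i N)) (fun N => notMem_others N (i N))
    (A := fun N => {q | (cnt (others N (i N)) (levelY f gy c N s q.1) q.2 : ℝ) ≤ m})
    (fun N => ?_) ?_
  · exact measurableSet_le (measurable_cnt _ (B := levelY f gy c N s)
      (H.measurableSet_yball_rad N s)) measurable_const
  · filter_upwards [H.ae_good] with z hz
    exact H.tendsto_frozen_y_le hZ hz s m (a := 1) (hi.mono fun N hN => card_others hN)

lemma nullSingletonClass_law (H : Setup f C K gx gy g cx cy c) : NullSingletonClass (law f) := by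
  have : Nonempty (Fin dx) := ⟨⟨0, H.dx_pos⟩⟩
  have h1 : NullSingletonClass (volume : Measure ((Fin dx → ℝ) × (Fin dy → ℝ))) := by
    rw [Measure.volume_eq_prod]
    infer_instance
  constructor
  intro z
  exact (withDensity_absolutelyContinuous _ _) (measure_singleton z)

lemma ae_ne (H : Setup f C K gx gy g cx cy c) :
    ∀ᵐ q ∂((law f).prod (law f)), q.1 ≠ q.2 := by
  have h0 := H.nullSingletonClass_law
  have h1 := H.dens.isProbabilityMeasure_law
  have hm : MeasurableSet {q : ((Fin dx → ℝ) × (Fin dy → ℝ)) × ((Fin dx → ℝ) × (Fin dy → ℝ)) |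
      q.1 ≠ q.2} := (measurableSet_eq_fun measurable_fst measurable_snd).compl
  refine (Measure.ae_prod_iff_ae_ae hm).2 (ae_of_all _ fun z => ?_)
  rw [ae_iff]
  convert measure_singleton (μ := law f) z using 2
  ext w
  simp [eq_comm]

open scoped Classical in
-- The law has no atoms, so the two centres are almost surely distinct. As the radii shrink, the
-- balls become disjoint and neither contains the other centre; the joint Poisson limit for the
-- remaining N - 2 points then factorises.
lemma tendsto_far_pair (H : Setup f C K gx gy g cx cy c) (hZ : IsIID Z (law f) P) (k : ℕ)
    (s : ℝ) {i j : ℕ → ℕ} (hi : ∀ᶠ N in atTop, i N < N) (hj : ∀ᶠ N in atTop, j N < N)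
    (hij : ∀ᶠ N in atTop, i N ≠ j N) :
    Tendsto (fun N => P.real {ω | cntAt Z N (i N) (levelBall f g c N s) ω < k ∧
      cntAt Z N (j N) (levelBall f g c N s) ω < k}) atTop
      (𝓝 (poissonLt k (Real.exp s) * poissonLt k (Real.exp s))) := by
  let S : ℕ → Finset ℕ := fun N => ((Finset.range N).erase (i N)).erase (j N)
  have hprob := H.dens.isProbabilityMeasure_law
  have hSi : ∀ N, i N ∉ S N := fun N h => Finset.notMem_erase _ _ (Finset.mem_of_mem_erase h)
  have hSj : ∀ N, j N ∉ S N := fun N => Finset.notMem_erase _ _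
  have hScard : ∀ᶠ N in atTop, (S N).card = N - 2 := by
    filter_upwards [hi, hj, hij] with N h1 h2 h3
    rw [Finset.card_erase_of_mem (Finset.mem_erase.2 ⟨h3.symm, Finset.mem_range.2 h2⟩),
      Finset.card_erase_of_mem (Finset.mem_range.2 h1), Finset.card_range]
    rfl
  let E := (Fin dx → ℝ) × (Fin dy → ℝ)
  let A : ∀ N, Set ((E × E) × (S N → E)) := fun N =>
    {q | cnt (S N) (levelBall f g c N s q.1.1) q.2 +
        (if q.1.2 ∈ levelBall f g c N s q.1.1 then 1 else 0) < k ∧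
      cnt (S N) (levelBall f g c N s q.1.2) q.2 +
        (if q.1.1 ∈ levelBall f g c N s q.1.2 then 1 else 0) < k}
  have hAm : ∀ N, MeasurableSet (A N) :=
    fun N => measurableSet_cnt_pair (S N) (H.measurableSet_gball_rad N s) k
  have key : Tendsto (fun N => P.real {ω | ((Z (i N) ω, Z (j N) ω), restrictSample Z (S N) ω) ∈ A N})
      atTop (𝓝 (poissonLt k (Real.exp s) * poissonLt k (Real.exp s))) := by
    refine hZ.tendsto_freeze_two hij hSi hSj hAm ?_
    filter_upwards [Measure.quasiMeasurePreserving_fst.ae H.ae_good,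
      Measure.quasiMeasurePreserving_snd.ae H.ae_good, H.ae_ne] with z h1 h2 h3
    have hc := H.gauge.pos
    have r1 := tendsto_rad (dy := dy) H.dx_pos hc s h1.pos
    have r2 := tendsto_rad (dy := dy) H.dx_pos hc s h2.pos
    have hdist : 0 < dist z.1 z.2 := dist_pos.2 h3
    have hlt : ∀ᶠ N in atTop, rad dx dy c N s (f z.1) + rad dx dy c N s (f z.2) < dist z.1 z.2 := by
      refine (r1.add r2).eventually_lt_const ?_
      rwa [add_zero]
    have hp1 := eventually_rad_pos (dx := dx) (dy := dy) hc s h1.pos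
    have hp2 := eventually_rad_pos (dx := dx) (dy := dy) hc s h2.pos
    have hdisj : ∀ᶠ N in atTop, Disjoint (levelBall f g c N s z.1) (levelBall f g c N s z.2) := by
      filter_upwards [hlt] with N hN
      exact (Metric.closedBall_disjoint_closedBall hN).mono (H.gauge.gball_subset _ _)
        (H.gauge.gball_subset _ _)
    refine (hZ.tendsto_cnt_lt_pair k 2 hScard (fun N => H.gauge.measurableSet_gball z.1 _)
      (fun N => H.gauge.measurableSet_gball z.2 _) hdisj (H.tendsto_mul_law_gball h1 s)
      (H.tendsto_mul_law_gball h2 s)).congr' ?_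
    filter_upwards [hlt, hp1, hp2] with N hN p1 p2
    have n1 : z.2 ∉ levelBall f g c N s z.1 := fun h => by
      have := H.gauge.gball_subset _ _ h
      rw [Metric.mem_closedBall, dist_comm] at this
      linarith
    have n2 : z.1 ∉ levelBall f g c N s z.2 := fun h => by
      have := H.gauge.gball_subset _ _ h
      rw [Metric.mem_closedBall] at this
      linarith
    congr 1
    ext ω
    change _ ↔ cnt (S N) (levelBall f g c N s z.1) (restrictSample Z (S N) ω) +
        (if z.2 ∈ levelBall f g c N s z.1 then 1 else 0) < k ∧
      cnt (S N) (levelBall f g c N s z.2) (restrictSample Z (S N) ω) +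
        (if z.1 ∈ levelBall f g c N s z.2 then 1 else 0) < k
    rw [if_neg n1, if_neg n2, add_zero, add_zero]
    exact Iff.rfl
  refine key.congr' ?_
  filter_upwards [hi, hj, hij] with N h1 h2 h3
  have e1 : others N (i N) = insert (j N) (S N) :=
    (Finset.insert_erase (Finset.mem_erase.2 ⟨h3.symm, Finset.mem_range.2 h2⟩)).symm
  have e2 : others N (j N) = insert (i N) (S N) := by
    simp only [S]
    rw [Finset.erase_right_comm, Finset.insert_erase]
    · rfl
    · exact Finset.mem_erase.2 ⟨h3, Finset.mem_range.2 h1⟩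
  congr 1
  ext ω
  simp only [Set.mem_ofPred_eq, cntAt]
  rw [e1, e2, cnt_insert Z (hSj N), cnt_insert Z (hSi N)]
  exact Iff.rfl

end Setup

end Integrated

/-! ### Averages controlled along index sequences -/

section Averages

/-- For each N take the index with the largest deviation: convergence along that sequence bounds
every term of the average. -/
lemma tendsto_average_of_sequences {a : ℕ → ℕ → ℝ} {L : ℝ}
    (h : ∀ i : ℕ → ℕ, (∀ᶠ N in atTop, i N < N) → Tendsto (fun N => a N (i N)) atTop (𝓝 L)) :
    Tendsto (fun N : ℕ => 1 / (N : ℝ) * ∑ i ∈ Finset.range N, |a N i - L|) atTop (𝓝 0) := by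
  have hmax : ∀ N : ℕ, ∃ i, 1 ≤ N → i < N ∧ ∀ j < N, |a N j - L| ≤ |a N i - L| := by
    intro N
    by_cases hN : 1 ≤ N
    · obtain ⟨i, hi, hi'⟩ := Finset.exists_max_image (Finset.range N) (fun j => |a N j - L|)
        ⟨0, Finset.mem_range.2 hN⟩
      exact ⟨i, fun _ => ⟨Finset.mem_range.1 hi, fun j hj => hi' j (Finset.mem_range.2 hj)⟩⟩
    · exact ⟨0, fun h => absurd h hN⟩
  choose i hi using hmax
  have h1 := h i ((eventually_ge_atTop 1).mono fun N hN => (hi N hN).1)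
  have h2 : Tendsto (fun N => |a N (i N) - L|) atTop (𝓝 0) := by
    simpa using (h1.sub_const L).abs
  refine squeeze_zero' (Eventually.of_forall fun N => by positivity) ?_ h2
  filter_upwards [eventually_ge_atTop 1] with N hN
  have hN0 : (0 : ℝ) < N := by exact_mod_cast hN
  rw [one_div, inv_mul_le_iff₀ hN0]
  refine (Finset.sum_le_card_nsmul _ _ _ fun j hj => (hi N hN).2 j (Finset.mem_range.1 hj)).trans ?_
  simp

/-- Off the diagonal the worst pair of indices controls every term; the N diagonal terms out of N^2
contribute at most B / N. -/
lemma tendsto_average_pair_of_sequences {a : ℕ → ℕ → ℕ → ℝ} {L B : ℝ}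
    (hB : ∀ N i j, |a N i j - L| ≤ B)
    (h : ∀ i j : ℕ → ℕ, (∀ᶠ N in atTop, i N < N) → (∀ᶠ N in atTop, j N < N) →
      (∀ᶠ N in atTop, i N ≠ j N) → Tendsto (fun N => a N (i N) (j N)) atTop (𝓝 L)) :
    Tendsto (fun N : ℕ => 1 / (N : ℝ) ^ 2 * ∑ i ∈ Finset.range N, ∑ j ∈ Finset.range N,
      |a N i j - L|) atTop (𝓝 0) := by
  have hmax : ∀ N : ℕ, ∃ q : ℕ × ℕ, 2 ≤ N → (q.1 < N ∧ q.2 < N ∧ q.1 ≠ q.2) ∧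
      ∀ i < N, ∀ j < N, i ≠ j → |a N i j - L| ≤ |a N q.1 q.2 - L| := by
    intro N
    by_cases hN : 2 ≤ N
    · obtain ⟨q, hq, hq'⟩ := Finset.exists_max_image (Finset.range N).offDiag
        (fun q => |a N q.1 q.2 - L|) ⟨(0, 1), by
          simp only [Finset.mem_offDiag, Finset.mem_range]; omega⟩
      simp only [Finset.mem_offDiag, Finset.mem_range] at hq hq'
      exact ⟨q, fun _ => ⟨hq, fun i hi j hj hij => hq' (i, j) ⟨hi, hj, hij⟩⟩⟩
    · exact ⟨(0, 0), fun h => absurd h hN⟩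
  choose q hq using hmax
  have h1 := h (fun N => (q N).1) (fun N => (q N).2)
    ((eventually_ge_atTop 2).mono fun N hN => (hq N hN).1.1)
    ((eventually_ge_atTop 2).mono fun N hN => (hq N hN).1.2.1)
    ((eventually_ge_atTop 2).mono fun N hN => (hq N hN).1.2.2)
  have h2 : Tendsto (fun N : ℕ => |a N (q N).1 (q N).2 - L| + B / N) atTop (𝓝 0) := by
    simpa using (h1.sub_const L).abs.add (tendsto_const_div_atTop_nhds_zero_nat B)
  refine squeeze_zero' (Eventually.of_forall fun N => by positivity) ?_ h2
  filter_upwards [eventually_ge_atTop 2] with N hN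
  have hN0 : (0 : ℝ) < N := by exact_mod_cast (by omega : 0 < N)
  set M := |a N (q N).1 (q N).2 - L| with hM
  have hM0 : 0 ≤ M := abs_nonneg _
  have h3 : ∀ i ∈ Finset.range N, ∑ j ∈ Finset.range N, |a N i j - L| ≤ N * M + B := by
    intro i hi
    rw [← Finset.add_sum_erase _ _ hi, add_comm]
    refine add_le_add ?_ (hB N i i)
    calc ∑ j ∈ (Finset.range N).erase i, |a N i j - L| ≤ ∑ j ∈ (Finset.range N).erase i, M := by
          refine Finset.sum_le_sum fun j hj => ?_
          rw [Finset.mem_erase, Finset.mem_range] at hj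
          exact (hq N hN).2 i (Finset.mem_range.1 hi) j hj.2 hj.1.symm
      _ ≤ ∑ j ∈ Finset.range N, M :=
          Finset.sum_le_sum_of_subset_of_nonneg (Finset.erase_subset _ _) fun _ _ _ => hM0
      _ = N * M := by simp
  rw [one_div, inv_mul_le_iff₀ (by positivity)]
  calc _ ≤ ∑ _i ∈ Finset.range N, (N * M + B) := Finset.sum_le_sum h3
    _ = N * (N * M + B) := by
      rw [Finset.sum_const, Finset.card_range, nsmul_eq_mul]
    _ = _ := by field_simp

end Averages

/-! ### The logarithm of a Gamma variable and the digamma function -/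

section LogGamma

/-- The derivatives of the summands telescope, leaving minus the Gamma density. This is the duality
between Poisson counts and Gamma waiting times. -/
lemma hasDerivAt_poissonLt (m : ℕ) (l : ℝ) :
    HasDerivAt (poissonLt (m + 1)) (-(l ^ m / m.factorial * Real.exp (-l))) l := by
  have he : HasDerivAt (fun l : ℝ => Real.exp (-l)) (-Real.exp (-l)) l := by
    simpa using (hasDerivAt_neg l).exp
  induction m with
  | zero =>
    have h : poissonLt (0 + 1) = fun l => Real.exp (-l) := by
      ext l
      simp [poissonLt]
    rw [h]
    simpa using he
  | succ m ih =>
    have h : poissonLt (m + 1 + 1) = fun l => poissonLt (m + 1) l +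
        l ^ (m + 1) / (m + 1).factorial * Real.exp (-l) := by
      ext l
      rw [poissonLt, Finset.sum_range_succ, poissonLt]
    rw [h]
    have h2 := ih.add ((((hasDerivAt_pow (m + 1) l).div_const ((m + 1).factorial : ℝ))).mul he)
    convert! h2 using 1
    rw [Nat.factorial_succ, Nat.add_sub_cancel]
    push_cast
    have : (m.factorial : ℝ) ≠ 0 := by positivity
    field_simp
    ring

lemma tendsto_poissonLt_atTop (k : ℕ) : Tendsto (poissonLt k) atTop (𝓝 0) := by
  have h := tendsto_finsetSum (Finset.range k) fun a _ =>
    (Real.tendsto_pow_mul_exp_neg_atTop_nhds_zero a).div_const (a.factorial : ℝ)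
  simp only [zero_div, Finset.sum_const_zero] at h
  refine h.congr fun l => ?_
  rw [poissonLt]
  exact Finset.sum_congr rfl fun a _ => by ring

/-- The density of the Gamma distribution with integer shape `m + 1`. -/
def erlangDensity (m : ℕ) (t : ℝ) : ℝ := t ^ m / m.factorial * Real.exp (-t)

lemma erlangDensity_nonneg (m : ℕ) {t : ℝ} (ht : 0 ≤ t) : 0 ≤ erlangDensity m t := by
  unfold erlangDensity
  positivity

lemma measurable_erlangDensity (m : ℕ) : Measurable (erlangDensity m) := by
  unfold erlangDensity
  fun_prop

lemma integrableOn_erlangDensity (m : ℕ) {l : ℝ} (hl : 0 ≤ l) :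
    IntegrableOn (erlangDensity m) (Set.Ioi l) :=
  integrableOn_Ioi_deriv_of_nonneg' (g := fun t => -poissonLt (m + 1) t)
    (fun t _ => (hasDerivAt_poissonLt m t).fun_neg.congr_deriv (by simp [erlangDensity]))
    (fun t ht => erlangDensity_nonneg m (hl.trans (le_of_lt ht)))
    (by simpa using (tendsto_poissonLt_atTop (m + 1)).neg)

lemma integral_erlangDensity (m : ℕ) {l : ℝ} (hl : 0 ≤ l) :
    ∫ t in Set.Ioi l, erlangDensity m t = poissonLt (m + 1) l := by
  rw [integral_Ioi_of_hasDerivAt_of_nonneg' (g := fun t => -poissonLt (m + 1) t) (l := 0)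
    (fun t _ => (hasDerivAt_poissonLt m t).fun_neg.congr_deriv (by simp [erlangDensity]))
    (fun t ht => erlangDensity_nonneg m (hl.trans (le_of_lt ht)))
    (by simpa using (tendsto_poissonLt_atTop (m + 1)).neg)]
  ring

/-- Γ is the Mellin transform of e^(-t); differentiating it at m + 1 inserts log t under the
integral, and dividing by Γ(m+1) = m! gives Γ'/Γ. -/
lemma integrableOn_log_mul_erlangDensity (m : ℕ) :
    IntegrableOn (fun t => erlangDensity m t * Real.log t) (Set.Ioi 0) ∧
      ∫ t in Set.Ioi 0, erlangDensity m t * Real.log t = digamma (m + 1) := by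
  set s : ℂ := (m : ℂ) + 1 with hs
  have hre : 0 < s.re := by
    simp only [hs, Complex.add_re, Complex.natCast_re, Complex.one_re]
    positivity
  have hcont : Continuous fun t : ℝ => (Real.exp (-t) : ℂ) :=
    Complex.continuous_ofReal.comp (Real.continuous_exp.comp continuous_neg)
  obtain ⟨h1, h2⟩ := mellin_hasDerivAt_of_isBigO_rpow (E := ℂ) (a := s.re + 1) (b := 0)
    (f := fun t : ℝ => (Real.exp (-t) : ℂ)) (s := s)
    (hcont.continuousOn.locallyIntegrableOn measurableSet_Ioi) (by
      rw [← Asymptotics.isBigO_norm_left]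
      simp_rw [Complex.norm_real, Asymptotics.isBigO_norm_left]
      simpa only [neg_one_mul] using (isLittleO_exp_neg_mul_rpow_atTop zero_lt_one _).isBigO)
    (lt_add_one _) (by
      simp_rw [neg_zero, Real.rpow_zero]
      refine Asymptotics.isBigO_const_of_tendsto (?_ : Tendsto _ _ (𝓝 (1 : ℂ))) one_ne_zero
      rw [(by simp : (1 : ℂ) = Real.exp (-0))]
      exact hcont.continuousWithinAt) hre
  have hev : Complex.Gamma =ᶠ[𝓝 s] mellin fun t : ℝ => (Real.exp (-t) : ℂ) := by
    have ho : IsOpen {s : ℂ | 0 < s.re} := Complex.continuous_re.isOpen_preimage _ isOpen_Ioi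
    filter_upwards [ho.mem_nhds hre] with z hz
    rw [Complex.Gamma_eq_integral hz, Complex.GammaIntegral_eq_mellin]
  have hderiv := (h2.congr_of_eventuallyEq hev).deriv
  have hfact : (m.factorial : ℝ) ≠ 0 := by positivity
  have hpt : ∀ t : ℝ, (t : ℂ) ^ (s - 1) • (Real.log t • (Real.exp (-t) : ℂ)) =
      ((m.factorial * (erlangDensity m t * Real.log t) : ℝ) : ℂ) := by
    intro t
    rw [hs, add_sub_cancel_right, Complex.cpow_natCast, erlangDensity]
    simp only [Complex.real_smul, smul_eq_mul]
    have : (m.factorial : ℂ) ≠ 0 := by exact_mod_cast hfact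
    push_cast
    field_simp
  have hint : IntegrableOn (fun t => m.factorial * (erlangDensity m t * Real.log t))
      (Set.Ioi 0) := by
    unfold MellinConvergent at h1
    simp_rw [hpt] at h1
    exact h1.re
  have hint' : IntegrableOn (fun t => erlangDensity m t * Real.log t) (Set.Ioi 0) := by
    have := hint.const_mul ((m.factorial : ℝ)⁻¹)
    simp only [inv_mul_cancel_left₀ hfact] at this
    exact this
  refine ⟨hint', ?_⟩
  rw [digamma, Complex.digamma_def, logDeriv_apply]
  push_cast
  rw [← hs, hderiv, mellin]
  simp_rw [hpt]
  rw [integral_complex_ofReal, integral_const_mul, hs, Complex.Gamma_nat_eq_factorial]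
  have : ((m.factorial * ∫ t in Set.Ioi 0, erlangDensity m t * Real.log t : ℝ) : ℂ) /
      (m.factorial : ℂ) = ((∫ t in Set.Ioi 0, erlangDensity m t * Real.log t : ℝ) : ℂ) := by
    have : (m.factorial : ℂ) ≠ 0 := by exact_mod_cast hfact
    push_cast
    field_simp
  rw [this, Complex.ofReal_re]

/-- The law of the logarithm of a Gamma variable with integer shape `m + 1`. -/
def logErlang (m : ℕ) : Measure ℝ :=
  ((volume.restrict (Set.Ioi 0)).withDensity fun t => ENNReal.ofReal (erlangDensity m t)).map
    Real.log

lemma erlang_Ioi (m : ℕ) {l : ℝ} (hl : 0 ≤ l) :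
    ((volume.restrict (Set.Ioi 0)).withDensity fun t => ENNReal.ofReal (erlangDensity m t))
      (Set.Ioi l) = ENNReal.ofReal (poissonLt (m + 1) l) := by
  rw [withDensity_apply _ measurableSet_Ioi, Measure.restrict_restrict measurableSet_Ioi,
    Set.inter_eq_left.2 (Set.Ioi_subset_Ioi hl), ← integral_erlangDensity m hl,
    ofReal_integral_eq_lintegral_ofReal (integrableOn_erlangDensity m hl)]
  exact (ae_restrict_mem measurableSet_Ioi).mono
    fun t ht => erlangDensity_nonneg m (hl.trans (le_of_lt ht))

lemma ae_erlang_pos (m : ℕ) : ∀ᵐ t ∂((volume.restrict (Set.Ioi (0 : ℝ))).withDensity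
    fun t => ENNReal.ofReal (erlangDensity m t)), 0 < t :=
  (withDensity_absolutelyContinuous _ _).ae_le (ae_restrict_mem measurableSet_Ioi)

lemma poissonLt_nonneg (k : ℕ) {l : ℝ} (hl : 0 ≤ l) : 0 ≤ poissonLt k l :=
  Finset.sum_nonneg fun a _ => by positivity

instance isProbabilityMeasure_logErlang (m : ℕ) : IsProbabilityMeasure (logErlang m) := by
  have h : IsProbabilityMeasure ((volume.restrict (Set.Ioi (0 : ℝ))).withDensity
      fun t => ENNReal.ofReal (erlangDensity m t)) := by
    constructor
    have h1 := erlang_Ioi m le_rfl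
    rw [poissonLt_zero (by omega), ENNReal.ofReal_one] at h1
    rw [← h1]
    refine measure_congr ?_
    filter_upwards [ae_erlang_pos m] with t ht
    exact propext ⟨fun _ => ht, fun _ => trivial⟩
  exact Measure.isProbabilityMeasure_map Real.measurable_log.aemeasurable

/-- Identifies the limiting probability of the far event at level s, for k = m + 1, with a tail of
the log-Gamma law. -/
lemma logErlang_Ioi (m : ℕ) (s : ℝ) :
    (logErlang m).real (Set.Ioi s) = poissonLt (m + 1) (Real.exp s) := by
  rw [Measure.real, logErlang, Measure.map_apply Real.measurable_log measurableSet_Ioi,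
    ← ENNReal.toReal_ofReal (poissonLt_nonneg (m + 1) (Real.exp_pos s).le),
    ← erlang_Ioi m (Real.exp_pos s).le]
  congr 1
  refine measure_congr ?_
  filter_upwards [ae_erlang_pos m] with t ht
  exact propext (Real.lt_log_iff_exp_lt ht)

lemma integrable_logErlang (m : ℕ) : Integrable (fun t => t) (logErlang m) := by
  rw [logErlang, integrable_map_measure (by fun_prop) Real.measurable_log.aemeasurable,
    integrable_withDensity_iff_integrable_smul' (measurable_erlangDensity m).ennreal_ofReal
      (by simp)]
  refine (integrableOn_log_mul_erlangDensity m).1.congr ?_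
  filter_upwards [ae_restrict_mem measurableSet_Ioi] with t ht
  rw [ENNReal.toReal_ofReal (erlangDensity_nonneg m (le_of_lt ht))]
  rfl

lemma integral_logErlang (m : ℕ) : ∫ t, t ∂logErlang m = digamma (m + 1) := by
  rw [logErlang, integral_map Real.measurable_log.aemeasurable (by fun_prop),
    integral_withDensity_eq_integral_toReal_smul (measurable_erlangDensity m).ennreal_ofReal
      (by simp), ← (integrableOn_log_mul_erlangDensity m).2]
  refine setIntegral_congr_fun measurableSet_Ioi fun t ht => ?_
  rw [ENNReal.toReal_ofReal (erlangDensity_nonneg m (le_of_lt ht)), smul_eq_mul]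

end LogGamma

/-! ### A weak law of large numbers in L¹ for asymptotically independent arrays -/

section WeakLaw

variable {Ω : Type*} [MeasurableSpace Ω] {P : Measure Ω} [IsProbabilityMeasure P]

lemma integral_abs_le_sqrt {W : Ω → ℝ} (hW : Measurable W) {B : ℝ} (hB : ∀ ω, |W ω| ≤ B) :
    ∫ ω, |W ω| ∂P ≤ Real.sqrt (∫ ω, W ω ^ 2 ∂P) := by
  have hm : MemLp (fun ω => |W ω|) 2 P :=
    MemLp.of_bound hW.abs.aestronglyMeasurable B (ae_of_all _ fun ω => by simpa using hB ω)
  have h1 := variance_nonneg (fun ω => |W ω|) P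
  rw [variance_eq_sub hm] at h1
  simp only [Pi.pow_apply, sq_abs] at h1
  exact Real.le_sqrt_of_sq_le (by linarith)

lemma integral_indicator_sub_mul {A B : Set Ω} (hA : MeasurableSet A) (hB : MeasurableSet B)
    (p : ℝ) : ∫ ω, (A.indicator (fun _ => (1 : ℝ)) ω - p) * (B.indicator (fun _ => (1 : ℝ)) ω - p) ∂P =
      P.real (A ∩ B) - p * P.real A - p * P.real B + p ^ 2 := by
  have hi : ∀ {S : Set Ω}, MeasurableSet S → Integrable (S.indicator fun _ => (1 : ℝ)) P :=
    fun hS => (integrable_const 1).indicator hS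
  have e : ∀ ω, (A.indicator (fun _ => (1 : ℝ)) ω - p) * (B.indicator (fun _ => (1 : ℝ)) ω - p) =
      (A ∩ B).indicator (fun _ => (1 : ℝ)) ω - p * A.indicator (fun _ => (1 : ℝ)) ω
        - p * B.indicator (fun _ => (1 : ℝ)) ω + p ^ 2 := by
    intro ω
    by_cases h1 : ω ∈ A <;> by_cases h2 : ω ∈ B <;> simp [h1, h2] <;> ring
  simp_rw [e]
  rw [integral_add, integral_sub, integral_sub, integral_const_mul, integral_const_mul,
    integral_indicator_const _ (hA.inter hB), integral_indicator_const _ hA,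
    integral_indicator_const _ hB]
  · simp
  · exact hi (hA.inter hB)
  · exact (hi hA).const_mul p
  · exact (hi (hA.inter hB)).sub ((hi hA).const_mul p)
  · exact (hi hB).const_mul p
  · exact ((hi (hA.inter hB)).sub ((hi hA).const_mul p)).sub ((hi hB).const_mul p)
  · exact integrable_const _

lemma average_sub {N : ℕ} (hN : 1 ≤ N) (a : ℕ → ℝ) (L : ℝ) :
    1 / (N : ℝ) * ∑ i ∈ Finset.range N, a i - L =
      1 / (N : ℝ) * ∑ i ∈ Finset.range N, (a i - L) := by
  have hN0 : (N : ℝ) ≠ 0 := by positivity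
  rw [Finset.sum_sub_distrib, Finset.sum_const, Finset.card_range, nsmul_eq_mul]
  field_simp

/-- Asymptotically pairwise independent events of asymptotically equal probability obey the weak
law of large numbers. -/
lemma tendsto_integral_average_indicator {A : ℕ → ℕ → Set Ω} (hA : ∀ N i, MeasurableSet (A N i))
    {p : ℝ}
    (h1 : ∀ i : ℕ → ℕ, (∀ᶠ N in atTop, i N < N) →
      Tendsto (fun N => P.real (A N (i N))) atTop (𝓝 p))
    (h2 : ∀ i j : ℕ → ℕ, (∀ᶠ N in atTop, i N < N) → (∀ᶠ N in atTop, j N < N) →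
      (∀ᶠ N in atTop, i N ≠ j N) →
      Tendsto (fun N => P.real (A N (i N) ∩ A N (j N))) atTop (𝓝 (p * p))) :
    Tendsto (fun N : ℕ => ∫ ω, |1 / (N : ℝ) *
      ∑ i ∈ Finset.range N, (A N i).indicator (fun _ => (1 : ℝ)) ω - p| ∂P) atTop (𝓝 0) := by
  let u : ℕ → ℕ → Ω → ℝ := fun N i ω => (A N i).indicator (fun _ => (1 : ℝ)) ω - p
  let a : ℕ → ℕ → ℕ → ℝ := fun N i j => ∫ ω, u N i ω * u N j ω ∂P
  have ha : ∀ N i j, a N i j =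
      P.real (A N i ∩ A N j) - p * P.real (A N i) - p * P.real (A N j) + p ^ 2 :=
    fun N i j => integral_indicator_sub_mul (hA N i) (hA N j) p
  have hu : ∀ N i, Measurable (u N i) := fun N i =>
    (measurable_const.indicator (hA N i)).sub_const p
  have hub : ∀ N i ω, |u N i ω| ≤ 1 + |p| := by
    intro N i ω
    refine (abs_sub _ _).trans (add_le_add ?_ le_rfl)
    by_cases h : ω ∈ A N i <;> simp [h]
  have huu : ∀ N i j, Integrable (fun ω => u N i ω * u N j ω) P := by
    intro N i j
    refine Integrable.of_bound ((hu N i).mul (hu N j)).aestronglyMeasurable ((1 + |p|) * (1 + |p|))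
      (ae_of_all _ fun ω => ?_)
    rw [Real.norm_eq_abs, abs_mul]
    exact mul_le_mul (hub N i ω) (hub N j ω) (abs_nonneg _) (by positivity)
  have hab : ∀ N i j, |a N i j - 0| ≤ (1 + |p|) * (1 + |p|) := by
    intro N i j
    rw [sub_zero]
    have := norm_integral_le_of_norm_le_const (μ := P) (f := fun ω => u N i ω * u N j ω)
      (C := (1 + |p|) * (1 + |p|)) (ae_of_all _ fun ω => by
        rw [Real.norm_eq_abs, abs_mul]
        exact mul_le_mul (hub N i ω) (hub N j ω) (abs_nonneg _) (by positivity))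
    simpa using this
  -- For distinct indices the mixed moments tend to p·p - p·p - p·p + p^2 = 0. The second moment of
  -- the centred average is the double average of these moments.
  have key := tendsto_average_pair_of_sequences hab (fun i j hi hj hij => by
    simp_rw [ha]
    have := (((h2 i j hi hj hij).sub ((h1 i hi).const_mul p)).sub ((h1 j hj).const_mul p)).add_const
      (p ^ 2)
    convert this using 2
    ring)
  have hsq : ∀ N : ℕ, ∫ ω, (1 / (N : ℝ) * ∑ i ∈ Finset.range N, u N i ω) ^ 2 ∂P =
      1 / (N : ℝ) ^ 2 * ∑ i ∈ Finset.range N, ∑ j ∈ Finset.range N, a N i j := by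
    intro N
    simp_rw [mul_pow, div_pow, one_pow, pow_two (∑ i ∈ Finset.range N, _), Finset.sum_mul_sum]
    rw [integral_const_mul, integral_finsetSum _ fun i _ => integrable_finsetSum _ fun j _ =>
      huu N i j]
    congr 1
    exact Finset.sum_congr rfl fun i _ => integral_finsetSum _ fun j _ => huu N i j
  have hsqrt : Tendsto (fun N : ℕ => Real.sqrt (1 / (N : ℝ) ^ 2 *
      ∑ i ∈ Finset.range N, ∑ j ∈ Finset.range N, |a N i j - 0|)) atTop (𝓝 0) := by
    simpa using key.sqrt
  refine squeeze_zero' (Eventually.of_forall fun N => integral_nonneg fun ω => abs_nonneg _) ?_ hsqrt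
  filter_upwards [eventually_ge_atTop 1] with N hN
  have hN0 : (0 : ℝ) < N := by exact_mod_cast hN
  simp_rw [average_sub hN]
  refine (integral_abs_le_sqrt (B := 1 + |p|) ?_ fun ω => ?_).trans (Real.sqrt_le_sqrt ?_)
  · exact (Finset.measurable_fun_sum _ fun i _ => hu N i).const_mul _
  · rw [abs_mul, abs_of_nonneg (by positivity), one_div, inv_mul_le_iff₀ hN0]
    refine (Finset.abs_sum_le_sum_abs _ _).trans
      ((Finset.sum_le_card_nsmul _ _ _ fun i _ => hub N i ω).trans ?_)
    rw [Finset.card_range, nsmul_eq_mul]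
  · rw [hsq N]
    gcongr with i _ j _
    simpa using le_abs_self (a N i j)

/-- The number of the levels `-M + m δ`, `m < n`, below `t`. -/
def levelCount (M δ : ℝ) (n : ℕ) (t : ℝ) : ℝ :=
  ∑ m ∈ Finset.range n, (Set.Ioi (-M + m * δ)).indicator (fun _ => (1 : ℝ)) t

/-- The staircase rising by δ at each level follows t within δ on [-M, M] and is constant outside,
where the error is the excess of |t| over M, up to δ. -/
lemma abs_sub_levelCount_le {M δ : ℝ} (hδ : 0 ≤ δ) {n : ℕ} (hn : n * δ = 2 * M) (t : ℝ) :
    |t - (-M + δ * levelCount M δ n t)| ≤ max (|t| - M) 0 + δ := by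
  -- Induction on the number of steps, separating the case where `t` lies above every level from the
  -- case where the staircase has already passed `t`.
  have key : ∀ n : ℕ, (n * δ < t + M → levelCount M δ n t = n) ∧
      (t + M ≤ n * δ → max (t + M) 0 ≤ δ * levelCount M δ n t ∧
        δ * levelCount M δ n t ≤ max (t + M) 0 + δ) := by
    intro n
    induction n with
    | zero =>
      refine ⟨fun _ => by simp [levelCount], fun h => ?_⟩
      have h0 : t + M ≤ 0 := by simpa using h
      simp [levelCount, h0, hδ]
    | succ n ih =>
      have hs : levelCount M δ (n + 1) t = levelCount M δ n t +
          (Set.Ioi (-M + n * δ)).indicator (fun _ => (1 : ℝ)) t := by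
        rw [levelCount, Finset.sum_range_succ, levelCount]
      rcases lt_or_ge (n * δ) (t + M) with h | h
      · have hmem : t ∈ Set.Ioi (-M + n * δ) := by
          rw [Set.mem_Ioi]; linarith
        rw [hs, Set.indicator_of_mem hmem, ih.1 h]
        have h0 : 0 ≤ t + M := le_trans (by positivity) h.le
        refine ⟨fun _ => by push_cast; ring, fun h' => ?_⟩
        push_cast at h'
        rw [max_eq_left h0]
        constructor <;> nlinarith
      · have hmem : t ∉ Set.Ioi (-M + n * δ) := by
          rw [Set.mem_Ioi]; linarith
        rw [hs, Set.indicator_of_notMem hmem, add_zero]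
        refine ⟨fun h' => ?_, fun _ => ih.2 h⟩
        push_cast at h'
        nlinarith
  have hM : 0 ≤ 2 * M := hn ▸ by positivity
  have h1 := le_max_left (|t| - M) 0
  have h2 := le_max_right (|t| - M) 0
  have h3 := le_abs_self t
  have h4 := neg_abs_le t
  rcases lt_or_ge (n * δ) (t + M) with h | h
  · rw [(key n).1 h, mul_comm, hn, abs_le]
    constructor <;> linarith
  · obtain ⟨a, b⟩ := (key n).2 h
    rcases le_total 0 (t + M) with h0 | h0
    · rw [max_eq_left h0] at a b
      rw [abs_le]
      constructor <;> linarith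
    · rw [max_eq_right h0] at a b
      rw [abs_le]
      constructor <;> linarith

lemma measurable_levelCount (M δ : ℝ) (n : ℕ) : Measurable (levelCount M δ n) :=
  Finset.measurable_fun_sum _ fun _ _ => measurable_const.indicator measurableSet_Ioi

lemma integrable_levelCount {α : Type*} [MeasurableSpace α] {μ : Measure α} [IsFiniteMeasure μ]
    {T : α → ℝ} (hT : Measurable T) (M δ : ℝ) (n : ℕ) :
    Integrable (fun a => levelCount M δ n (T a)) μ := by
  refine Integrable.of_bound ((measurable_levelCount M δ n).comp hT).aestronglyMeasurable n
    (ae_of_all _ fun a => ?_)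
  refine (norm_sum_le _ _).trans
    ((Finset.sum_le_card_nsmul _ _ (1 : ℝ) fun m _ => ?_).trans (by simp))
  by_cases h : T a ∈ Set.Ioi (-M + m * δ)
  · rw [Set.indicator_of_mem h]; simp
  · rw [Set.indicator_of_notMem h]; simp

lemma integral_levelCount (γ : Measure ℝ) [IsProbabilityMeasure γ] (M δ : ℝ) (n : ℕ) :
    ∫ t, levelCount M δ n t ∂γ = ∑ m ∈ Finset.range n, γ.real (Set.Ioi (-M + m * δ)) := by
  unfold levelCount
  rw [integral_finsetSum _ fun m _ => (integrable_const 1).indicator measurableSet_Ioi]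
  exact Finset.sum_congr rfl fun m _ => by
    rw [integral_indicator_const _ measurableSet_Ioi]; simp

lemma tendsto_integral_excess {α : Type*} [MeasurableSpace α] {μ : Measure α}
    {T : α → ℝ} (hT : Integrable T μ) :
    Tendsto (fun M : ℝ => ∫ a, max (|T a| - M) 0 ∂μ) atTop (𝓝 0) := by
  suffices h : Tendsto (fun M : ℝ => ∫ a, max (|T a| - M) 0 ∂μ) atTop (𝓝 (∫ _a, (0 : ℝ) ∂μ)) by
    simpa using h
  refine tendsto_integral_filter_of_dominated_convergence (fun a => |T a|) ?_ ?_ hT.abs ?_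
  · exact Eventually.of_forall fun M =>
      ((hT.abs.aestronglyMeasurable.sub aestronglyMeasurable_const).sup aestronglyMeasurable_const)
  · filter_upwards [eventually_ge_atTop 0] with M hM
    refine ae_of_all _ fun a => ?_
    rw [Real.norm_eq_abs, abs_of_nonneg (le_max_right _ _)]
    exact max_le (by linarith) (abs_nonneg _)
  · refine ae_of_all _ fun a => tendsto_const_nhds.congr' ?_
    filter_upwards [eventually_ge_atTop |T a|] with M hM
    rw [max_eq_right (by linarith)]

lemma integrable_excess {α : Type*} [MeasurableSpace α] {μ : Measure α} [IsFiniteMeasure μ]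
    {T : α → ℝ} (hT : Integrable T μ) (M : ℝ) : Integrable (fun a => max (|T a| - M) 0) μ :=
  (hT.abs.sub (integrable_const M)).sup (integrable_const 0)

/-- Uniformly integrable, asymptotically pairwise independent variables that are asymptotically
distributed as `γ` obey the weak law of large numbers in `L¹`. -/
lemma tendsto_integral_average {T : ℕ → ℕ → Ω → ℝ} (hT : ∀ N i, Measurable (T N i))
    {γ : Measure ℝ} [IsProbabilityMeasure γ] (hγ : Integrable (fun t => t) γ)
    (h1 : ∀ (s : ℝ) (i : ℕ → ℕ), (∀ᶠ N in atTop, i N < N) →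
      Tendsto (fun N => P.real {ω | s < T N (i N) ω}) atTop (𝓝 (γ.real (Set.Ioi s))))
    (h2 : ∀ (s : ℝ) (i j : ℕ → ℕ), (∀ᶠ N in atTop, i N < N) → (∀ᶠ N in atTop, j N < N) →
      (∀ᶠ N in atTop, i N ≠ j N) →
      Tendsto (fun N => P.real {ω | s < T N (i N) ω ∧ s < T N (j N) ω}) atTop
        (𝓝 (γ.real (Set.Ioi s) * γ.real (Set.Ioi s))))
    (hint : ∀ᶠ N in atTop, ∀ i < N, Integrable (T N i) P)
    (hui : ∀ η : ℝ, 0 < η → ∀ᶠ M : ℝ in atTop, ∀ᶠ N in atTop, ∀ i < N,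
      ∫ ω, max (|T N i ω| - M) 0 ∂P ≤ η) :
    Tendsto (fun N : ℕ => ∫ ω, |1 / (N : ℝ) * ∑ i ∈ Finset.range N, T N i ω - ∫ t, t ∂γ| ∂P) atTop
      (𝓝 0) := by
  refine Metric.tendsto_nhds.2 fun ε hε => ?_
  -- The budget: η + δ for the sample staircase, η for the level frequencies, η + δ for the
  -- staircase under γ; with δ ≤ η the total is at most 5η < ε.
  set η := ε / 6 with hη
  have hη0 : 0 < η := by positivity
  obtain ⟨M, hM0, hM1, hM2⟩ := ((eventually_gt_atTop (0 : ℝ)).and ((hui η hη0).and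
    ((tendsto_integral_excess hγ).eventually_le_const hη0))).exists
  obtain ⟨n, hn⟩ := exists_nat_gt (2 * M / η)
  have hn0 : (0 : ℝ) < n := lt_trans (by positivity) hn
  set δ := 2 * M / n with hδ
  have hδ0 : 0 < δ := by positivity
  have hnδ : n * δ = 2 * M := by rw [hδ]; field_simp
  have hδη : δ ≤ η := by
    rw [hδ, div_le_iff₀ hn0]
    rw [div_lt_iff₀ hη0] at hn
    linarith
  let A : ℕ → ℕ → ℕ → Set Ω := fun m N i => {ω | -M + m * δ < T N i ω}
  let D : ℕ → ℕ → Ω → ℝ := fun m N ω => 1 / (N : ℝ) *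
      ∑ i ∈ Finset.range N, (A m N i).indicator (fun _ => (1 : ℝ)) ω - γ.real (Set.Ioi (-M + m * δ))
  have hAm : ∀ m N i, MeasurableSet (A m N i) := fun m N i =>
    measurableSet_lt measurable_const (hT N i)
  have hcount : Tendsto (fun N : ℕ => ∑ m ∈ Finset.range n, ∫ ω, |D m N ω| ∂P) atTop (𝓝 0) := by
    rw [show (0 : ℝ) = ∑ m ∈ Finset.range n, (0 : ℝ) by simp]
    exact tendsto_finsetSum _ fun m _ =>
      tendsto_integral_average_indicator (hAm m) (h1 _) (h2 _)
  have hDi : ∀ m N, Integrable (D m N) P := fun m N =>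
    ((integrable_finsetSum _ fun i _ => (integrable_const 1).indicator (hAm m N i)).const_mul
      _).sub (integrable_const _)
  have hδcount := hcount.const_mul δ
  rw [mul_zero] at hδcount
  have hγ1 : |(-M + δ * ∑ m ∈ Finset.range n, γ.real (Set.Ioi (-M + m * δ))) - ∫ t, t ∂γ| ≤
      η + δ := by
    have hi : Integrable (levelCount M δ n) γ := integrable_levelCount measurable_id M δ n
    have e : (-M + δ * ∑ m ∈ Finset.range n, γ.real (Set.Ioi (-M + m * δ))) - ∫ t, t ∂γ =
        ∫ t, -(t - (-M + δ * levelCount M δ n t)) ∂γ := by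
      have hi' : Integrable (fun t => -M + δ * levelCount M δ n t) γ :=
        (integrable_const _).add (hi.const_mul δ)
      rw [integral_neg, integral_sub hγ hi', integral_add (integrable_const _) (hi.const_mul δ),
        integral_const_mul, integral_levelCount]
      simp
    rw [e]
    refine (abs_integral_le_integral_abs).trans ?_
    refine (integral_mono (g := fun t => max (|t| - M) 0 + δ) ?_
      ((integrable_excess hγ M).add (integrable_const δ)) fun t => ?_).trans ?_
    · exact ((hγ.sub ((integrable_const _).add (hi.const_mul δ))).neg).abs
    · dsimp only
      rw [abs_neg]
      exact abs_sub_levelCount_le hδ0.le hnδ t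
    · rw [integral_add (integrable_excess hγ M) (integrable_const δ)]
      simpa using hM2
  have hev := hδcount.eventually_le_const hη0
  filter_upwards [hev, hM1, hint, eventually_ge_atTop 1] with N hN1 hN2 hN3 hN
  have hN0 : (0 : ℝ) < N := by exact_mod_cast hN
  rw [Real.dist_eq, sub_zero, abs_of_nonneg (integral_nonneg fun ω => abs_nonneg _)]
  have hpt : ∀ ω, |1 / (N : ℝ) * ∑ i ∈ Finset.range N, T N i ω - ∫ t, t ∂γ| ≤
      (1 / (N : ℝ) * ∑ i ∈ Finset.range N, (max (|T N i ω| - M) 0 + δ)) +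
      (δ * ∑ m ∈ Finset.range n, |D m N ω|) + (η + δ) := by
    intro ω
    set Γ := ∑ m ∈ Finset.range n, γ.real (Set.Ioi (-M + m * δ)) with hΓ
    have e1 : 1 / (N : ℝ) * ∑ i ∈ Finset.range N, T N i ω -
        1 / (N : ℝ) * ∑ i ∈ Finset.range N, (-M + δ * levelCount M δ n (T N i ω)) =
        1 / (N : ℝ) * ∑ i ∈ Finset.range N, (T N i ω - (-M + δ * levelCount M δ n (T N i ω))) := by
      rw [Finset.sum_sub_distrib, mul_sub]
    have e2 : 1 / (N : ℝ) * ∑ i ∈ Finset.range N, (-M + δ * levelCount M δ n (T N i ω)) -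
        (-M + δ * Γ) = δ * ∑ m ∈ Finset.range n, D m N ω := by
      simp only [D, Finset.sum_sub_distrib, ← Finset.mul_sum, Finset.sum_add_distrib,
        Finset.sum_const, Finset.card_range, nsmul_eq_mul]
      rw [Finset.sum_comm]
      have : ∑ i ∈ Finset.range N, levelCount M δ n (T N i ω) = ∑ y ∈ Finset.range N,
          ∑ m ∈ Finset.range n, (A m N y).indicator (fun _ => (1 : ℝ)) ω := rfl
      rw [this, ← hΓ]
      field_simp
      ring
    have b1 : |1 / (N : ℝ) * ∑ i ∈ Finset.range N, (T N i ω - (-M + δ * levelCount M δ n (T N i ω)))| ≤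
        1 / (N : ℝ) * ∑ i ∈ Finset.range N, (max (|T N i ω| - M) 0 + δ) := by
      rw [abs_mul, abs_of_nonneg (by positivity : 0 ≤ 1 / (N : ℝ))]
      gcongr
      exact (Finset.abs_sum_le_sum_abs _ _).trans
        (Finset.sum_le_sum fun i _ => abs_sub_levelCount_le hδ0.le hnδ _)
    have b2 : |δ * ∑ m ∈ Finset.range n, D m N ω| ≤ δ * ∑ m ∈ Finset.range n, |D m N ω| := by
      rw [abs_mul, abs_of_pos hδ0]
      gcongr
      exact Finset.abs_sum_le_sum_abs _ _
    rw [← e1] at b1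
    rw [← e2] at b2
    rw [abs_le] at b1 b2 hγ1 ⊢
    constructor <;> linarith [b1.1, b1.2, b2.1, b2.2, hγ1.1, hγ1.2]
  have i1 : ∀ i ∈ Finset.range N, Integrable (fun ω => max (|T N i ω| - M) 0 + δ) P := fun i hi =>
    (integrable_excess (hN3 i (Finset.mem_range.1 hi)) M).add (integrable_const δ)
  have j1 : Integrable (fun ω => 1 / (N : ℝ) *
      ∑ i ∈ Finset.range N, (max (|T N i ω| - M) 0 + δ)) P :=
    (integrable_finsetSum _ i1).const_mul _
  have j2 : Integrable (fun ω => δ * ∑ m ∈ Finset.range n, |D m N ω|) P :=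
    (integrable_finsetSum _ fun m _ => (hDi m N).abs).const_mul _
  have j0 : Integrable (fun ω => |1 / (N : ℝ) * ∑ i ∈ Finset.range N, T N i ω - ∫ t, t ∂γ|) P :=
    (((integrable_finsetSum _ fun i hi => hN3 i (Finset.mem_range.1 hi)).const_mul _).sub
      (integrable_const _)).abs
  have hle := integral_mono j0 ((j1.add j2).add (integrable_const (η + δ))) hpt
  refine hle.trans_lt ?_
  have s1 : ∫ ω, 1 / (N : ℝ) * ∑ i ∈ Finset.range N, (max (|T N i ω| - M) 0 + δ) ∂P ≤ η + δ := by
    rw [integral_const_mul, integral_finsetSum _ i1, one_div, inv_mul_le_iff₀ hN0]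
    refine (Finset.sum_le_card_nsmul _ _ (η + δ) fun i hi => ?_).trans
      (by rw [Finset.card_range, nsmul_eq_mul])
    rw [integral_add (integrable_excess (hN3 i (Finset.mem_range.1 hi)) M) (integrable_const δ)]
    simpa using hN2 i (Finset.mem_range.1 hi)
  have s2 : ∫ ω, δ * ∑ m ∈ Finset.range n, |D m N ω| ∂P ≤ η := by
    rw [integral_const_mul, integral_finsetSum _ fun m _ => (hDi m N).abs]
    exact hN1
  have e : ∫ ω, ((fun ω : Ω => 1 / (N : ℝ) * ∑ i ∈ Finset.range N, (max (|T N i ω| - M) 0 + δ)) +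
      (fun ω => δ * ∑ m ∈ Finset.range n, |D m N ω|) + fun _ => η + δ : Ω → ℝ) ω ∂P =
      ∫ ω, 1 / (N : ℝ) * ∑ i ∈ Finset.range N, (max (|T N i ω| - M) 0 + δ) ∂P +
      ∫ ω, δ * ∑ m ∈ Finset.range n, |D m N ω| ∂P + (η + δ) := by
    rw [integral_add' (j1.add j2) (integrable_const _), integral_add' j1 j2]
    simp
  rw [e]
  linarith

lemma integrable_of_tail {L : Ω → ℝ} (hL : Measurable L) {q : ℝ → ℝ}
    (hq : IntegrableOn q (Set.Ioi 0)) (h : ∀ t, 0 ≤ t → P.real {ω | t < |L ω|} ≤ q t) :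
    Integrable L P := by
  refine (integrable_norm_iff hL.aestronglyMeasurable).1 ⟨hL.norm.aestronglyMeasurable, ?_⟩
  simp only [Real.norm_eq_abs]
  rw [hasFiniteIntegral_iff_ofReal (ae_of_all _ fun ω => abs_nonneg _),
    lintegral_eq_lintegral_meas_lt P (ae_of_all _ fun ω => abs_nonneg _) hL.abs.aemeasurable]
  refine lt_of_le_of_lt (lintegral_mono_ae ?_) hq.lintegral_lt_top
  filter_upwards [ae_restrict_mem measurableSet_Ioi] with t ht
  rw [← ofReal_measureReal]
  exact ENNReal.ofReal_le_ofReal (h t (le_of_lt ht))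

/-- Layer-cake formula: the excess over M surpasses t exactly when |L| surpasses t + M, so the tail
integral starts at M. -/
lemma integral_excess_le {L : Ω → ℝ} (hL : Measurable L) {q : ℝ → ℝ}
    (hq : IntegrableOn q (Set.Ioi 0)) (h : ∀ t, 0 ≤ t → P.real {ω | t < |L ω|} ≤ q t) {M : ℝ}
    (hM : 0 ≤ M) : ∫ ω, max (|L ω| - M) 0 ∂P ≤ ∫ t in Set.Ioi M, q t := by
  have hi := integrable_excess (integrable_of_tail hL hq h) M
  rw [hi.integral_eq_integral_meas_lt (ae_of_all _ fun ω => le_max_right _ _)]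
  have hset : ∀ t ∈ Set.Ioi (0 : ℝ), P.real {ω | t < max (|L ω| - M) 0} =
      P.real {ω | t + M < |L ω|} := by
    intro t ht
    congr 1
    ext ω
    simp only [Set.mem_ofPred_eq, lt_max_iff, not_lt.2 (Set.mem_Ioi.1 ht).le, or_false]
    exact lt_sub_iff_add_lt
  have hqM : IntegrableOn q (Set.Ioi M) := hq.mono_set (Set.Ioi_subset_Ioi hM)
  have hmp : MeasurePreserving (fun t : ℝ => t + M) (volume.restrict (Set.Ioi 0))
      (volume.restrict (Set.Ioi M)) := by
    have := (measurePreserving_add_right (volume : Measure ℝ) M).restrict_preimage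
      (measurableSet_Ioi (a := M))
    simpa using this
  have he : MeasurableEmbedding fun t : ℝ => t + M := measurableEmbedding_addRight M
  rw [setIntegral_congr_fun measurableSet_Ioi hset, ← hmp.integral_comp he]
  refine integral_mono_of_nonneg (ae_of_all _ fun t => measureReal_nonneg)
    ((hmp.integrable_comp_emb he).2 hqM) ?_
  filter_upwards [ae_restrict_mem measurableSet_Ioi] with t ht
  exact h _ (add_nonneg (le_of_lt ht) hM)

lemma tendsto_integral_Ioi_atTop {q : ℝ → ℝ} (hq : IntegrableOn q (Set.Ioi 0)) :
    Tendsto (fun M : ℝ => ∫ t in Set.Ioi M, q t) atTop (𝓝 0) := by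
  have h1 := intervalIntegral_tendsto_integral_Ioi 0 hq tendsto_id
  have h2 := h1.const_sub (∫ t in Set.Ioi 0, q t)
  rw [sub_self] at h2
  refine h2.congr' ?_
  filter_upwards [eventually_ge_atTop 0] with M hM
  have := intervalIntegral.integral_Ioi_sub_Ioi hq hM
  simp only [id]
  rw [← this]
  ring

end WeakLaw

/-! ### Comparison of the digamma function with the logarithm -/

section DigammaLog

lemma digamma_natCast_add_one (n : ℕ) :
    digamma (n + 1) = harmonic n - Real.eulerMascheroniConstant := by
  have h : Complex.digamma ((n : ℂ) + 1) = ((harmonic n - Real.eulerMascheroniConstant : ℝ) : ℂ) := by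
    induction n with
    | zero => simp [Complex.digamma_one]
    | succ n ih =>
      have hn : ∀ m : ℕ, ((n : ℂ) + 1) ≠ -m := by
        intro m h
        have h1 : (n : ℝ) + 1 = -m := by
          have := congrArg Complex.re h
          simpa using this
        have : (0 : ℝ) < (n : ℝ) + 1 := by positivity
        have : (0 : ℝ) ≤ m := by positivity
        linarith
      rw [Nat.cast_succ, Complex.digamma_apply_add_one _ hn, ih, harmonic_succ]
      push_cast
      ring
  rw [digamma]
  push_cast
  rw [h, Complex.ofReal_re]

/-- Here ψ(n+1) = H_n - γ, and Euler's constant lies between H_n - log(n+1) and H_n - log n. -/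
lemma abs_digamma_sub_log_le {n : ℕ} (hn : 1 ≤ n) :
    |digamma (n + 1) - Real.log n| ≤ 1 / n := by
  have hn0 : (0 : ℝ) < n := by exact_mod_cast hn
  have h1 := Real.eulerMascheroniSeq_lt_eulerMascheroniConstant n
  have h2 := Real.eulerMascheroniConstant_lt_eulerMascheroniSeq' n
  rw [Real.eulerMascheroniSeq] at h1
  rw [Real.eulerMascheroniSeq', if_neg (by omega)] at h2
  have h3 : Real.log (n + 1) - Real.log n ≤ 1 / n := by
    rw [← Real.log_div (by positivity) hn0.ne']
    refine (Real.log_le_sub_one_of_pos (by positivity)).trans (le_of_eq ?_)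
    field_simp
    ring
  rw [digamma_natCast_add_one, abs_le]
  have : (0 : ℝ) < 1 / n := by positivity
  constructor <;> linarith

end DigammaLog

/-! ### Elementary limit lemmas -/

section Sandwich

/-- The bounds hold for each fixed δ as N → ∞; letting δ → 0 afterwards, continuity of `F` closes
the gap. -/
lemma tendsto_of_sandwich {u : ℕ → ℝ} {F : ℝ → ℝ} {s : ℝ} (hF : ContinuousAt F s)
    (hu : ∀ δ : ℝ, 0 < δ → ∃ v : ℕ → ℝ, Tendsto v atTop (𝓝 (F (s - δ))) ∧ ∀ᶠ N in atTop, u N ≤ v N)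
    (hl : ∀ δ : ℝ, 0 < δ → ∃ v : ℕ → ℝ, Tendsto v atTop (𝓝 (F (s + δ))) ∧ ∀ᶠ N in atTop, v N ≤ u N) :
    Tendsto u atTop (𝓝 (F s)) := by
  have hright : Tendsto (fun δ => F (s + δ)) (𝓝[>] 0) (𝓝 (F s)) := by
    have : Tendsto (fun δ : ℝ => s + δ) (𝓝 0) (𝓝 s) := by
      simpa using (continuous_const_add s).tendsto 0
    exact (hF.tendsto.comp this).mono_left nhdsWithin_le_nhds
  have hleft : Tendsto (fun δ => F (s - δ)) (𝓝[>] 0) (𝓝 (F s)) := by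
    have : Tendsto (fun δ : ℝ => s - δ) (𝓝 0) (𝓝 s) := by
      simpa using (continuous_sub_left s).tendsto 0
    exact (hF.tendsto.comp this).mono_left nhdsWithin_le_nhds
  refine tendsto_order.2 ⟨fun a ha => ?_, fun a ha => ?_⟩
  · obtain ⟨δ, h1, h2⟩ := ((hright.eventually_const_lt ha).and self_mem_nhdsWithin).exists
    obtain ⟨v, hv, hv'⟩ := hl δ h2
    filter_upwards [hv.eventually_const_lt h1, hv'] with N h3 h4
    exact h3.trans_le h4
  · obtain ⟨δ, h1, h2⟩ := ((hleft.eventually_lt_const ha).and self_mem_nhdsWithin).exists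
    obtain ⟨v, hv, hv'⟩ := hu δ h2
    filter_upwards [hv.eventually_lt_const h1, hv'] with N h3 h4
    exact h4.trans_lt h3

lemma average_add (N : ℕ) (a b : ℕ → ℝ) :
    1 / (N : ℝ) * ∑ i ∈ Finset.range N, (a i + b i) =
      1 / (N : ℝ) * ∑ i ∈ Finset.range N, a i + 1 / (N : ℝ) * ∑ i ∈ Finset.range N, b i := by
  rw [Finset.sum_add_distrib, mul_add]

end Sandwich

/-- The neighbour counts `nx N i`, `ny N i` of the `i`-th among `N` sample points. -/
structure CountFamily {dx dy : ℕ} (gx : (Fin dx → ℝ) → ℝ) (gy : (Fin dy → ℝ) → ℝ)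
    (g : (Fin dx → ℝ) × (Fin dy → ℝ) → ℝ) (k : ℕ) {Ω : Type*} [MeasurableSpace Ω]
    (Z : ℕ → Ω → (Fin dx → ℝ) × (Fin dy → ℝ)) (nx ny : ℕ → ℕ → Ω → ℕ) : Prop where
  measurable_x : ∀ N i, Measurable (nx N i)
  measurable_y : ∀ N i, Measurable (ny N i)
  counts : ∀ N, k < N → ∀ i < N, ∀ ω, KnnCounts gx gy g k (others N i) (Z i ω)
    (restrictSample Z (others N i) ω) (nx N i ω) (ny N i ω)

/-! ### Convergence of the averages of the count logarithms -/

section Excess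

variable {dx dy : ℕ} {f : (Fin dx → ℝ) × (Fin dy → ℝ) → ℝ} {C K : ℝ}
  {gx : (Fin dx → ℝ) → ℝ} {gy : (Fin dy → ℝ) → ℝ} {g : (Fin dx → ℝ) × (Fin dy → ℝ) → ℝ}
  {cx cy c : ℝ} {Ω : Type*} [MeasurableSpace Ω] {P : Measure Ω} [IsProbabilityMeasure P]
  {Z : ℕ → Ω → (Fin dx → ℝ) × (Fin dy → ℝ)} {nx ny : ℕ → ℕ → Ω → ℕ} {k : ℕ}

/-- The logarithm of `nx ny / N`, centred by its limiting conditional location. -/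
def logExcess (f : (Fin dx → ℝ) × (Fin dy → ℝ) → ℝ) (cx cy c : ℝ)
    (Z : ℕ → Ω → (Fin dx → ℝ) × (Fin dy → ℝ)) (nx ny : ℕ → ℕ → Ω → ℕ) (N i : ℕ) (ω : Ω) : ℝ :=
  logCounts N (nx N i ω) (ny N i ω) - logCentre f cx cy c (Z i ω)

/-- The event that the `k`-th neighbour of the `i`-th sample point is farther than level `s`. -/
def farEvent (f g : (Fin dx → ℝ) × (Fin dy → ℝ) → ℝ) (c : ℝ) (k : ℕ)
    (Z : ℕ → Ω → (Fin dx → ℝ) × (Fin dy → ℝ)) (s : ℝ) (N i : ℕ) : Set Ω :=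
  {ω | cntAt Z N i (levelBall f g c N s) ω < k}

/-- The event that the cylinders at level `s` contain many points. -/
def manyEvent (f : (Fin dx → ℝ) × (Fin dy → ℝ) → ℝ) (gx : (Fin dx → ℝ) → ℝ) (gy : (Fin dy → ℝ) → ℝ)
    (cx cy c : ℝ) (Z : ℕ → Ω → (Fin dx → ℝ) × (Fin dy → ℝ)) (s δ : ℝ) (N i : ℕ) : Set Ω :=
  {ω | N * Real.exp (logCentre f cx cy c (Z i ω) + s + δ) ≤
      cntAt Z N i (levelX f gx c N s) ω * cntAt Z N i (levelY f gy c N s) ω}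

/-- The event that the cylinders at level `s` contain few points. -/
def fewEvent (f : (Fin dx → ℝ) × (Fin dy → ℝ) → ℝ) (gx : (Fin dx → ℝ) → ℝ) (gy : (Fin dy → ℝ) → ℝ)
    (cx cy c : ℝ) (Z : ℕ → Ω → (Fin dx → ℝ) × (Fin dy → ℝ)) (s δ : ℝ) (N i : ℕ) : Set Ω :=
  {ω | (cntAt Z N i (levelX f gx c N s) ω * cntAt Z N i (levelY f gy c N s) ω : ℝ) ≤
      N * Real.exp (logCentre f cx cy c (Z i ω) + s - δ)}

lemma rad_nonneg' (H : Setup f C K gx gy g cx cy c) (N : ℕ) (s : ℝ)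
    (z : (Fin dx → ℝ) × (Fin dy → ℝ)) : 0 ≤ rad dx dy c N s (f z) := by
  have h1 := H.dens.nonneg z
  have h2 := H.gauge.pos
  unfold rad
  positivity

omit [IsProbabilityMeasure P] in
-- If the k-th neighbour is within level s - δ, the counts are at most those of the cylinders at
-- that level, so a large product forces these cylinders to be crowded.
lemma lt_logExcess_subset (H : Setup f C K gx gy g cx cy c) (hn : CountFamily gx gy g k Z nx ny)
    {N i : ℕ} (hN : k < N) (hi : i < N) (s δ : ℝ) :
    {ω | s < logExcess f cx cy c Z nx ny N i ω} ⊆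
      farEvent f g c k Z (s - δ) N i ∪ manyEvent f gx gy cx cy c Z (s - δ) δ N i := by
  intro ω hω
  by_contra hcon
  simp only [Set.mem_union, not_or, farEvent, manyEvent, Set.mem_ofPred_eq, not_lt, not_le] at hcon hω
  obtain ⟨h1, h2⟩ := hcon
  have hK := hn.counts N hN i hi ω
  obtain ⟨h3, h4⟩ := hK.le_of _ (rad_nonneg' H N (s - δ) (Z i ω)) h1
  have hN0 : (0 : ℝ) < N := by exact_mod_cast (by omega : 0 < N)
  have h5 : Real.exp (logCentre f cx cy c (Z i ω) + s) < nx N i ω * ny N i ω / N := by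
    rw [← exp_logCounts (by omega) hK.x_pos hK.y_pos]
    refine Real.exp_lt_exp.2 ?_
    unfold logExcess at hω
    linarith
  rw [lt_div_iff₀ hN0] at h5
  have h6 : (nx N i ω * ny N i ω : ℝ) ≤
      cntAt Z N i (levelX f gx c N (s - δ)) ω * cntAt Z N i (levelY f gy c N (s - δ)) ω := by
    exact_mod_cast Nat.mul_le_mul h3 h4
  rw [show logCentre f cx cy c (Z i ω) + (s - δ) + δ = logCentre f cx cy c (Z i ω) + s by ring] at h2
  linarith

omit [IsProbabilityMeasure P] in
-- If the k-th neighbour is beyond level s + δ, the counts are at least those of the cylinders at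
-- that level, so a small product forces these cylinders to be sparse.
lemma farEvent_subset (H : Setup f C K gx gy g cx cy c) (hn : CountFamily gx gy g k Z nx ny)
    {N i : ℕ} (hN : k < N) (hi : i < N) (s δ : ℝ) :
    farEvent f g c k Z (s + δ) N i ⊆
      {ω | s < logExcess f cx cy c Z nx ny N i ω} ∪ fewEvent f gx gy cx cy c Z (s + δ) δ N i := by
  intro ω hω
  by_contra hcon
  simp only [Set.mem_union, not_or, farEvent, fewEvent, Set.mem_ofPred_eq, not_lt, not_le] at hcon hω
  obtain ⟨h1, h2⟩ := hcon
  have hK := hn.counts N hN i hi ω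
  obtain ⟨h3, h4⟩ := hK.ge_of _ (rad_nonneg' H N (s + δ) (Z i ω)) hω
  have hN0 : (0 : ℝ) < N := by exact_mod_cast (by omega : 0 < N)
  have h5 : nx N i ω * ny N i ω / N ≤ Real.exp (logCentre f cx cy c (Z i ω) + s) := by
    rw [← exp_logCounts (by omega) hK.x_pos hK.y_pos]
    refine Real.exp_le_exp.2 ?_
    unfold logExcess at h1
    linarith
  rw [div_le_iff₀ hN0] at h5
  have h6 : (cntAt Z N i (levelX f gx c N (s + δ)) ω * cntAt Z N i (levelY f gy c N (s + δ)) ω : ℝ) ≤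
      nx N i ω * ny N i ω := by
    exact_mod_cast Nat.mul_le_mul h3 h4
  rw [show logCentre f cx cy c (Z i ω) + (s + δ) - δ = logCentre f cx cy c (Z i ω) + s by ring] at h2
  linarith

lemma continuous_poissonLt_exp (k : ℕ) : Continuous fun s : ℝ => poissonLt k (Real.exp s) :=
  (continuous_poissonLt k).comp Real.continuous_exp

/-- The crowded and sparse events vanish in probability, leaving far events at levels s - δ and s +
δ as upper and lower bounds. -/
lemma tendsto_prob_logExcess (H : Setup f C K gx gy g cx cy c) (hZ : IsIID Z (law f) P)
    (hk : 1 ≤ k) (hn : CountFamily gx gy g k Z nx ny) (s : ℝ) {i : ℕ → ℕ}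
    (hi : ∀ᶠ N in atTop, i N < N) :
    Tendsto (fun N => P.real {ω | s < logExcess f cx cy c Z nx ny N (i N) ω}) atTop
      (𝓝 (poissonLt k (Real.exp s))) := by
  refine tendsto_of_sandwich (F := fun s => poissonLt k (Real.exp s))
    (continuous_poissonLt_exp k).continuousAt (fun δ hδ => ?_) (fun δ hδ => ?_)
  · refine ⟨fun N => P.real (farEvent f g c k Z (s - δ) N (i N)) +
      P.real (manyEvent f gx gy cx cy c Z (s - δ) δ N (i N)), ?_, ?_⟩
    · have := (H.tendsto_far hZ hk (s - δ) hi).add (H.tendsto_ge hZ (s - δ) hδ hi)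
      rw [add_zero] at this
      exact this
    · filter_upwards [hi, eventually_gt_atTop k] with N h1 h2
      exact (measureReal_mono (lt_logExcess_subset H hn h2 h1 s δ)).trans (measureReal_union_le _ _)
  · refine ⟨fun N => P.real (farEvent f g c k Z (s + δ) N (i N)) -
      P.real (fewEvent f gx gy cx cy c Z (s + δ) δ N (i N)), ?_, ?_⟩
    · have := (H.tendsto_far hZ hk (s + δ) hi).sub (H.tendsto_le hZ (s + δ) hδ hi)
      rw [sub_zero] at this
      exact this
    · filter_upwards [hi, eventually_gt_atTop k] with N h1 h2
      rw [sub_le_iff_le_add]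
      exact (measureReal_mono (farEvent_subset H hn h2 h1 s δ)).trans (measureReal_union_le _ _)

lemma tendsto_prob_logExcess_pair (H : Setup f C K gx gy g cx cy c) (hZ : IsIID Z (law f) P)
    (hn : CountFamily gx gy g k Z nx ny) (s : ℝ) {i j : ℕ → ℕ}
    (hi : ∀ᶠ N in atTop, i N < N) (hj : ∀ᶠ N in atTop, j N < N) (hij : ∀ᶠ N in atTop, i N ≠ j N) :
    Tendsto (fun N => P.real {ω | s < logExcess f cx cy c Z nx ny N (i N) ω ∧
      s < logExcess f cx cy c Z nx ny N (j N) ω}) atTop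
      (𝓝 (poissonLt k (Real.exp s) * poissonLt k (Real.exp s))) := by
  refine tendsto_of_sandwich (F := fun s => poissonLt k (Real.exp s) * poissonLt k (Real.exp s))
    ((continuous_poissonLt_exp k).mul (continuous_poissonLt_exp k)).continuousAt
    (fun δ hδ => ?_) (fun δ hδ => ?_)
  · refine ⟨fun N => P.real (farEvent f g c k Z (s - δ) N (i N) ∩ farEvent f g c k Z (s - δ) N (j N)) +
      (P.real (manyEvent f gx gy cx cy c Z (s - δ) δ N (i N)) +
        P.real (manyEvent f gx gy cx cy c Z (s - δ) δ N (j N))), ?_, ?_⟩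
    · have := (H.tendsto_far_pair hZ k (s - δ) hi hj hij).add
        ((H.tendsto_ge hZ (s - δ) hδ hi).add (H.tendsto_ge hZ (s - δ) hδ hj))
      rw [add_zero, add_zero] at this
      exact this
    · filter_upwards [hi, hj, eventually_gt_atTop k] with N h1 h1' h2
      refine le_trans (measureReal_mono (s₂ := (farEvent f g c k Z (s - δ) N (i N) ∩
        farEvent f g c k Z (s - δ) N (j N)) ∪ (manyEvent f gx gy cx cy c Z (s - δ) δ N (i N) ∪
        manyEvent f gx gy cx cy c Z (s - δ) δ N (j N))) ?_) ?_
      · rintro ω ⟨ha, hb⟩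
        have ha' := lt_logExcess_subset H hn h2 h1 s δ ha
        have hb' := lt_logExcess_subset H hn h2 h1' s δ hb
        simp only [Set.mem_union, Set.mem_inter_iff] at ha' hb' ⊢
        tauto
      · exact (measureReal_union_le _ _).trans (add_le_add le_rfl (measureReal_union_le _ _))
  · refine ⟨fun N => P.real (farEvent f g c k Z (s + δ) N (i N) ∩ farEvent f g c k Z (s + δ) N (j N)) -
      (P.real (fewEvent f gx gy cx cy c Z (s + δ) δ N (i N)) +
        P.real (fewEvent f gx gy cx cy c Z (s + δ) δ N (j N))), ?_, ?_⟩
    · have := (H.tendsto_far_pair hZ k (s + δ) hi hj hij).sub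
        ((H.tendsto_le hZ (s + δ) hδ hi).add (H.tendsto_le hZ (s + δ) hδ hj))
      rw [add_zero, sub_zero] at this
      exact this
    · filter_upwards [hi, hj, eventually_gt_atTop k] with N h1 h1' h2
      rw [sub_le_iff_le_add]
      refine le_trans (measureReal_mono (s₂ := {ω | s < logExcess f cx cy c Z nx ny N (i N) ω ∧
        s < logExcess f cx cy c Z nx ny N (j N) ω} ∪ (fewEvent f gx gy cx cy c Z (s + δ) δ N (i N) ∪
        fewEvent f gx gy cx cy c Z (s + δ) δ N (j N))) ?_) ?_
      · rintro ω ⟨ha, hb⟩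
        have ha' := farEvent_subset H hn h2 h1 s δ ha
        have hb' := farEvent_subset H hn h2 h1' s δ hb
        simp only [Set.mem_union, Set.mem_ofPred_eq] at ha' hb' ⊢
        tauto
      · exact (measureReal_union_le _ _).trans (add_le_add le_rfl (measureReal_union_le _ _))

lemma CountFamily.measurable_logCounts (hn : CountFamily gx gy g k Z nx ny) (N i : ℕ) :
    Measurable fun ω => logCounts N (nx N i ω) (ny N i ω) := by
  have h1 : Measurable fun ω => (nx N i ω : ℝ) := measurable_from_nat.comp (hn.measurable_x N i)
  have h2 : Measurable fun ω => (ny N i ω : ℝ) := measurable_from_nat.comp (hn.measurable_y N i)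
  unfold logCounts
  fun_prop

lemma integrable_logCentre (H : Setup f C K gx gy g cx cy c)
    (hent : Integrable fun z => f z * |Real.log (f z)|) :
    Integrable (logCentre f cx cy c) (law f) ∧
      ∫ z, logCentre f cx cy c z ∂(law f) = -mutualInfo f + Real.log (cx * cy / c) := by
  have hprob := H.dens.isProbabilityMeasure_law
  obtain ⟨-, h1, h2⟩ := H.dens.integrable_logRatio H.cond hent
  refine ⟨h1.add (integrable_const _), ?_⟩
  unfold logCentre
  rw [integral_add h1 (integrable_const _), h2]
  simp

omit [IsProbabilityMeasure P] in
lemma IsIID.measurePreserving {E : Type*} [MeasurableSpace E] {Z : ℕ → Ω → E} {μ : Measure E}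
    (hZ : IsIID Z μ P) (i : ℕ) : MeasurePreserving (Z i) P μ := ⟨hZ.measurable i, hZ.map_eq i⟩

omit [IsProbabilityMeasure P] in
lemma max_abs_sub_le (a b M : ℝ) :
    max (|a - b| - (M + M)) 0 ≤ max (|a| - M) 0 + max (|b| - M) 0 := by
  have h1 := abs_sub a b
  have h2 := le_max_left (|a| - M) 0
  have h3 := le_max_left (|b| - M) 0
  have h4 := le_max_right (|a| - M) 0
  have h5 := le_max_right (|b| - M) 0
  exact max_le (by linarith) (by linarith)

/-- The weak law applies with the log-Gamma law of shape k as limit, whose mean is ψ(k). Uniform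
integrability combines the common tail of the count logarithms with one fixed integrable law for the
centring. -/
lemma tendsto_average_logExcess (H : Setup f C K gx gy g cx cy c) (hZ : IsIID Z (law f) P)
    (hk : 1 ≤ k) (hent : Integrable fun z => f z * |Real.log (f z)|)
    (hn : CountFamily gx gy g k Z nx ny) :
    Tendsto (fun N : ℕ => ∫ ω, |1 / (N : ℝ) *
      ∑ i ∈ Finset.range N, logExcess f cx cy c Z nx ny N i ω - digamma k| ∂P) atTop (𝓝 0) := by
  obtain ⟨m, rfl⟩ : ∃ m, k = m + 1 := ⟨k - 1, by omega⟩
  obtain ⟨q, hq, htail⟩ := H.exists_tail (P := P) hk hent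
  have hcm := H.measurable_logCentre
  have hci := (integrable_logCentre H hent).1
  have hprob := H.dens.isProbabilityMeasure_law
  have hciZ : ∀ i, Integrable (fun ω => logCentre f cx cy c (Z i ω)) P := fun i =>
    (hZ.measurePreserving i).integrable_comp_of_integrable hci
  have ht : ∀ N, m + 1 < N → ∀ i < N, ∀ t : ℝ, 0 ≤ t →
      P.real {ω | t < |logCounts N (nx N i ω) (ny N i ω)|} ≤ q t := fun N hN i hi =>
    htail Z hZ N i (by omega) hi _ _ (hn.counts N hN i hi)
  have hli : ∀ N, m + 1 < N → ∀ i < N,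
      Integrable (fun ω => logCounts N (nx N i ω) (ny N i ω)) P := fun N hN i hi =>
    integrable_of_tail (hn.measurable_logCounts N i) hq (ht N hN i hi)
  have key := tendsto_integral_average (P := P) (T := logExcess f cx cy c Z nx ny)
    (γ := logErlang m) (fun N i => ?_) (integrable_logErlang m) (fun s i hi => ?_)
    (fun s i j hi hj hij => ?_) ?_ ?_
  · rw [integral_logErlang] at key
    push_cast
    exact key
  · exact (hn.measurable_logCounts N i).sub (hcm.comp (hZ.measurable i))
  · rw [logErlang_Ioi]
    exact tendsto_prob_logExcess H hZ hk hn s hi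
  · rw [logErlang_Ioi]
    exact tendsto_prob_logExcess_pair H hZ hn s hi hj hij
  · filter_upwards [eventually_gt_atTop (m + 1)] with N hN i hi
    exact (hli N hN i hi).sub (hciZ i)
  · intro η hη
    have h1 := (tendsto_integral_Ioi_atTop hq).eventually_le_const (half_pos hη)
    have h2 := (tendsto_integral_excess hci).eventually_le_const (half_pos hη)
    have h3 : ∀ᶠ M : ℝ in atTop, ∀ᶠ N in atTop, ∀ i < N,
        ∫ ω, max (|logExcess f cx cy c Z nx ny N i ω| - (M + M)) 0 ∂P ≤ η := by
      filter_upwards [h1, h2, eventually_ge_atTop 0] with M h1 h2 hM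
      filter_upwards [eventually_gt_atTop (m + 1)] with N hN i hi
      have e1 := integrable_excess (hli N hN i hi) M
      have e2 := integrable_excess (hciZ i) M
      have e3 : ∫ ω, max (|logCentre f cx cy c (Z i ω)| - M) 0 ∂P =
          ∫ z, max (|logCentre f cx cy c z| - M) 0 ∂(law f) := by
        rw [← hZ.map_eq i, integral_map (hZ.measurable i).aemeasurable]
        exact Measurable.aestronglyMeasurable (by fun_prop)
      refine (integral_mono (integrable_excess ((hli N hN i hi).sub (hciZ i)) _) (e1.add e2)
        fun ω => max_abs_sub_le _ _ M).trans ?_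
      rw [integral_add' e1 e2, e3]
      have := integral_excess_le (hn.measurable_logCounts N i) hq (ht N hN i hi) hM
      linarith
    have h4 : Tendsto (fun M : ℝ => M / 2) atTop atTop := tendsto_id.atTop_div_const two_pos
    filter_upwards [h4.eventually h3] with M hM
    simpa using hM

/-- The centring terms are genuinely i.i.d. and integrable, so the strong law in L¹ applies. -/
lemma tendsto_average_logCentre (H : Setup f C K gx gy g cx cy c) (hZ : IsIID Z (law f) P)
    (hent : Integrable fun z => f z * |Real.log (f z)|) :
    Tendsto (fun N : ℕ => ∫ ω, |1 / (N : ℝ) * ∑ i ∈ Finset.range N, logCentre f cx cy c (Z i ω) -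
      (-mutualInfo f + Real.log (cx * cy / c))| ∂P) atTop (𝓝 0) := by
  obtain ⟨hci, hcI⟩ := integrable_logCentre H hent
  have hcm := H.measurable_logCentre
  have hciZ : ∀ i, Integrable (fun ω => logCentre f cx cy c (Z i ω)) P := fun i =>
    (hZ.measurePreserving i).integrable_comp_of_integrable hci
  have h := strong_law_Lp (μ := P) le_rfl ENNReal.one_ne_top
    (fun i ω => logCentre f cx cy c (Z i ω)) (memLp_one_iff_integrable.2 (hciZ 0))
    (fun i j hij => (hZ.indep.indepFun hij).comp hcm hcm)
    (fun i => (IdentDistrib.mk (hZ.measurable i).aemeasurable (hZ.measurable 0).aemeasurable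
      ((hZ.map_eq i).trans (hZ.map_eq 0).symm)).comp hcm)
  have hmean : ∫ ω, logCentre f cx cy c (Z 0 ω) ∂P = -mutualInfo f + Real.log (cx * cy / c) := by
    rw [← hcI, ← hZ.map_eq 0, integral_map (hZ.measurable 0).aemeasurable hcm.aestronglyMeasurable]
  rw [hmean] at h
  have h' := (ENNReal.tendsto_toReal ENNReal.zero_ne_top).comp h
  refine h'.congr fun N => ?_
  have hm : AEStronglyMeasurable (fun ω => (N : ℝ)⁻¹ •
      (∑ i ∈ Finset.range N, logCentre f cx cy c (Z i ω)) -
        (-mutualInfo f + Real.log (cx * cy / c))) P :=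
    (((integrable_finsetSum _ fun i _ => hciZ i).smul ((N : ℝ)⁻¹)).sub
      (integrable_const _)).aestronglyMeasurable
  simp only [Function.comp_apply]
  rw [eLpNorm_one_eq_lintegral_enorm, ← integral_norm_eq_lintegral_enorm hm]
  simp [one_div]

lemma integrable_average_logExcess (H : Setup f C K gx gy g cx cy c) (hZ : IsIID Z (law f) P)
    (hk : 1 ≤ k) (hent : Integrable fun z => f z * |Real.log (f z)|)
    (hn : CountFamily gx gy g k Z nx ny) {N : ℕ} (hN : k < N) :
    Integrable (fun ω => 1 / (N : ℝ) * ∑ i ∈ Finset.range N,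
      logCounts N (nx N i ω) (ny N i ω)) P := by
  obtain ⟨q, hq, htail⟩ := H.exists_tail (P := P) hk hent
  exact (integrable_finsetSum _ fun i hi => integrable_of_tail (hn.measurable_logCounts N i) hq
    (htail Z hZ N i (by omega) (Finset.mem_range.1 hi) _ _
      (hn.counts N hN i (Finset.mem_range.1 hi)))).const_mul _

omit [IsProbabilityMeasure P] in
lemma integral_abs_le_add {u v w : Ω → ℝ} (hu : Integrable u P) (hv : Integrable v P)
    (h : ∀ ω, |w ω| ≤ |u ω| + |v ω|) :
    ∫ ω, |w ω| ∂P ≤ ∫ ω, |u ω| ∂P + ∫ ω, |v ω| ∂P := by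
  rw [← integral_add hu.abs hv.abs]
  exact integral_mono_of_nonneg (ae_of_all _ fun ω => abs_nonneg _) (hu.abs.add hv.abs)
    (ae_of_all _ h)

/-- The averages of `log (nx ny / N)` converge in `L¹`. -/
lemma tendsto_average_logCounts (H : Setup f C K gx gy g cx cy c) (hZ : IsIID Z (law f) P)
    (hk : 1 ≤ k) (hent : Integrable fun z => f z * |Real.log (f z)|)
    (hn : CountFamily gx gy g k Z nx ny) :
    Tendsto (fun N : ℕ => ∫ ω, |1 / (N : ℝ) *
      ∑ i ∈ Finset.range N, logCounts N (nx N i ω) (ny N i ω) -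
        (digamma k + (-mutualInfo f + Real.log (cx * cy / c)))| ∂P) atTop (𝓝 0) := by
  have h1 := tendsto_average_logExcess H hZ hk hent hn
  have h2 := tendsto_average_logCentre H hZ hent
  have h3 := h1.add h2
  rw [add_zero] at h3
  refine squeeze_zero' (Eventually.of_forall fun N => integral_nonneg fun ω => abs_nonneg _) ?_ h3
  filter_upwards [eventually_gt_atTop k] with N hN
  have hciZ : Integrable (fun ω => 1 / (N : ℝ) *
      ∑ i ∈ Finset.range N, logCentre f cx cy c (Z i ω)) P :=
    (integrable_finsetSum _ fun i _ => (hZ.measurePreserving i).integrable_comp_of_integrable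
      (integrable_logCentre H hent).1).const_mul _
  have hl := integrable_average_logExcess H hZ hk hent hn hN
  have e : ∀ ω, 1 / (N : ℝ) * ∑ i ∈ Finset.range N, logExcess f cx cy c Z nx ny N i ω =
      1 / (N : ℝ) * ∑ i ∈ Finset.range N, logCounts N (nx N i ω) (ny N i ω) -
      1 / (N : ℝ) * ∑ i ∈ Finset.range N, logCentre f cx cy c (Z i ω) := by
    intro ω
    simp only [logExcess]
    rw [Finset.sum_sub_distrib, mul_sub]
  simp_rw [e]
  refine integral_abs_le_add ((hl.sub hciZ).sub (integrable_const _))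
    (hciZ.sub (integrable_const _)) fun ω => ?_
  refine le_trans (le_of_eq ?_) (abs_add_le _ _)
  congr 1
  ring

/-- Unless the k-th neighbour is closer than level s, the count `n` dominates the level-s count `l`,
which diverges in probability. The exceptional probability tends to 1 - `poissonLt k (exp s)`, which
is small for s near -∞. -/
lemma tendsto_prob_count_le (H : Setup f C K gx gy g cx cy c) (hZ : IsIID Z (law f) P)
    (hk : 1 ≤ k) {n : ℕ → ℕ → Ω → ℕ} {l : ℝ → ℕ → ℕ → Ω → ℕ}
    (hln : ∀ s N i ω, k < N → i < N → cntAt Z N i (levelBall f g c N s) ω < k →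
      l s N i ω ≤ n N i ω) (m : ℝ) {i : ℕ → ℕ} (hi : ∀ᶠ N in atTop, i N < N)
    (hl : ∀ s, Tendsto (fun N => P.real {ω | (l s N (i N) ω : ℝ) ≤ m}) atTop (𝓝 0)) :
    Tendsto (fun N => P.real {ω | (n N (i N) ω : ℝ) ≤ m}) atTop (𝓝 0) := by
  have h0 : Tendsto (fun s : ℝ => 1 - poissonLt k (Real.exp s)) atBot (𝓝 0) := by
    have := (((continuous_poissonLt k).tendsto 0).comp Real.tendsto_exp_atBot).const_sub 1
    rw [poissonLt_zero hk, sub_self] at this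
    exact this
  refine tendsto_order.2 ⟨fun a ha => Eventually.of_forall fun N => ha.trans_le measureReal_nonneg,
    fun a ha => ?_⟩
  obtain ⟨s, hs⟩ := (h0.eventually_lt_const ha).exists
  have h1 := ((H.tendsto_far hZ hk s hi).const_sub 1).add (hl s)
  rw [add_zero] at h1
  filter_upwards [h1.eventually_lt_const hs, hi, eventually_gt_atTop k] with N h2 h3 h4
  refine lt_of_le_of_lt ?_ h2
  have hm : MeasurableSet (farEvent f g c k Z s N (i N)) :=
    measurableSet_lt (hZ.measurable_cntAt N (i N) (B := levelBall f g c N s)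
      (H.measurableSet_gball_rad N s)) measurable_const
  have h5 : P.real (farEvent f g c k Z s N (i N))ᶜ =
      1 - P.real (farEvent f g c k Z s N (i N)) := probReal_compl_eq_one_sub hm
  refine le_trans (measureReal_mono (s₂ := (farEvent f g c k Z s N (i N))ᶜ ∪
    {ω | (l s N (i N) ω : ℝ) ≤ m}) fun ω hω => ?_) ((measureReal_union_le _ _).trans
    (add_le_add h5.le le_rfl))
  by_cases hf : ω ∈ farEvent f g c k Z s N (i N)
  · right
    have : (l s N (i N) ω : ℝ) ≤ n N (i N) ω := by exact_mod_cast hln s N (i N) ω h4 h3 hf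
    exact this.trans hω
  · exact Or.inl hf

/-- The integrand is at most 1 on the unlikely event that the count is at most 2/a, and below a/2
off it. -/
lemma tendsto_integral_inv {n : ℕ → Ω → ℕ} (hm : ∀ N, Measurable (n N))
    (h1 : ∀ᶠ N in atTop, ∀ ω, 1 ≤ n N ω)
    (h : ∀ m : ℝ, Tendsto (fun N => P.real {ω | (n N ω : ℝ) ≤ m}) atTop (𝓝 0)) :
    Tendsto (fun N => ∫ ω, 1 / (n N ω : ℝ) ∂P) atTop (𝓝 0) := by
  refine tendsto_order.2 ⟨fun a ha => Eventually.of_forall fun N =>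
    ha.trans_le (integral_nonneg fun ω => by positivity), fun a ha => ?_⟩
  have ha2 : 0 < a / 2 := by positivity
  filter_upwards [(h (2 / a)).eventually_lt_const ha2, h1] with N h2 h3
  have hset : MeasurableSet {ω | (n N ω : ℝ) ≤ 2 / a} :=
    measurableSet_le (measurable_from_nat.comp (hm N)) measurable_const
  have hi : Integrable ({ω | (n N ω : ℝ) ≤ 2 / a}.indicator fun _ => (1 : ℝ)) P :=
    (integrable_const 1).indicator hset
  have hle : ∫ ω, 1 / (n N ω : ℝ) ∂P ≤
      ∫ ω, ({ω | (n N ω : ℝ) ≤ 2 / a}.indicator (fun _ => (1 : ℝ)) ω + a / 2) ∂P := by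
    refine integral_mono_of_nonneg (ae_of_all _ fun ω => by positivity)
      (hi.add (integrable_const _)) (ae_of_all _ fun ω => ?_)
    have hpos : (1 : ℝ) ≤ n N ω := by exact_mod_cast h3 ω
    dsimp only
    by_cases hω : (n N ω : ℝ) ≤ 2 / a
    · rw [Set.indicator_of_mem (by exact hω)]
      have : 1 / (n N ω : ℝ) ≤ 1 := by
        rw [div_le_one (by linarith)]
        exact hpos
      linarith
    · rw [Set.indicator_of_notMem (by exact hω), zero_add, div_le_iff₀ (by linarith)]
      rw [not_le, div_lt_iff₀ ha] at hω
      linarith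
  rw [integral_add hi (integrable_const _), integral_indicator_const _ hset] at hle
  simp only [smul_eq_mul, mul_one, integral_const, probReal_univ, one_mul] at hle
  linarith

/-- Replacing `log n` by `ψ (n + 1)` does not change averages over diverging counts. -/
lemma tendsto_average_digamma {n : ℕ → ℕ → Ω → ℕ} (hm : ∀ N i, Measurable (n N i))
    (h1 : ∀ᶠ N in atTop, ∀ i < N, ∀ ω, 1 ≤ n N i ω)
    (h : ∀ (m : ℝ) (i : ℕ → ℕ), (∀ᶠ N in atTop, i N < N) →
      Tendsto (fun N => P.real {ω | (n N (i N) ω : ℝ) ≤ m}) atTop (𝓝 0)) :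
    (∀ᶠ N in atTop, ∀ i < N,
      Integrable (fun ω => digamma (n N i ω + 1) - Real.log (n N i ω)) P) ∧
    Tendsto (fun N : ℕ => ∫ ω, |1 / (N : ℝ) * ∑ i ∈ Finset.range N,
      (digamma (n N i ω + 1) - Real.log (n N i ω))| ∂P) atTop (𝓝 0) := by
  have hmeas : ∀ N i, Measurable fun ω => digamma (n N i ω + 1) - Real.log (n N i ω) := fun N i =>
    (measurable_from_nat (f := fun n : ℕ => digamma (n + 1) - Real.log n)).comp (hm N i)
  have hle1 : ∀ x : ℕ, 1 ≤ x → 1 / (x : ℝ) ≤ 1 := fun x hx => by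
    have : (1 : ℝ) ≤ x := by exact_mod_cast hx
    rw [div_le_one (by linarith)]
    exact this
  have hint : ∀ᶠ N in atTop, ∀ i < N,
      Integrable (fun ω => digamma (n N i ω + 1) - Real.log (n N i ω)) P := by
    filter_upwards [h1] with N hN i hi
    exact Integrable.of_bound (hmeas N i).aestronglyMeasurable 1 (ae_of_all _ fun ω =>
      (abs_digamma_sub_log_le (hN i hi ω)).trans (hle1 _ (hN i hi ω)))
  refine ⟨hint, ?_⟩
  have key := tendsto_average_of_sequences (a := fun N i => ∫ ω, 1 / (n N i ω : ℝ) ∂P) (L := 0)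
    fun i hi => tendsto_integral_inv (fun N => hm N (i N)) (by
      filter_upwards [hi, h1] with N h2 h3 ω using h3 _ h2 ω) fun m => h m i hi
  refine squeeze_zero' (Eventually.of_forall fun N => integral_nonneg fun ω => abs_nonneg _) ?_ key
  filter_upwards [h1] with N hN
  have hinv : ∀ i ∈ Finset.range N, Integrable (fun ω => 1 / (n N i ω : ℝ)) P := fun i hi =>
    Integrable.of_bound ((measurable_from_nat (f := fun n : ℕ => 1 / (n : ℝ))).comp
      (hm N i)).aestronglyMeasurable 1 (ae_of_all _ fun ω => by
        rw [Real.norm_of_nonneg (by positivity)]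
        exact hle1 _ (hN i (Finset.mem_range.1 hi) ω))
  have hrhs : 1 / (N : ℝ) * ∑ i ∈ Finset.range N, |∫ ω, 1 / (n N i ω : ℝ) ∂P - 0| =
      ∫ ω, 1 / (N : ℝ) * ∑ i ∈ Finset.range N, 1 / (n N i ω : ℝ) ∂P := by
    rw [integral_const_mul, integral_finsetSum _ hinv]
    congr 1
    refine Finset.sum_congr rfl fun i _ => ?_
    rw [sub_zero, abs_of_nonneg (integral_nonneg fun ω => by positivity)]
  rw [hrhs]
  refine integral_mono_of_nonneg (ae_of_all _ fun ω => abs_nonneg _)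
    ((integrable_finsetSum _ hinv).const_mul _) (ae_of_all _ fun ω => ?_)
  dsimp only
  rw [abs_mul, abs_of_nonneg (by positivity : 0 ≤ 1 / (N : ℝ))]
  gcongr
  exact (Finset.abs_sum_le_sum_abs _ _).trans (Finset.sum_le_sum fun i hi =>
    abs_digamma_sub_log_le (hN i (Finset.mem_range.1 hi) ω))

/-- The averages of `ψ (nx + 1) + ψ (ny + 1) - log N` converge in `L¹`. -/
lemma tendsto_average_digamma_counts (H : Setup f C K gx gy g cx cy c) (hZ : IsIID Z (law f) P)
    (hk : 1 ≤ k) (hent : Integrable fun z => f z * |Real.log (f z)|)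
    (hn : CountFamily gx gy g k Z nx ny) :
    (∀ᶠ N : ℕ in atTop, Integrable (fun ω => 1 / (N : ℝ) *
      ∑ i ∈ Finset.range N, (digamma (nx N i ω + 1) + digamma (ny N i ω + 1) - Real.log N)) P) ∧
    Tendsto (fun N : ℕ => ∫ ω, |1 / (N : ℝ) *
      ∑ i ∈ Finset.range N, (digamma (nx N i ω + 1) + digamma (ny N i ω + 1) - Real.log N) -
        (digamma k + (-mutualInfo f + Real.log (cx * cy / c)))| ∂P) atTop (𝓝 0) := by
  obtain ⟨ix, hx⟩ := tendsto_average_digamma (P := P) hn.measurable_x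
    ((eventually_gt_atTop k).mono fun N hN i hi ω => (hn.counts N hN i hi ω).x_pos)
    (fun m i hi => tendsto_prob_count_le H hZ hk
      (l := fun s N i ω => cntAt Z N i (levelX f gx c N s) ω)
      (fun s N i ω hN hi h => ((hn.counts N hN i hi ω).ge_of _ (rad_nonneg' H N s (Z i ω)) h).1)
      m hi fun s => H.tendsto_x_le hZ s m hi)
  obtain ⟨iy, hy⟩ := tendsto_average_digamma (P := P) hn.measurable_y
    ((eventually_gt_atTop k).mono fun N hN i hi ω => (hn.counts N hN i hi ω).y_pos)
    (fun m i hi => tendsto_prob_count_le H hZ hk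
      (l := fun s N i ω => cntAt Z N i (levelY f gy c N s) ω)
      (fun s N i ω hN hi h => ((hn.counts N hN i hi ω).ge_of _ (rad_nonneg' H N s (Z i ω)) h).2)
      m hi fun s => H.tendsto_y_le hZ s m hi)
  have e : ∀ (N : ℕ) ω, 1 / (N : ℝ) * ∑ i ∈ Finset.range N,
      (digamma (nx N i ω + 1) + digamma (ny N i ω + 1) - Real.log N) =
      1 / (N : ℝ) * ∑ i ∈ Finset.range N, logCounts N (nx N i ω) (ny N i ω) +
      (1 / (N : ℝ) * ∑ i ∈ Finset.range N, (digamma (nx N i ω + 1) - Real.log (nx N i ω)) +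
      1 / (N : ℝ) * ∑ i ∈ Finset.range N, (digamma (ny N i ω + 1) - Real.log (ny N i ω))) := by
    intro N ω
    rw [← average_add, ← average_add]
    congr 1
    refine Finset.sum_congr rfl fun i _ => ?_
    rw [logCounts]
    ring
  have hix : ∀ᶠ N : ℕ in atTop, Integrable (fun ω => 1 / (N : ℝ) * ∑ i ∈ Finset.range N,
      (digamma (nx N i ω + 1) - Real.log (nx N i ω))) P := by
    filter_upwards [ix] with N h
    exact (integrable_finsetSum _ fun i hi => h i (Finset.mem_range.1 hi)).const_mul _
  have hiy : ∀ᶠ N : ℕ in atTop, Integrable (fun ω => 1 / (N : ℝ) * ∑ i ∈ Finset.range N,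
      (digamma (ny N i ω + 1) - Real.log (ny N i ω))) P := by
    filter_upwards [iy] with N h
    exact (integrable_finsetSum _ fun i hi => h i (Finset.mem_range.1 hi)).const_mul _
  refine ⟨?_, ?_⟩
  · filter_upwards [hix, hiy, eventually_gt_atTop k] with N h1 h2 hN
    simp_rw [e]
    exact (integrable_average_logExcess H hZ hk hent hn hN).add (h1.add h2)
  · have h3 := (tendsto_average_logCounts H hZ hk hent hn).add (hx.add hy)
    rw [add_zero, add_zero] at h3
    refine squeeze_zero' (Eventually.of_forall fun N => integral_nonneg fun ω => abs_nonneg _) ?_ h3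
    filter_upwards [hix, hiy, eventually_gt_atTop k] with N h1 h2 hN
    refine (integral_abs_le_add ((integrable_average_logExcess H hZ hk hent hn hN).sub
      (integrable_const (digamma k + (-mutualInfo f + Real.log (cx * cy / c))))) (h1.add h2)
      fun ω => ?_).trans (add_le_add le_rfl (integral_abs_le_add h1 h2 fun ω => abs_add_le _ _))
    rw [e]
    refine le_trans (le_of_eq ?_) (abs_add_le _ _)
    simp only [Pi.sub_apply, Pi.add_apply]
    congr 1
    ring

lemma tendsto_prob_of_integral_abs {W : ℕ → Ω → ℝ} (hW : ∀ᶠ N in atTop, Integrable (W N) P)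
    (h : Tendsto (fun N => ∫ ω, |W N ω| ∂P) atTop (𝓝 0)) {ε : ℝ} (hε : 0 < ε) :
    Tendsto (fun N => P {ω | ε < |W N ω|}) atTop (𝓝 0) := by
  have h1 : Tendsto (fun N => P.real {ω | ε < |W N ω|}) atTop (𝓝 0) := by
    have h2 := h.const_mul (1 / ε)
    rw [mul_zero] at h2
    refine squeeze_zero' (Eventually.of_forall fun N => measureReal_nonneg) ?_ h2
    filter_upwards [hW] with N hN
    have h3 := mul_meas_ge_le_integral_of_nonneg (ae_of_all P fun ω => abs_nonneg (W N ω)) hN.abs ε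
    have h4 : P.real {ω | ε < |W N ω|} ≤ P.real {ω | ε ≤ |W N ω|} :=
      measureReal_mono fun ω (hω : ε < |W N ω|) => hω.le
    rw [one_div, ← div_eq_inv_mul, le_div_iff₀ hε]
    nlinarith
  refine (ENNReal.tendsto_toReal_iff (fun N => measure_ne_top _ _) ENNReal.zero_ne_top).1 ?_
  simpa [Measure.real] using h1

end Excess

/-! ### Nearest neighbour distances and the counts they define -/

section NearestNeighbours

variable {dx dy : ℕ} {gx : (Fin dx → ℝ) → ℝ} {gy : (Fin dy → ℝ) → ℝ}
  {g : (Fin dx → ℝ) × (Fin dy → ℝ) → ℝ}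

/-- The distance, with respect to the gauge `g`, from `z` to its `k`-th nearest sample point. -/
def knnRadius (g : (Fin dx → ℝ) × (Fin dy → ℝ) → ℝ) (k : ℕ) (S : Finset ℕ)
    (z : (Fin dx → ℝ) × (Fin dy → ℝ)) (w : S → (Fin dx → ℝ) × (Fin dy → ℝ)) : ℝ :=
  sInf {r : ℝ | 0 ≤ r ∧ k ≤ cnt S (gball g z r) w}

/-- The count reaches k exactly when r bounds the gauge values of some k or more points: a finite
union of closed conditions. Hence the infimum defining the k-th distance is attained. -/
lemma isClosed_cnt_gball (k : ℕ) (S : Finset ℕ) (z : (Fin dx → ℝ) × (Fin dy → ℝ))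
    (w : S → (Fin dx → ℝ) × (Fin dy → ℝ)) :
    IsClosed {r : ℝ | 0 ≤ r ∧ k ≤ cnt S (gball g z r) w} := by
  classical
  have h : {r : ℝ | k ≤ cnt S (gball g z r) w} =
      ⋃ T : {T : Finset S // k ≤ T.card}, ⋂ j ∈ T.1, Set.Ici (g (w j - z)) := by
    ext r
    simp only [Set.mem_ofPred_eq, Set.mem_iUnion, Set.mem_iInter, Set.mem_Ici]
    constructor
    · intro hr
      refine ⟨⟨_, hr⟩, fun j hj => ?_⟩
      simp only [Finset.mem_filter] at hj
      exact hj.2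
    · rintro ⟨T, hT⟩
      refine T.2.trans (Finset.card_le_card fun j hj => ?_)
      simp only [Finset.mem_filter, Finset.mem_univ, true_and]
      exact hT j hj
  have h2 : IsClosed {r : ℝ | k ≤ cnt S (gball g z r) w} := by
    rw [h]
    exact isClosed_iUnion_of_finite fun T => isClosed_biInter fun j _ => isClosed_Ici
  exact isClosed_Ici.inter h2

lemma knnRadius_mem {k : ℕ} {S : Finset ℕ} (hk : k ≤ S.card) (z : (Fin dx → ℝ) × (Fin dy → ℝ))
    (w : S → (Fin dx → ℝ) × (Fin dy → ℝ)) :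
    0 ≤ knnRadius g k S z w ∧ k ≤ cnt S (gball g z (knnRadius g k S z w)) w := by
  classical
  -- The sum of all gauge values is a radius that captures every sample point.
  refine (isClosed_cnt_gball k S z w).csInf_mem ⟨∑ j : S, |g (w j - z)|, ?_, ?_⟩
    ⟨0, fun r hr => hr.1⟩
  · positivity
  · refine hk.trans (le_of_eq ?_)
    rw [cnt, Finset.filter_true_of_mem, Finset.card_univ, Fintype.card_coe]
    intro j _
    exact (le_abs_self _).trans
      (Finset.single_le_sum (f := fun j : S => |g (w j - z)|) (fun _ _ => abs_nonneg _)
        (Finset.mem_univ j))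

lemma knnRadius_le_iff {k : ℕ} {S : Finset ℕ} (hk : k ≤ S.card)
    (z : (Fin dx → ℝ) × (Fin dy → ℝ)) (w : S → (Fin dx → ℝ) × (Fin dy → ℝ)) {r : ℝ} (hr : 0 ≤ r) :
    knnRadius g k S z w ≤ r ↔ k ≤ cnt S (gball g z r) w :=
  ⟨fun h => (knnRadius_mem hk z w).2.trans (cnt_mono S (gball_mono z h) w),
    fun h => csInf_le ⟨0, fun _ hr => hr.1⟩ ⟨hr, h⟩⟩

lemma measurable_knnRadius (hg : Measurable g) {k : ℕ} {S : Finset ℕ} (hk : k ≤ S.card) :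
    Measurable fun q : ((Fin dx → ℝ) × (Fin dy → ℝ)) × (S → (Fin dx → ℝ) × (Fin dy → ℝ)) =>
      knnRadius g k S q.1 q.2 := by
  refine measurable_of_Iic fun r => ?_
  rcases lt_or_ge r 0 with hr | hr
  · convert MeasurableSet.empty
    ext q
    simp only [Set.mem_preimage, Set.mem_Iic, Set.mem_empty_iff_false, iff_false, not_le]
    exact hr.trans_le (knnRadius_mem hk q.1 q.2).1
  · have hm : MeasurableSet {q : ((Fin dx → ℝ) × (Fin dy → ℝ)) ×
        (S → (Fin dx → ℝ) × (Fin dy → ℝ)) | k ≤ cnt S (gball g q.1 r) q.2} :=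
      measurableSet_le measurable_const (measurable_cnt_nat S (B := fun z => gball g z r)
        (measurableSet_le (hg.comp (measurable_snd.sub measurable_fst)) measurable_const))
    convert hm using 1
    ext q
    exact knnRadius_le_iff hk q.1 q.2 hr

/-- Monotonicity of the cylinders in the radius gives the comparisons. Positivity holds because the
k points in the joint ball also lie in both cylinders. -/
lemma knnCounts_knnRadius (hx : ∀ v, gx v.1 ≤ g v) (hy : ∀ v, gy v.2 ≤ g v) {k : ℕ} (hk : 1 ≤ k)
    {S : Finset ℕ} (hkS : k ≤ S.card) (z : (Fin dx → ℝ) × (Fin dy → ℝ))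
    (w : S → (Fin dx → ℝ) × (Fin dy → ℝ)) :
    KnnCounts gx gy g k S z w (cnt S (xball gx z (knnRadius g k S z w)) w)
      (cnt S (yball gy z (knnRadius g k S z w)) w) := by
  classical
  have hxm : ∀ {r r' : ℝ}, r ≤ r' → xball (dy := dy) gx z r ⊆ xball gx z r' := fun h _ hw =>
    gball_mono z.1 h hw
  have hym : ∀ {r r' : ℝ}, r ≤ r' → yball (dx := dx) gy z r ⊆ yball gy z r' := fun h _ hw =>
    gball_mono z.2 h hw
  have hmem := knnRadius_mem (g := g) hkS z w
  have hle : ∀ B : Set ((Fin dx → ℝ) × (Fin dy → ℝ)), cnt S B w ≤ S.card := fun B =>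
    (Finset.card_filter_le _ _).trans (by simp)
  refine ⟨fun r hr h => ?_, fun r hr h => ?_, ?_, ?_, hle _, hle _⟩
  · have := (knnRadius_le_iff hkS z w hr).2 h
    exact ⟨cnt_mono S (hxm this) w, cnt_mono S (hym this) w⟩
  · have : r ≤ knnRadius g k S z w := by
      by_contra hcon
      exact absurd ((knnRadius_le_iff hkS z w hr).1 (not_le.1 hcon).le) (not_le.2 h)
    exact ⟨cnt_mono S (hxm this) w, cnt_mono S (hym this) w⟩
  · exact hk.trans (hmem.2.trans (cnt_mono S (fun v hv => (hx (v - z)).trans hv) w))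
  · exact hk.trans (hmem.2.trans (cnt_mono S (fun v hv => (hy (v - z)).trans hv) w))

variable {Ω : Type*} [MeasurableSpace Ω] {P : Measure Ω}
  {Z : ℕ → Ω → (Fin dx → ℝ) × (Fin dy → ℝ)}

/-- The number of the other sample points in the cylinder over the first coordinate whose radius is
the nearest neighbour distance. -/
def countX (gx : (Fin dx → ℝ) → ℝ) (g : (Fin dx → ℝ) × (Fin dy → ℝ) → ℝ) (k : ℕ)
    (Z : ℕ → Ω → (Fin dx → ℝ) × (Fin dy → ℝ)) (N i : ℕ) (ω : Ω) : ℕ :=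
  -- The constant default keeps the count measurable for every N and i; `CountFamily` constrains the
  -- values only when k < N and i < N.
  if k < N ∧ i < N then cnt (others N i) (xball gx (Z i ω) (knnRadius g k (others N i) (Z i ω)
    (restrictSample Z (others N i) ω))) (restrictSample Z (others N i) ω) else 1

/-- The number of the other sample points in the cylinder over the second coordinate whose radius is
the nearest neighbour distance. -/
def countY (gy : (Fin dy → ℝ) → ℝ) (g : (Fin dx → ℝ) × (Fin dy → ℝ) → ℝ) (k : ℕ)
    (Z : ℕ → Ω → (Fin dx → ℝ) × (Fin dy → ℝ)) (N i : ℕ) (ω : Ω) : ℕ :=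
  if k < N ∧ i < N then cnt (others N i) (yball gy (Z i ω) (knnRadius g k (others N i) (Z i ω)
    (restrictSample Z (others N i) ω))) (restrictSample Z (others N i) ω) else 1

lemma measurable_cnt_knnRadius [IsProbabilityMeasure P] {μ : Measure ((Fin dx → ℝ) × (Fin dy → ℝ))}
    (hZ : IsIID Z μ P)
    (hg : Measurable g) {k N i : ℕ} (hk : k ≤ (others N i).card)
    {B : ((Fin dx → ℝ) × (Fin dy → ℝ)) × ℝ → Set ((Fin dx → ℝ) × (Fin dy → ℝ))}
    (hB : MeasurableSet {q : (((Fin dx → ℝ) × (Fin dy → ℝ)) × ℝ) × ((Fin dx → ℝ) × (Fin dy → ℝ)) |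
      q.2 ∈ B q.1}) :
    Measurable fun ω => cnt (others N i) (B (Z i ω, knnRadius g k (others N i) (Z i ω)
      (restrictSample Z (others N i) ω))) (restrictSample Z (others N i) ω) := by
  have h1 := hZ.measurable i
  have h2 := hZ.measurable_restrictSample (others N i)
  exact (measurable_cnt_nat (others N i) (B := B) hB).comp
    ((h1.prodMk ((measurable_knnRadius hg hk).comp (h1.prodMk h2))).prodMk h2)

lemma countFamily [IsProbabilityMeasure P] {μ : Measure ((Fin dx → ℝ) × (Fin dy → ℝ))}
    (hZ : IsIID Z μ P) (hgx : Measurable gx)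
    (hgy : Measurable gy) (hg : Measurable g) (hx : ∀ v, gx v.1 ≤ g v) (hy : ∀ v, gy v.2 ≤ g v)
    {k : ℕ} (hk : 1 ≤ k) : CountFamily gx gy g k Z (countX gx g k Z) (countY gy g k Z) := by
  refine ⟨fun N i => ?_, fun N i => ?_, fun N hN i hi ω => ?_⟩
  · by_cases h : k < N ∧ i < N
    · unfold countX
      simp only [if_pos h]
      refine measurable_cnt_knnRadius hZ hg (by rw [card_others h.2]; omega)
        (B := fun q => xball gx q.1 q.2) (measurableSet_le (hgx.comp ?_) ?_) <;> fun_prop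
    · unfold countX
      simp only [if_neg h]
      exact measurable_const
  · by_cases h : k < N ∧ i < N
    · unfold countY
      simp only [if_pos h]
      refine measurable_cnt_knnRadius hZ hg (by rw [card_others h.2]; omega)
        (B := fun q => yball gy q.1 q.2) (measurableSet_le (hgy.comp ?_) ?_) <;> fun_prop
    · unfold countY
      simp only [if_neg h]
      exact measurable_const
  · rw [countX, countY, if_pos ⟨hN, hi⟩, if_pos ⟨hN, hi⟩]
    exact knnCounts_knnRadius hx hy hk (by rw [card_others hi]; omega) _ _

lemma ncard_fin_eq_cnt {E : Type*} (Z : ℕ → Ω → E) {N i : ℕ} (hi : i < N) (B : Set E) (ω : Ω) :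
    {j : Fin N | j ≠ ⟨i, hi⟩ ∧ Z j ω ∈ B}.ncard =
      cnt (others N i) B (restrictSample Z (others N i) ω) := by
  classical
  rw [cnt_restrictSample, ← Set.ncard_coe_finset, ← Set.ncard_image_of_injective _ Fin.val_injective]
  congr 1
  ext j
  simp only [Set.mem_image, Set.mem_ofPred_eq, Finset.coe_filter, others, Finset.mem_erase,
    Finset.mem_range]
  constructor
  · rintro ⟨j, ⟨h1, h2⟩, rfl⟩
    exact ⟨⟨fun h => h1 (Fin.ext h), j.2⟩, h2⟩
  · rintro ⟨⟨h1, h2⟩, h3⟩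
    exact ⟨⟨j, h2⟩, ⟨fun h => h1 (congrArg Fin.val h), h3⟩, rfl⟩

end NearestNeighbours

/-! ### The Euclidean and maximum norms as gauges -/

section Norms

/-- The `ℓ_p` norm on a product of coordinate spaces. -/
def jointNorm {dx dy : ℕ} (p : ℝ≥0∞) (v : (Fin dx → ℝ) × (Fin dy → ℝ)) : ℝ :=
  vecNorm p (Sum.elim v.1 v.2)

/-- The balls of the `ℓ_p` norm have volume `b d r ^ d` in dimension `d`, and the norm dominates
that of the two halves of a vector. -/
structure IsBallVolume (p : ℝ≥0∞) (b : ℕ → ℝ) : Prop where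
  pos : ∀ d, 0 < b d
  volume : ∀ (ι : Type) [Fintype ι] [Nonempty ι] (r : ℝ), 0 ≤ r →
    volume.real {v : ι → ℝ | vecNorm p v ≤ r} = b (Fintype.card ι) * r ^ Fintype.card ι
  inl_le : ∀ (ι κ : Type) [Fintype ι] [Fintype κ] (v : ι → ℝ) (w : κ → ℝ),
    vecNorm p v ≤ vecNorm p (Sum.elim v w)
  inr_le : ∀ (ι κ : Type) [Fintype ι] [Fintype κ] (v : ι → ℝ) (w : κ → ℝ),
    vecNorm p w ≤ vecNorm p (Sum.elim v w)

lemma unitBallVol_pos (d : ℕ) : 0 < unitBallVol d := by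
  unfold unitBallVol
  have := Real.Gamma_pos_of_pos (by positivity : (0 : ℝ) < (d : ℝ) / 2 + 1)
  positivity

lemma vecNorm_two {ι : Type*} [Fintype ι] (v : ι → ℝ) : vecNorm 2 v = √(∑ i, v i ^ 2) := by
  rw [vecNorm, EuclideanSpace.norm_eq]
  simp

lemma vecNorm_top {ι : Type*} [Fintype ι] (v : ι → ℝ) : vecNorm ⊤ v = ‖v‖ := by
  rw [vecNorm, PiLp.norm_toLp]

lemma isBallVolume_two : IsBallVolume 2 unitBallVol where
  pos := unitBallVol_pos
  volume ι _ _ r hr := by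
    have h1 : {v : ι → ℝ | vecNorm 2 v ≤ r} =
        (WithLp.toLp 2) ⁻¹' (Metric.closedBall (0 : EuclideanSpace ℝ ι) r) := by
      ext v
      simp [vecNorm]
    rw [h1, Measure.real, (PiLp.volume_preserving_toLp ι).measure_preimage
      measurableSet_closedBall.nullMeasurableSet, EuclideanSpace.volume_closedBall,
      ENNReal.toReal_mul, ENNReal.toReal_pow, ENNReal.toReal_ofReal hr, mul_comm, unitBallVol]
    have hG := Real.Gamma_pos_of_pos (by positivity : (0 : ℝ) < (Fintype.card ι : ℝ) / 2 + 1)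
    rw [ENNReal.toReal_ofReal (by positivity)]
    congr 2
    rw [Real.sqrt_eq_rpow, ← Real.rpow_natCast, ← Real.rpow_mul Real.pi_pos.le]
    congr 1
    ring
  inl_le ι κ _ _ v w := by
    rw [vecNorm_two, vecNorm_two, Fintype.sum_sum_type]
    refine Real.sqrt_le_sqrt ?_
    simp only [Sum.elim_inl, Sum.elim_inr]
    have : 0 ≤ ∑ i, w i ^ 2 := by positivity
    linarith
  inr_le ι κ _ _ v w := by
    rw [vecNorm_two, vecNorm_two, Fintype.sum_sum_type]
    refine Real.sqrt_le_sqrt ?_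
    simp only [Sum.elim_inl, Sum.elim_inr]
    have : 0 ≤ ∑ i, v i ^ 2 := by positivity
    linarith

lemma isBallVolume_top : IsBallVolume ⊤ (fun d => 2 ^ d) where
  pos d := by positivity
  volume ι _ _ r hr := by
    have h1 : {v : ι → ℝ | vecNorm ⊤ v ≤ r} = Metric.closedBall 0 r := by
      ext v
      simp [vecNorm_top]
    rw [h1, Measure.real, Real.volume_pi_closedBall _ hr, ENNReal.toReal_ofReal (by positivity),
      mul_pow]
  inl_le ι κ _ _ v w := by
    rw [vecNorm_top, vecNorm_top]
    exact (pi_norm_le_iff_of_nonneg (norm_nonneg _)).2 fun i => norm_le_pi_norm (Sum.elim v w) (.inl i)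
  inr_le ι κ _ _ v w := by
    rw [vecNorm_top, vecNorm_top]
    exact (pi_norm_le_iff_of_nonneg (norm_nonneg _)).2 fun i => norm_le_pi_norm (Sum.elim v w) (.inr i)

variable {p : ℝ≥0∞} [Fact (1 ≤ p)]

lemma measurable_vecNorm {ι : Type*} [Fintype ι] : Measurable (vecNorm (ι := ι) p) :=
  ((PiLp.continuous_toLp p (fun _ : ι => ℝ)).norm).measurable

lemma vecNorm_neg {ι : Type*} [Fintype ι] (v : ι → ℝ) : vecNorm p (-v) = vecNorm p v := by
  rw [vecNorm, vecNorm, WithLp.toLp_neg, norm_neg]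

lemma norm_le_vecNorm {ι : Type*} [Fintype ι] (v : ι → ℝ) : ‖v‖ ≤ vecNorm p v :=
  (pi_norm_le_iff_of_nonneg (norm_nonneg _)).2 fun i => PiLp.norm_apply_le (WithLp.toLp p v) i

lemma IsBallVolume.isGauge {b : ℕ → ℝ} (h : IsBallVolume p b) {d : ℕ} (hd : 1 ≤ d) :
    IsGauge (vecNorm (ι := Fin d) p) (b d) d where
  measurable := measurable_vecNorm
  norm_le := norm_le_vecNorm
  neg := vecNorm_neg
  pos := h.pos d
  volume_le r hr := by
    have : Nonempty (Fin d) := ⟨⟨0, hd⟩⟩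
    simpa using h.volume (Fin d) r hr

lemma IsBallVolume.isGauge_joint {b : ℕ → ℝ} (h : IsBallVolume p b) {dx dy : ℕ} (hd : 1 ≤ dx) :
    IsGauge (jointNorm (dx := dx) (dy := dy) p) (b (dx + dy)) (dx + dy) where
  measurable := measurable_vecNorm.comp (measurable_pi_iff.2 (by
    rintro (i | i)
    · exact (measurable_pi_apply i).comp measurable_fst
    · exact (measurable_pi_apply i).comp measurable_snd))
  norm_le v := by
    refine max_le ((norm_le_vecNorm v.1).trans (h.inl_le _ _ _ _))
      ((norm_le_vecNorm v.2).trans (h.inr_le _ _ _ _))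
  neg v := by
    rw [jointNorm, jointNorm, ← vecNorm_neg]
    congr 1
    ext (i | i) <;> simp
  pos := h.pos _
  volume_le r hr := by
    have : Nonempty (Fin dx) := ⟨⟨0, hd⟩⟩
    have h1 := h.volume (Fin dx ⊕ Fin dy) r hr
    rw [Fintype.card_sum, Fintype.card_fin, Fintype.card_fin] at h1
    rw [← h1, Measure.real, Measure.real, ← (volume_measurePreserving_sumPiEquivProdPi_symm
      (fun _ : Fin dx ⊕ Fin dy => ℝ)).measure_preimage
      (measurableSet_le measurable_vecNorm measurable_const).nullMeasurableSet]
    congr 2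

end Norms

/-! ### The two estimators and their consistency -/

section Estimators

variable {dx dy : ℕ} {Ω : Type*} [MeasurableSpace Ω] {X : ℕ → Ω → Fin dx → ℝ}
  {Y : ℕ → Ω → Fin dy → ℝ}

lemma knnDist_eq (p : ℝ≥0∞) (k : ℕ) {N i : ℕ} (hi : i < N) (ω : Ω) :
    knnDist p k (fun j : Fin N => X j ω) (fun j : Fin N => Y j ω) ⟨i, hi⟩ =
      knnRadius (jointNorm p) k (others N i) (X i ω, Y i ω)
        (restrictSample (fun n ω => (X n ω, Y n ω)) (others N i) ω) := by
  rw [knnDist, knnRadius]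
  congr 1
  ext r
  rw [Set.mem_ofPred_eq, Set.mem_ofPred_eq, ← ncard_fin_eq_cnt _ hi]
  exact Iff.rfl

lemma nX_eq (p : ℝ≥0∞) {k N i : ℕ} (hk : k < N) (hi : i < N) (ω : Ω) :
    nX p k (fun j : Fin N => X j ω) (fun j : Fin N => Y j ω) ⟨i, hi⟩ =
      countX (vecNorm p) (jointNorm p) k (fun n ω => (X n ω, Y n ω)) N i ω := by
  rw [countX, if_pos ⟨hk, hi⟩, ← ncard_fin_eq_cnt _ hi, nX, knnDist_eq]
  rfl

lemma nY_eq (p : ℝ≥0∞) {k N i : ℕ} (hk : k < N) (hi : i < N) (ω : Ω) :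
    nY p k (fun j : Fin N => X j ω) (fun j : Fin N => Y j ω) ⟨i, hi⟩ =
      countY (vecNorm p) (jointNorm p) k (fun n ω => (X n ω, Y n ω)) N i ω := by
  rw [countY, if_pos ⟨hk, hi⟩, ← ncard_fin_eq_cnt _ hi, nY, knnDist_eq]
  rfl

lemma sum_fin_counts (p : ℝ≥0∞) {k N : ℕ} (hk : k < N) (ω : Ω) (F : ℕ → ℕ → ℝ) :
    ∑ i : Fin N, F (nX p k (fun j : Fin N => X j ω) (fun j : Fin N => Y j ω) i)
        (nY p k (fun j : Fin N => X j ω) (fun j : Fin N => Y j ω) i) =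
      ∑ i ∈ Finset.range N, F (countX (vecNorm p) (jointNorm p) k (fun n ω => (X n ω, Y n ω)) N i ω)
        (countY (vecNorm p) (jointNorm p) k (fun n ω => (X n ω, Y n ω)) N i ω) := by
  rw [← Fin.sum_univ_eq_sum_range (fun i =>
    F (countX (vecNorm p) (jointNorm p) k (fun n ω => (X n ω, Y n ω)) N i ω)
      (countY (vecNorm p) (jointNorm p) k (fun n ω => (X n ω, Y n ω)) N i ω))]
  refine Finset.sum_congr rfl fun i _ => ?_
  rw [← nX_eq p hk i.2, ← nY_eq p hk i.2]

lemma average_sub_const {N : ℕ} (hN : 1 ≤ N) (a : ℕ → ℝ) (L : ℝ) :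
    1 / (N : ℝ) * ∑ i ∈ Finset.range N, (a i - L) =
      1 / (N : ℝ) * ∑ i ∈ Finset.range N, a i - L := (average_sub hN a L).symm

variable {P : Measure Ω} [IsProbabilityMeasure P] {f : (Fin dx → ℝ) × (Fin dy → ℝ) → ℝ} {k : ℕ}

/-- The estimation error is, up to sign, the centred average of log(nx ny / N), with log N absorbed
into the average. -/
lemma tendsto_biKsgEstimator {C K : ℝ} (hk : 1 ≤ k)
    (H : Setup f C K (vecNorm 2) (vecNorm 2) (jointNorm 2) (unitBallVol dx) (unitBallVol dy)
      (unitBallVol (dx + dy))) (hZ : IsIID (fun n ω => (X n ω, Y n ω)) (law f) P)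
    (hent : Integrable fun z => f z * |Real.log (f z)|) {ε : ℝ} (hε : 0 < ε) :
    Tendsto (fun N : ℕ => P {ω | ε <
      |biKsgEstimator k (fun i : Fin N => X i ω) (fun i : Fin N => Y i ω) - mutualInfo f|})
      atTop (𝓝 0) := by
  have hn := countFamily hZ H.gauge_x.measurable H.gauge_y.measurable H.gauge.measurable H.fst_le
    H.snd_le hk
  have key := tendsto_prob_of_integral_abs ((eventually_gt_atTop k).mono fun N hN =>
    (integrable_average_logExcess H hZ hk hent hn hN).sub (integrable_const _))
    (tendsto_average_logCounts H hZ hk hent hn) hε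
  refine key.congr' ?_
  filter_upwards [eventually_gt_atTop k] with N hN
  congr 1
  ext ω
  simp only [Set.mem_ofPred_eq]
  rw [← abs_neg, biKsgEstimator,
    sum_fin_counts 2 hN ω fun a b => Real.log a + Real.log b]
  simp only [logCounts, Pi.sub_apply]
  rw [average_sub_const (by omega)]
  ring_nf

lemma tendsto_ksgEstimator {C K : ℝ} (hk : 1 ≤ k)
    (H : Setup f C K (vecNorm ⊤) (vecNorm ⊤) (jointNorm ⊤) (2 ^ dx) (2 ^ dy) (2 ^ (dx + dy)))
    (hZ : IsIID (fun n ω => (X n ω, Y n ω)) (law f) P)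
    (hent : Integrable fun z => f z * |Real.log (f z)|) {ε : ℝ} (hε : 0 < ε) :
    Tendsto (fun N : ℕ => P {ω | ε <
      |ksgEstimator k (fun i : Fin N => X i ω) (fun i : Fin N => Y i ω) - mutualInfo f|})
      atTop (𝓝 0) := by
  have hn := countFamily hZ H.gauge_x.measurable H.gauge_y.measurable H.gauge.measurable H.fst_le
    H.snd_le hk
  obtain ⟨h1, h2⟩ := tendsto_average_digamma_counts H hZ hk hent hn
  have key := tendsto_prob_of_integral_abs (h1.mono fun N hN => hN.sub (integrable_const _)) h2 hε
  refine key.congr' ?_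
  filter_upwards [eventually_gt_atTop k] with N hN
  congr 1
  ext ω
  simp only [Set.mem_ofPred_eq]
  rw [← abs_neg, ksgEstimator,
    sum_fin_counts ⊤ hN ω fun a b => digamma (a + 1) + digamma (b + 1)]
  simp only [Pi.sub_apply]
  -- For the maximum norm the volume of a product of balls is the product of the volumes, so the
  -- logarithmic correction vanishes.
  have hone : (2 : ℝ) ^ dx * 2 ^ dy / 2 ^ (dx + dy) = 1 := by
    rw [pow_add, div_self (by positivity)]
  rw [average_sub_const (by omega), hone, Real.log_one]
  ring_nf

end Estimators

end KSG

end

theorem mainTheorem1 {dx dy : ℕ} (hdx : 1 ≤ dx) (hdy : 1 ≤ dy)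
    (k : ℕ) (hk : max ((dx : ℝ) / dy) ((dy : ℝ) / dx) < k)
    -- the joint density
    (f : (Fin dx → ℝ) × (Fin dy → ℝ) → ℝ) (hf_nonneg : ∀ z, 0 ≤ f z)
    -- an i.i.d. sequence of samples with density `f`
    {Ω : Type*} [MeasurableSpace Ω] (P : Measure Ω) [IsProbabilityMeasure P]
    (X : ℕ → Ω → Fin dx → ℝ) (Y : ℕ → Ω → Fin dy → ℝ)
    (hX : ∀ n, Measurable (X n)) (hY : ∀ n, Measurable (Y n))
    (hlaw : ∀ n, P.map (fun ω => (X n ω, Y n ω)) =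
      (volume : Measure ((Fin dx → ℝ) × (Fin dy → ℝ))).withDensity (fun z => ENNReal.ofReal (f z)))
    (hindep : iIndepFun (fun n ω => (X n ω, Y n ω)) P)
    -- (a) the joint entropy integral converges absolutely
    (hent : Integrable (fun z => f z * |Real.log (f z)|))
    -- (b) the conditional densities are bounded
    (hcond : ∃ C' : ℝ, ∀ᵐ z : (Fin dx → ℝ) × (Fin dy → ℝ),
      KSG.condYX f z.1 z.2 < C' ∧ KSG.condXY f z.1 z.2 < C')
    -- (c) the joint density is twice continuously differentiable with bounded Hessian
    (hsmooth : ContDiff ℝ 2 f)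
    (hhess : ∃ C : ℝ, ∀ᵐ z : (Fin dx → ℝ) × (Fin dy → ℝ), KSG.matNorm (KSG.hessian f z) < C) :
    -- the marginal entropy integrals converge, so that `I(X;Y)` is well defined
    (Integrable (fun x => KSG.marginalX f x * Real.log (KSG.marginalX f x)) ∧
      Integrable (fun y => KSG.marginalY f y * Real.log (KSG.marginalY f y))) ∧
    (∀ ε : ℝ, 0 < ε → Tendsto (fun N : ℕ => P {ω | ε <
      |KSG.ksgEstimator k (fun i : Fin N => X i ω) (fun i : Fin N => Y i ω)
        - KSG.mutualInfo f|}) atTop (𝓝 0)) ∧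
    (∀ ε : ℝ, 0 < ε → Tendsto (fun N : ℕ => P {ω | ε <
      |KSG.biKsgEstimator k (fun i : Fin N => X i ω) (fun i : Fin N => Y i ω)
        - KSG.mutualInfo f|}) atTop (𝓝 0)) := by 
  obtain ⟨C, hC⟩ := hcond
  obtain ⟨K, hK, hsemi⟩ := KSG.exists_semiconvex hsmooth hhess
  -- The ratios of dimensions are nonnegative, so the strict lower bound on `k` makes it positive.
  have hk1 : 1 ≤ k := by
    have h1 : (0 : ℝ) ≤ (dx : ℝ) / dy := by positivity
    have h2 : (0 : ℝ) < k := (h1.trans (le_max_left _ _)).trans_lt hk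
    exact_mod_cast h2
  have hZ : KSG.IsIID (fun n ω => (X n ω, Y n ω)) (KSG.law f) P :=
    ⟨fun n => (hX n).prodMk (hY n), hindep, hlaw⟩
  have hdens : KSG.IsDensity f := KSG.isDensity_of_isProbabilityMeasure hf_nonneg
    hsmooth.continuous.measurable hZ.isProbabilityMeasure
  have hb := hdens.boundedCond hC
  have hsetup : ∀ {p : ℝ≥0∞} [Fact (1 ≤ p)] {b : ℕ → ℝ}, KSG.IsBallVolume p b →
      KSG.Setup f C K (KSG.vecNorm p) (KSG.vecNorm p) (KSG.jointNorm p) (b dx) (b dy)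
        (b (dx + dy)) := fun h =>
    ⟨hdx, hdy, hdens, hb, hK, hsemi, h.isGauge hdx, h.isGauge hdy, h.isGauge_joint hdx,
      fun v => h.inl_le _ _ v.1 v.2, fun v => h.inr_le _ _ v.1 v.2⟩
  exact ⟨(hdens.integrable_logRatio hb hent).1,
    fun ε hε => KSG.tendsto_ksgEstimator hk1 (hsetup KSG.isBallVolume_top) hZ hent hε,
    fun ε hε => KSG.tendsto_biKsgEstimator hk1 (hsetup KSG.isBallVolume_two) hZ hent hε⟩
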